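/- Let $0<\alpha<1$, $\rho_0,\rho_1>0$, $\xi_\delta>0$, $u_0,u_1\in\mathbb R$. Consider the generalized Chaplygin gas system $$\partial_t\rho+\partial_x(\rho u)=0,\qquad \partial_t(\rho u)+\partial_x(\rho u^2-\rho^{-\alpha})=0,$$ with characteristic speeds $\lambda_{1,2}=u\mp\sqrt\alpha\,\rho^{-\frac{1+\alpha}2}$ and energy density $\eta=\frac12\rho u^2+\frac1{1+\alpha}\rho^{-\alpha}$, and the delta Riemann data $$(\rho,u)(x,0)=\begin{cases}(\rho_0,u_0),&x<0\\(\rho_1,u_1),&x>0\end{cases}\;+\;(\xi_\delta,0)\,\delta .$$ For $\mu>0$ and $u_\delta\in\mathbb R$ the data are replaced by the piecewise constant function equal to $(\rho_0,u_0)$ for $x<-\frac\mu2$, to $(\xi_\delta/\mu,u_\delta)$ for $-\frac\mu2<x<\frac\mu2$, and to $(\rho_1,u_1)$ for $x>\frac\mu2$. *Solutions for fixed $\mu$.* A solution, on a short time interval, is a net $U^\varepsilon$ ($\varepsilon\to0$) which satisfies the system with these data in the distributional limit $\varepsilon\to0$, and which consists of a solution of the Riemann problem at $x=-\frac\mu2$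 and one of the Riemann problem at $x=\frac\mu2$. Each of the two is either a 1-wave followed by a 2-wave (Lax shocks or centred rarefaction waves, possibly trivial), or an overcompressive shadow wave: with $x$ measured from the centre and some speed $c$, it equals the left state $U_l$ for $x<(c-\frac\varepsilon2)t$, a state $U_{0,\varepsilon}$ for $(c-\frac\varepsilon2)t<x<ct$, a state $U_{1,\varepsilon}$ for $ct<x<(c+\frac\varepsilon2)t$ and the right state $U_r$ for $x>(c+\frac\varepsilon2)t$, where $\lambda_2(U_r)\le c\le\lambda_1(U_l)$ and, with $W=(\rho,\rho u)$, $F=(\rho u,\rho u^2-\rho^{-\alpha})$ and $[\cdot]$ the jump from $U_l$ to $U_r$, as $\varepsilon\to0$, $$-c[W]+[F]+\tfrac\varepsilon2\big(W(U_{0,\varepsilon})+W(U_{1,\varepsilon})\big)\to0,\qquad \tfrac\varepsilon2\sum_{i=0,1}\big(c\,W(U_{i,\varepsilon})-F(U_{i,\varepsilon})\big)\to0 .$$ For $L>0$ let $H_{[-L,L]}(t)=\lim_{\varepsilon\to0}\int_{-L}^L\eta(U^\varepsilon(x,t))\,dx$. A solution is (energy) admissible if $\frac{d}{dt}H_{[-L,L]}(0+)$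 exists and is minimal among all solutions with the same $\mu$ and $u_\delta$. *Backward energy condition.* An admissible solution of the delta Riemann problem corresponding to $u_\delta$ is a family $U=(U_\mu)$ such that, for all small $\mu$, $U_\mu$ is admissible for $\mu$ and $u_\delta$ ($u_\delta$ not depending on $\mu$). It has minimal dissipation if, for every admissible solution $\tilde U$ corresponding to any other value $\tilde u_\delta$, $$\tfrac{d}{dt}H_{[-L,L]}(\tilde U_\mu)(0+)\le\tfrac{d}{dt}H_{[-L,L]}(U_\mu)(0+)\quad\text{for all sufficiently small }\mu .$$ It satisfies the backward energy condition if it has minimal dissipation and if, compared with every other solution of minimal dissipation, its total initial energy in $[-L,L]$ is not larger for all sufficiently small $\mu$. **Theorem.** Put $A_2=u_0+\frac{2\sqrt\alpha}{1+\alpha}\rho_0^{-\frac{1+\alpha}2}$ and $B_1=u_1-\frac{2\sqrt\alpha}{1+\alpha}\rho_1^{-\frac{1+\alpha}2}$. There is $u_\delta\in[\min\{A_2,B_1\},\max\{A_2,B_1\}]$ and a corresponding admissible solution that satisfies the backward energy condition for every $L>0$. Moreover, for every $L>0$, this $u_\delta$ is the only real value to which a solution satisfying the backward energy condition corresponds,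 and the solution is weakly unique: for any two solutions $U,V$ satisfying the condition and all sufficiently small $\mu$, the nets $U_\mu$ and $V_\mu$ have, as $\varepsilon\to0$, the same distributional limit of $(\rho,\rho u)$ at all sufficiently small times. -/

import Mathlib

open Set Filter Topology MeasureTheory
open scoped ContDiff

noncomputable section

namespace GenChaplygin

/-- A state `(ρ, u)`: density and velocity. -/
abbrev State := ℝ × ℝ

/-- The conserved quantities `(ρ, ρ u)`. -/
def conserved (U : State) : ℝ × ℝ := (U.1, U.1 * U.2)

/-- The flux `(ρ u, ρ u² - ρ^{-α})` of the generalized Chaplygin system. -/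
def flux (α : ℝ) (U : State) : ℝ × ℝ := (U.1 * U.2, U.1 * U.2 ^ 2 - U.1 ^ (-α))

/-- The physical energy density `η = ρ u² / 2 + ρ^{-α} / (1 + α)`. -/
def energy (α : ℝ) (U : State) : ℝ := 1 / 2 * U.1 * U.2 ^ 2 + 1 / (1 + α) * U.1 ^ (-α)

/-- The smaller characteristic speed `u - √(p'(ρ))`, with `p(ρ) = -ρ^{-α}`. -/
def lam₁ (α : ℝ) (U : State) : ℝ := U.2 - √α * U.1 ^ (-((1 + α) / 2))

/-- The larger characteristic speed `u + √(p'(ρ))`, with `p(ρ) = -ρ^{-α}`. -/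
def lam₂ (α : ℝ) (U : State) : ℝ := U.2 + √α * U.1 ^ (-((1 + α) / 2))

/-! ### Elementary waves -/

/-- The Rankine--Hugoniot conditions for a jump from `Ul` to `Ur` moving with speed `s`. -/
def RankineHugoniot (α : ℝ) (Ul Ur : State) (s : ℝ) : Prop :=
  flux α Ur - flux α Ul = s • (conserved Ur - conserved Ul)

/-- A Lax 1-shock from `Ul` (left) to `Ur` (right) with speed `s`. -/
def IsShock₁ (α : ℝ) (Ul Ur : State) (s : ℝ) : Prop :=
  RankineHugoniot α Ul Ur s ∧ lam₁ α Ur < s ∧ s < lam₁ α Ul ∧ s < lam₂ α Ur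

/-- A Lax 2-shock from `Ul` (left) to `Ur` (right) with speed `s`. -/
def IsShock₂ (α : ℝ) (Ul Ur : State) (s : ℝ) : Prop :=
  RankineHugoniot α Ul Ur s ∧ lam₂ α Ur < s ∧ s < lam₂ α Ul ∧ lam₁ α Ul < s

/-- A centred rarefaction wave of the family with characteristic speed `lam`: a continuous
self-similar solution `w(x/t)`, `a ≤ x/t ≤ b`, from `Ul` to `Ur` with `lam (w ζ) = ζ`.
The case `a = b` is the trivial wave `Ul = Ur`. -/
def IsRarefaction (α : ℝ) (lam : State → ℝ) (Ul Ur : State) (a b : ℝ) (w : ℝ → State) : Prop :=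
  a ≤ b ∧ w a = Ul ∧ w b = Ur ∧ ContinuousOn w (Icc a b) ∧
  (∀ ζ ∈ Icc a b, 0 < (w ζ).1 ∧ lam (w ζ) = ζ) ∧
  ∀ ζ ∈ Ioo a b, DifferentiableAt ℝ w ζ ∧
    deriv (fun z => flux α (w z)) ζ = ζ • deriv (fun z => conserved (w z)) ζ

/-- A wave of the first family (`S₁` or `R₁`) filling the sector `a ≤ x/t ≤ b`. -/
def IsWave₁ (α : ℝ) (Ul Ur : State) (a b : ℝ) (w : ℝ → State) : Prop :=
  (a = b ∧ IsShock₁ α Ul Ur a) ∨ IsRarefaction α (lam₁ α) Ul Ur a b w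

/-- A wave of the second family (`S₂` or `R₂`) filling the sector `a ≤ x/t ≤ b`. -/
def IsWave₂ (α : ℝ) (Ul Ur : State) (a b : ℝ) (w : ℝ → State) : Prop :=
  (a = b ∧ IsShock₂ α Ul Ur a) ∨ IsRarefaction α (lam₂ α) Ul Ur a b w

/-- The self-similar profile, as a function of `ζ = x/t`, of two waves separated by the
constant state `Um`. -/
def fanProfile (Ul Um Ur : State) (a₁ b₁ a₂ b₂ : ℝ) (w₁ w₂ : ℝ → State) (ζ : ℝ) : State :=
  if ζ ≤ a₁ then Ul
  else if ζ < b₁ then w₁ ζ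
  else if ζ ≤ a₂ then Um
  else if ζ < b₂ then w₂ ζ
  else Ur

/-! ### Solutions of Riemann problems

A self-similar net is a map `V : ε ↦ (ζ ↦ V ε ζ)`; it stands for the net of functions
`(x, t) ↦ V ε (x/t)`, `ε > 0`. -/

/-- `V` is a classical solution of the Riemann problem `(Ul, Ur)`: a 1-wave followed by a
2-wave (it does not depend on `ε`). -/
def IsClassicalRiemann (α : ℝ) (Ul Ur : State) (V : ℝ → ℝ → State) : Prop :=
  ∃ (Um : State) (a₁ b₁ a₂ b₂ : ℝ) (w₁ w₂ : ℝ → State),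
    0 < Um.1 ∧ IsWave₁ α Ul Um a₁ b₁ w₁ ∧ IsWave₂ α Um Ur a₂ b₂ w₂ ∧ b₁ ≤ a₂ ∧
    ∀ ε > 0, ∀ ζ, V ε ζ = fanProfile Ul Um Ur a₁ b₁ a₂ b₂ w₁ w₂ ζ

/-- `V` is an overcompressive shadow wave joining `Ul` to `Ur` with speed `c` and intermediate
states `U₀ ε` (for `c - ε/2 < x/t < c`) and `U₁ ε` (for `c < x/t < c + ε/2`).
Overcompressive: `c ≤ lam₁ Ul < lam₂ Ul` and `lam₁ Ur < lam₂ Ur ≤ c`, so all characteristics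
run into the front.  The two limits are the generalized Rankine--Hugoniot conditions. -/
def IsShadowRiemann (α : ℝ) (Ul Ur : State) (V : ℝ → ℝ → State) : Prop :=
  ∃ (c : ℝ) (U₀ U₁ : ℝ → State),
    (∀ ε > 0, 0 < (U₀ ε).1 ∧ 0 < (U₁ ε).1) ∧
    c ≤ lam₁ α Ul ∧ lam₂ α Ur ≤ c ∧
    Tendsto (fun ε : ℝ => -(c • (conserved Ur - conserved Ul)) + (flux α Ur - flux α Ul)
        + (ε / 2) • (conserved (U₀ ε) + conserved (U₁ ε))) (𝓝[>] 0) (𝓝 0) ∧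
    Tendsto (fun ε : ℝ => (ε / 2) • (c • (conserved (U₀ ε) + conserved (U₁ ε))
        - (flux α (U₀ ε) + flux α (U₁ ε)))) (𝓝[>] 0) (𝓝 0) ∧
    ∀ ε > 0, ∀ ζ, V ε ζ =
      if ζ ≤ c - ε / 2 then Ul
      else if ζ < c then U₀ ε
      else if ζ < c + ε / 2 then U₁ ε
      else Ur

/-- Solutions of Riemann problems: classical ones and overcompressive shadow waves. -/
def IsRiemannSolution (α : ℝ) (Ul Ur : State) (V : ℝ → ℝ → State) : Prop :=
  IsClassicalRiemann α Ul Ur V ∨ IsShadowRiemann α Ul Ur V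

/-! ### The regularized problem, for fixed `μ` -/

/-- The piecewise constant approximation of the delta Riemann data: the point mass `ξ` is spread
over `(-μ/2, μ/2)` and is given the velocity `v`. -/
def initialData (Ul Ur : State) (ξ μ v : ℝ) (x : ℝ) : State :=
  if x < -(μ / 2) then Ul else if x < μ / 2 then (ξ / μ, v) else Ur

/-- The net `U : ε ↦ (x ↦ t ↦ U ε x t)` solves the system with initial data `Uin` for `t < T` in the
sense of distributions as `ε → 0`. -/
def IsApproxWeakSolution (α : ℝ) (Uin : ℝ → State) (T : ℝ) (U : ℝ → ℝ → ℝ → State) : Prop :=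
  ∀ φ : ℝ × ℝ → ℝ, ContDiff ℝ ∞ φ → HasCompactSupport φ → tsupport φ ⊆ {p | p.2 < T} →
    Tendsto (fun ε : ℝ =>
      (∫ p in {p : ℝ × ℝ | 0 < p.2},
        (fderiv ℝ φ p (0, 1) • conserved (U ε p.1 p.2)
          + fderiv ℝ φ p (1, 0) • flux α (U ε p.1 p.2)))
      + ∫ x : ℝ, φ (x, 0) • conserved (Uin x)) (𝓝[>] 0) (𝓝 0)

/-- `U` is a (short time) solution with initial data `initialData Ul Ur ξ μ v`: it consists of a
solution of the Riemann problem `(Ul, (ξ/μ, v))` centred at `-μ/2` and one of the Riemann problem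
`((ξ/μ, v), Ur)` centred at `μ/2`, up to some time `T > 0`, and solves the system weakly. -/
def IsSolution (α : ℝ) (Ul Ur : State) (ξ μ v : ℝ) (U : ℝ → ℝ → ℝ → State) : Prop :=
  ∃ T > 0, IsApproxWeakSolution α (initialData Ul Ur ξ μ v) T U ∧
    ∃ Vl Vr : ℝ → ℝ → State,
      IsRiemannSolution α Ul (ξ / μ, v) Vl ∧ IsRiemannSolution α (ξ / μ, v) Ur Vr ∧
      ∀ᶠ ε in 𝓝[>] (0 : ℝ), ∀ x,
        U ε x 0 = initialData Ul Ur ξ μ v x ∧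
        ∀ t ∈ Ioo 0 T, U ε x t =
          if x < 0 then Vl ε ((x + μ / 2) / t) else Vr ε ((x - μ / 2) / t)

/-- `H` is the total energy of the net `U` in `[-L, L]` at time `t`, i.e. the limit of
`∫_{-L}^{L} η(U ε x t) dx` as `ε → 0`. -/
def HasEnergy (α L : ℝ) (U : ℝ → ℝ → ℝ → State) (t H : ℝ) : Prop :=
  (∀ᶠ ε in 𝓝[>] (0 : ℝ), IntervalIntegrable (fun x => energy α (U ε x t)) volume (-L) L) ∧
  Tendsto (fun ε => ∫ x in (-L)..L, energy α (U ε x t)) (𝓝[>] 0) (𝓝 H)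

/-- The total energy of `U` in `[-L, L]` has time derivative `r` at `t = 0+`. -/
def HasEnergyRate (α L : ℝ) (U : ℝ → ℝ → ℝ → State) (r : ℝ) : Prop :=
  ∃ H : ℝ → ℝ, (∀ᶠ t in 𝓝[≥] (0 : ℝ), HasEnergy α L U t (H t)) ∧
    HasDerivWithinAt H r (Ici 0) 0

/-- Energy admissible solutions: the initial energy rate is minimal (energy is dissipated at the
highest rate) among all solutions with the same initial data. -/
def IsAdmissible (α L : ℝ) (Ul Ur : State) (ξ μ v : ℝ) (U : ℝ → ℝ → ℝ → State) : Prop :=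
  IsSolution α Ul Ur ξ μ v U ∧
  ∃ r, HasEnergyRate α L U r ∧
    ∀ V r', IsSolution α Ul Ur ξ μ v V → HasEnergyRate α L V r' → r ≤ r'

/-! ### The delta Riemann problem and the backward energy condition -/

/-- `U : μ ↦ U μ` is an admissible solution of the delta Riemann problem corresponding to the
value `v`. -/
def IsAdmissibleFamily (α L : ℝ) (Ul Ur : State) (ξ v : ℝ) (U : ℝ → ℝ → ℝ → ℝ → State) : Prop :=
  ∀ᶠ μ in 𝓝[>] (0 : ℝ), IsAdmissible α L Ul Ur ξ μ v (U μ)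

/-- `U` is an admissible solution corresponding to `v`, and its initial energy rate is, for small
`μ`, at least that of every admissible solution corresponding to any other value. -/
def HasMinimalDissipation (α L : ℝ) (Ul Ur : State) (ξ v : ℝ) (U : ℝ → ℝ → ℝ → ℝ → State) : Prop :=
  IsAdmissibleFamily α L Ul Ur ξ v U ∧
  ∀ v' U', IsAdmissibleFamily α L Ul Ur ξ v' U' →
    ∀ᶠ μ in 𝓝[>] (0 : ℝ), ∀ r r',
      HasEnergyRate α L (U μ) r → HasEnergyRate α L (U' μ) r' → r' ≤ r

/-- The total energy of the initial data in `[-L, L]`. -/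
def initialEnergy (α L : ℝ) (Ul Ur : State) (ξ μ v : ℝ) : ℝ :=
  ∫ x in (-L)..L, energy α (initialData Ul Ur ξ μ v x)

/-- The backward energy condition: minimal dissipation and, among the solutions with minimal
dissipation, minimal total initial energy. -/
def BackwardEnergyCondition (α L : ℝ) (Ul Ur : State) (ξ v : ℝ)
    (U : ℝ → ℝ → ℝ → ℝ → State) : Prop :=
  HasMinimalDissipation α L Ul Ur ξ v U ∧
  ∀ v' U', HasMinimalDissipation α L Ul Ur ξ v' U' →
    ∀ᶠ μ in 𝓝[>] (0 : ℝ), initialEnergy α L Ul Ur ξ μ v ≤ initialEnergy α L Ul Ur ξ μ v'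

/-- Two nets have the same distributional limit as `ε → 0` at all small times. -/
def WeaklyEqual (U V : ℝ → ℝ → ℝ → State) : Prop :=
  ∃ T > 0, ∀ t ∈ Ioo (0 : ℝ) T, ∀ ψ : ℝ → ℝ, Continuous ψ → HasCompactSupport ψ →
    Tendsto (fun ε => ∫ x : ℝ, ψ x • (conserved (U ε x t) - conserved (V ε x t)))
      (𝓝[>] 0) (𝓝 0)

/-- `A₂ = u₀ + (2√α/(1+α)) ρ₀^{-(1+α)/2}`. -/
def A₂ (α ρ₀ u₀ : ℝ) : ℝ := u₀ + 2 * √α / (1 + α) * ρ₀ ^ (-((1 + α) / 2))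

/-- `B₁ = u₁ - (2√α/(1+α)) ρ₁^{-(1+α)/2}`. -/
def B₁ (α ρ₁ u₁ : ℝ) : ℝ := u₁ - 2 * √α / (1 + α) * ρ₁ ^ (-((1 + α) / 2))

end GenChaplygin

end

set_option linter.unusedSectionVars false

noncomputable section

namespace GenChaplygin

/-! ### Powers -/

lemma rpow_lt_tangent {p y : ℝ} (hp : 0 < p) (hp' : p < 1) (hy : 0 ≤ y) (hy' : y ≠ 1) :
    y ^ p < 1 + p * (y - 1) := by
  have h := rpow_one_add_lt_one_add_mul_self (s := y - 1) (by linarith)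
    (sub_ne_zero.2 hy') hp hp'
  simpa using h

lemma tangent_le_rpow {p y : ℝ} (hp : 1 ≤ p) (hy : 0 ≤ y) : 1 + p * (y - 1) ≤ y ^ p := by
  have h := one_add_mul_self_le_rpow_one_add (s := y - 1) (by linarith) hp
  simpa using h

/-! ### The normalized wave curve -/

/-- `2√α / (1 + α)`, the coefficient in the Riemann invariants. -/
def kap (α : ℝ) : ℝ := 2 * √α / (1 + α)

/-- Normalized velocity along the 1-wave curve, with parameter `x = ρₗ / ρ`. -/
def velCurve (α x : ℝ) : ℝ :=
  if x ≤ 1 then -√((1 - x ^ α) * (1 - x)) else kap α * (x ^ ((1 + α) / 2) - 1)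

/-- Normalized mass flux through a shock. -/
def massFlux (α x : ℝ) : ℝ := √((1 - x ^ α) / (1 - x))

/-- The trapezoidal defect in the energy balance of a shock. -/
def trapDefect (α x : ℝ) : ℝ := (1 - x ^ (1 + α)) / (1 + α) - (1 + x ^ α) * (1 - x) / 2

/-- Normalized limiting velocity of the dense state reached by a 1-wave with parameter `x ≥ 0`
followed by a 2-rarefaction; for `x < 0` the parameter labels shadow waves. -/
def parVel (α x : ℝ) : ℝ :=
  if x < 0 then x - 1 else velCurve α x + kap α * x ^ ((1 + α) / 2)

/-- Normalized energy dissipation along the 1-wave curve, continued to shadow waves. -/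
def parDiss (α x : ℝ) : ℝ :=
  if x < 0 then -((1 - x) ^ 3 / 2 - α / (1 + α) * (1 - x))
  else if x < 1 then -(massFlux α x * trapDefect α x) else 0

/-- Quotient of the normalized mass flux and the Lagrangian sound speed. -/
def fluxRatio (α x : ℝ) : ℝ := massFlux α x / (√α * x ^ ((α - 1) / 2))

/-- The averaged factor in the derivative of the dissipation. -/
def avgFactor (α x : ℝ) : ℝ := trapDefect α x / (1 - x) + (1 - x ^ α)

/-- The derivative of `parDiss` with respect to `parVel`. -/
def dissSlope (α x : ℝ) : ℝ :=
  if x ≤ 0 then 3 / 2 * (1 - x) ^ 2 - α / (1 + α)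
  else if x < 1 then (1 - fluxRatio α x) / (1 + fluxRatio α x) * avgFactor α x else 0

section

variable {α : ℝ}

lemma velCurve_of_one_le {x : ℝ} (hx : 1 ≤ x) :
    velCurve α x = kap α * (x ^ ((1 + α) / 2) - 1) := by
  rcases hx.eq_or_lt with rfl | h
  · simp [velCurve]
  · simp [velCurve, not_le.2 h]

lemma parVel_one : parVel α 1 = kap α := by
  simp [parVel, velCurve, not_lt.2 (zero_le_one' ℝ)]

variable (hα₀ : 0 < α) (hα₁ : α < 1)
include hα₀

lemma kap_pos : 0 < kap α := by unfold kap; positivity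

lemma one_sub_rpow_pos {x : ℝ} (hx : 0 ≤ x) (hx1 : x < 1) : 0 < 1 - x ^ α := by
  have := Real.rpow_lt_one hx hx1 hα₀; linarith

lemma massFlux_pos {x : ℝ} (hx : 0 ≤ x) (hx1 : x < 1) : 0 < massFlux α x :=
  Real.sqrt_pos.2 (div_pos (one_sub_rpow_pos hα₀ hx hx1) (by linarith))

lemma velCurve_zero : velCurve α 0 = -1 := by
  simp [velCurve, Real.zero_rpow hα₀.ne']

lemma continuous_velCurve_Ici : ContinuousOn (velCurve α) (Ici 0) := by
  have h1 : Continuous fun x : ℝ => -√((1 - x ^ α) * (1 - x)) := by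
    have : Continuous fun x : ℝ => x ^ α := Real.continuous_rpow_const hα₀.le
    fun_prop
  have h2 : Continuous fun x : ℝ => kap α * (x ^ ((1 + α) / 2) - 1) := by
    have : Continuous fun x : ℝ => x ^ ((1 + α) / 2) := Real.continuous_rpow_const (by positivity)
    fun_prop
  refine Continuous.continuousOn (Continuous.if_le h1 h2 continuous_id continuous_const ?_)
  rintro x (rfl : x = 1); simp

lemma strictMonoOn_velCurve : StrictMonoOn (velCurve α) (Ici 0) := by
  intro x hx y hy hxy
  simp only [mem_Ici] at hx hy
  have hpow : ∀ a b : ℝ, 0 ≤ a → a < b → ∀ p : ℝ, 0 < p → a ^ p < b ^ p := fun a b ha hab p hp =>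
    Real.rpow_lt_rpow ha hab hp
  have hk := kap_pos hα₀
  by_cases h1 : 1 ≤ x
  · rw [velCurve_of_one_le h1, velCurve_of_one_le (by linarith)]
    have := hpow x y hx hxy ((1 + α) / 2) (by positivity)
    nlinarith
  · push Not at h1
    have hP := one_sub_rpow_pos hα₀ hx h1
    rw [velCurve, if_pos h1.le]
    by_cases h2 : 1 ≤ y
    · rw [velCurve_of_one_le h2]
      have h3 : 0 < √((1 - x ^ α) * (1 - x)) := Real.sqrt_pos.2 (mul_pos hP (by linarith))
      have h4 : (1 : ℝ) ≤ y ^ ((1 + α) / 2) := Real.one_le_rpow h2 (by positivity)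
      nlinarith
    · push Not at h2
      rw [velCurve, if_pos h2.le, neg_lt_neg_iff]
      have := hpow x y hx hxy α hα₀
      have hQ := one_sub_rpow_pos hα₀ hy h2
      apply Real.sqrt_lt_sqrt (mul_nonneg hQ.le (by linarith))
      exact mul_lt_mul'' (by linarith) (by linarith) hQ.le (by linarith)

lemma velCurve_mem {x : ℝ} (hx : 0 ≤ x) (hx1 : x ≤ 1) : velCurve α x ∈ Icc (-1 : ℝ) 0 := by
  constructor
  · rw [← velCurve_zero hα₀]; exact (strictMonoOn_velCurve hα₀).monotoneOn self_mem_Ici hx hx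
  · rw [velCurve, if_pos hx1]; simp

lemma strictMono_parVel : StrictMono (parVel α) := by
  have hk := kap_pos hα₀
  refine StrictMonoOn.Iic_union_Ici (a := 0) ?_ ?_
  · intro x hx y hy hxy
    simp only [mem_Iic] at hx hy
    have hx' : x < 0 := by linarith
    rcases hy.eq_or_lt with rfl | h
    · simp [parVel, hx', velCurve_zero hα₀, Real.zero_rpow (by positivity : (1 + α) / 2 ≠ 0)]
      linarith
    · simp [parVel, hx', h, hxy]
  · intro x hx y hy hxy
    have := strictMonoOn_velCurve hα₀ hx hy hxy
    simp only [mem_Ici] at hx hy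
    have h2 := Real.rpow_lt_rpow hx hxy (by positivity : 0 < (1 + α) / 2)
    simp only [parVel, not_lt.2 hx, not_lt.2 hy, if_false]
    nlinarith

lemma continuous_parVel : Continuous (parVel α) := by
  rw [← continuousOn_univ, ← Iic_union_Ici (a := (0 : ℝ))]
  apply ContinuousOn.union_of_isClosed ?_ ?_ isClosed_Iic isClosed_Ici
  · have : ContinuousOn (fun x : ℝ => x - 1) (Iic 0) := by fun_prop
    refine this.congr fun x hx => ?_
    rcases (mem_Iic.1 hx).eq_or_lt with rfl | h
    · simp [parVel, velCurve_zero hα₀, Real.zero_rpow (by positivity : (1 + α) / 2 ≠ 0)]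
    · simp [parVel, h]
  · have h2 : Continuous fun x : ℝ => x ^ ((1 + α) / 2) := Real.continuous_rpow_const (by positivity)
    have : ContinuousOn (fun x : ℝ => velCurve α x + kap α * x ^ ((1 + α) / 2)) (Ici 0) :=
      (continuous_velCurve_Ici hα₀).add (by fun_prop)
    refine this.congr fun x hx => ?_
    simp [parVel, not_lt.2 (mem_Ici.1 hx)]

lemma surjective_parVel : Function.Surjective (parVel α) := by
  have hk := kap_pos hα₀
  refine (continuous_parVel hα₀).surjective ?_ ?_
  · have h2 : Tendsto (fun x : ℝ => kap α * (x ^ ((1 + α) / 2) - 1)) atTop atTop :=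
      ((tendsto_rpow_atTop (by positivity : 0 < (1 + α) / 2)).atTop_add
        (tendsto_const_nhds (x := (-1 : ℝ)))).const_mul_atTop hk
    refine tendsto_atTop_mono' _ ?_ h2
    filter_upwards [eventually_ge_atTop 1] with x hx
    have h0 : 0 ≤ x := by linarith
    have := Real.rpow_nonneg h0 ((1 + α) / 2)
    simp only [parVel, not_lt.2 h0, if_false]
    rw [velCurve_of_one_le hx]
    nlinarith
  · have h2 : Tendsto (fun x : ℝ => x - 1) atBot atBot :=
      tendsto_atBot_add_const_right _ (-1) tendsto_id
    refine h2.congr' ?_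
    filter_upwards [eventually_lt_atBot 0] with x hx
    simp [parVel, hx]

include hα₁

lemma one_sub_rpow_le {x : ℝ} (hx : 0 ≤ x) (hx1 : x ≤ 1) : 1 - x ^ α ≤ 1 - x := by
  have := Real.rpow_le_rpow_of_exponent_ge' hx hx1 hα₀.le hα₁.le
  rw [Real.rpow_one] at this; linarith

lemma massFlux_le_one {x : ℝ} (hx : 0 ≤ x) (hx1 : x ≤ 1) : massFlux α x ≤ 1 := by
  refine Real.sqrt_le_one.2 ?_
  exact div_le_one_of_le₀ (one_sub_rpow_le hα₀ hα₁ hx hx1) (by linarith)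

lemma continuous_trapDefect : Continuous (trapDefect α) := by
  have h1 : Continuous fun x : ℝ => x ^ α := Real.continuous_rpow_const hα₀.le
  have h2 : Continuous fun x : ℝ => x ^ (1 + α) := Real.continuous_rpow_const (by linarith)
  unfold trapDefect; fun_prop

lemma continuous_parDiss : Continuous (parDiss α) := by
  have hG := continuous_trapDefect hα₀ hα₁
  have hp : Continuous fun x : ℝ => x ^ α := Real.continuous_rpow_const hα₀.le
  have hzero : massFlux α 0 * trapDefect α 0 = 1 / 2 - α / (1 + α) := by
    have : (1 : ℝ) + α ≠ 0 := by positivity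
    simp [massFlux, trapDefect, Real.zero_rpow hα₀.ne', Real.zero_rpow this]
    field_simp; ring
  rw [← continuousOn_univ, ← Iic_union_Ici (a := (0 : ℝ))]
  apply ContinuousOn.union_of_isClosed ?_ ?_ isClosed_Iic isClosed_Ici
  · have : ContinuousOn (fun x : ℝ => -((1 - x) ^ 3 / 2 - α / (1 + α) * (1 - x))) (Iic 0) := by
      fun_prop
    refine this.congr fun x hx => ?_
    rcases (mem_Iic.1 hx).eq_or_lt with rfl | h
    · simp [parDiss, hzero]
    · simp [parDiss, h]
  · rw [← Icc_union_Ici_eq_Ici (zero_le_one' ℝ)]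
    apply ContinuousOn.union_of_isClosed ?_ ?_ isClosed_Icc isClosed_Ici
    · have : ContinuousOn (fun x : ℝ => -(massFlux α x * trapDefect α x)) (Icc 0 1) := by
        intro x hx
        rcases hx.2.eq_or_lt with rfl | h
        · have hG1 : trapDefect α 1 = 0 := by simp [trapDefect]
          rw [ContinuousWithinAt, hG1, mul_zero, neg_zero]
          refine squeeze_zero_norm' (a := fun x => |trapDefect α x|) ?_ ?_
          · filter_upwards [self_mem_nhdsWithin] with y hy
            rw [norm_neg, norm_mul, Real.norm_eq_abs, Real.norm_eq_abs]
            have h1 := massFlux_le_one hα₀ hα₁ hy.1 hy.2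
            have h0 : 0 ≤ massFlux α y := Real.sqrt_nonneg _
            rw [abs_of_nonneg h0]
            exact mul_le_of_le_one_left (abs_nonneg _) h1
          · have := (hG.abs.tendsto 1).mono_left (nhdsWithin_le_nhds (s := Icc 0 1))
            simpa [hG1] using this
        · apply ContinuousAt.continuousWithinAt
          refine ((ContinuousAt.sqrt ?_).mul hG.continuousAt).neg
          exact (continuous_const.sub hp).continuousAt.div (by fun_prop) (by linarith)
      refine this.congr fun x hx => ?_
      rcases hx.2.eq_or_lt with rfl | h
      · simp [parDiss, trapDefect, not_lt.2 (zero_le_one' ℝ)]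
      · simp [parDiss, not_lt.2 hx.1, h]
    · refine (continuousOn_const (c := (0 : ℝ))).congr fun x hx => ?_
      have h1 : (1 : ℝ) ≤ x := hx
      simp [parDiss, not_lt.2 (zero_le_one.trans h1), not_lt.2 h1]

end

section

variable {α : ℝ}

lemma parDiss_of_one_le {x : ℝ} (hx : 1 ≤ x) : parDiss α x = 0 := by
  simp [parDiss, not_lt.2 hx, not_lt.2 (zero_le_one.trans hx)]

lemma dissSlope_of_one_le {x : ℝ} (hx : 1 ≤ x) : dissSlope α x = 0 := by
  simp [dissSlope, not_lt.2 hx, not_le.2 (zero_lt_one.trans_le hx)]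

variable (hα₀ : 0 < α) (hα₁ : α < 1)
include hα₀

lemma one_sub_rpow_lt_mul {x : ℝ} (hα₁ : α < 1) (hx : 0 < x) (hx1 : x < 1) :
    1 - x ^ α < α * x ^ (α - 1) * (1 - x) := by
  have h := rpow_lt_tangent hα₀ hα₁ (inv_pos.2 hx).le (by simpa using hx1.ne)
  have hxp : 0 < x ^ α := Real.rpow_pos_of_pos hx α
  rw [Real.inv_rpow hx.le] at h
  have h2 := mul_lt_mul_of_pos_left h hxp
  rw [mul_inv_cancel₀ hxp.ne'] at h2
  rw [Real.rpow_sub_one hx.ne']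
  have : x ^ α * (1 + α * (x⁻¹ - 1)) = x ^ α + α * (x ^ α / x) * (1 - x) := by field_simp
  linarith

lemma sq_soundFactor {x : ℝ} (hx : 0 < x) : (√α * x ^ ((α - 1) / 2)) ^ 2 = α * x ^ (α - 1) := by
  rw [mul_pow, Real.sq_sqrt hα₀.le, ← Real.rpow_natCast, ← Real.rpow_mul hx.le]
  norm_num

lemma soundFactor_pos {x : ℝ} (hx : 0 < x) : 0 < √α * x ^ ((α - 1) / 2) := by positivity

lemma sq_massFlux {x : ℝ} (hx : 0 ≤ x) (hx1 : x < 1) :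
    massFlux α x ^ 2 * (1 - x) = 1 - x ^ α := by
  rw [massFlux, Real.sq_sqrt (div_nonneg (one_sub_rpow_pos hα₀ hx hx1).le (by linarith)),
    div_mul_cancel₀ _ (by linarith)]

lemma massFlux_lt_soundFactor (hα₁ : α < 1) {x : ℝ} (hx : 0 < x) (hx1 : x < 1) :
    massFlux α x < √α * x ^ ((α - 1) / 2) := by
  apply lt_of_pow_lt_pow_left₀ 2 (soundFactor_pos hα₀ hx).le
  rw [sq_soundFactor hα₀ hx]
  have h1 := sq_massFlux hα₀ hx.le hx1
  have h2 := one_sub_rpow_lt_mul hα₀ hα₁ hx hx1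
  rw [← h1] at h2
  exact lt_of_mul_lt_mul_right h2 (by linarith)

lemma sqrt_lt_massFlux (hα₁ : α < 1) {x : ℝ} (hx : 0 ≤ x) (hx1 : x < 1) : √α < massFlux α x := by
  apply lt_of_pow_lt_pow_left₀ 2 (Real.sqrt_nonneg _)
  rw [Real.sq_sqrt hα₀.le]
  have h1 := sq_massFlux hα₀ hx hx1
  have h2 := rpow_lt_tangent hα₀ hα₁ hx hx1.ne
  change α < massFlux α x ^ 2
  refine lt_of_mul_lt_mul_right (a := 1 - x) ?_ (by linarith)
  linarith

lemma hasDerivAt_parVel {x : ℝ} (hx : 0 < x) (hx1 : x < 1) :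
    HasDerivAt (parVel α)
      ((√α * x ^ ((α - 1) / 2) + massFlux α x) ^ 2 / (2 * massFlux α x)) x := by
  have hP := one_sub_rpow_pos hα₀ hx.le hx1
  have hd : 0 < 1 - x := by linarith
  have h1 : HasDerivAt (fun y : ℝ => (1 - y ^ α) * (1 - y))
      (-(α * x ^ (α - 1)) * (1 - x) + (1 - x ^ α) * (-1)) x := by
    have a := (Real.hasDerivAt_rpow_const (x := x) (p := α) (Or.inl hx.ne')).const_sub 1
    have b := (hasDerivAt_id x).const_sub 1
    exact a.mul b
  have h2 := (h1.sqrt (mul_pos hP hd).ne').neg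
  have h3 := (Real.hasDerivAt_rpow_const (x := x) (p := (1 + α) / 2) (Or.inl hx.ne')).const_mul
    (kap α)
  have h4 := h2.add h3
  have hm : massFlux α x = √(1 - x ^ α) / √(1 - x) := by rw [massFlux, Real.sqrt_div hP.le]
  have hev : parVel α =ᶠ[𝓝 x]
      fun y => -√((1 - y ^ α) * (1 - y)) + kap α * y ^ ((1 + α) / 2) := by
    filter_upwards [Ioo_mem_nhds hx hx1] with y hy
    simp [parVel, velCurve, not_lt.2 hy.1.le, hy.2.le]
  refine (h4.congr_of_eventuallyEq hev).congr_deriv ?_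
  have hsP : 0 < √(1 - x ^ α) := Real.sqrt_pos.2 hP
  have hsd : 0 < √(1 - x) := Real.sqrt_pos.2 hd
  have e1 : (1 + α) / 2 - 1 = (α - 1) / 2 := by ring
  have hc2 := sq_soundFactor hα₀ hx
  have hk : kap α * ((1 + α) / 2 * x ^ ((α - 1) / 2)) = √α * x ^ ((α - 1) / 2) := by
    unfold kap; field_simp
  rw [e1, hk, hm, Real.sqrt_mul hP.le, ← hc2]
  have q1 : √(1 - x ^ α) ^ 2 = 1 - x ^ α := Real.sq_sqrt hP.le
  have q2 : √(1 - x) ^ 2 = 1 - x := Real.sq_sqrt hd.le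
  have q3 : -((√α * x ^ ((α - 1) / 2)) ^ 2) * (1 - x) + (1 - x ^ α) * -1 = -((√α * x ^ ((α - 1) / 2)) ^ 2) * √(1 - x) ^ 2 + √(1 - x ^ α) ^ 2 * -1 := by
    rw [q1, q2]
  rw [q3]
  generalize √(1 - x ^ α) = a at *
  generalize √(1 - x) = b at *
  generalize √α * x ^ ((α - 1) / 2) = c at *
  field_simp
  ring

lemma hasDerivAt_trapDefect {x : ℝ} (hx : 0 < x) :
    HasDerivAt (trapDefect α) ((1 - x ^ α) / 2 - α * x ^ (α - 1) * (1 - x) / 2) x := by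
  have a := (Real.hasDerivAt_rpow_const (x := x) (p := α) (Or.inl hx.ne')).const_add 1
  have b := (hasDerivAt_id x).const_sub 1
  have c := ((Real.hasDerivAt_rpow_const (x := x) (p := 1 + α) (Or.inl hx.ne')).const_sub
    1).div_const (1 + α)
  have := c.sub ((a.mul b).div_const 2)
  refine this.congr_deriv ?_
  have e : 1 + α - 1 = α := by ring
  simp only [id, e]
  field_simp
  ring

lemma hasDerivAt_parDiss {x : ℝ} (hx : 0 < x) (hx1 : x < 1) :
    HasDerivAt (parDiss α) (dissSlope α x *
      ((√α * x ^ ((α - 1) / 2) + massFlux α x) ^ 2 / (2 * massFlux α x))) x := by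
  have hP := one_sub_rpow_pos hα₀ hx.le hx1
  have hd : 0 < 1 - x := by linarith
  have h1 : HasDerivAt (fun y : ℝ => (1 - y ^ α) / (1 - y))
      ((-(α * x ^ (α - 1)) * (1 - x) - (1 - x ^ α) * (-1)) / (1 - x) ^ 2) x := by
    have a := (Real.hasDerivAt_rpow_const (x := x) (p := α) (Or.inl hx.ne')).const_sub 1
    have b := (hasDerivAt_id x).const_sub 1
    exact a.div b hd.ne'
  have h2 : HasDerivAt (massFlux α) _ x := h1.sqrt (div_pos hP hd).ne'
  have h4 := (h2.mul (hasDerivAt_trapDefect hα₀ hx)).neg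
  have hev : parDiss α =ᶠ[𝓝 x] fun y => -(massFlux α y * trapDefect α y) := by
    filter_upwards [Ioo_mem_nhds hx hx1] with y hy
    simp [parDiss, not_lt.2 hy.1.le, hy.2]
  refine (h4.congr_of_eventuallyEq hev).congr_deriv ?_
  have hm : 0 < massFlux α x := massFlux_pos hα₀ hx.le hx1
  have hc := soundFactor_pos hα₀ hx
  change -(_ / (2 * massFlux α x) * _ + _) = _
  rw [dissSlope, if_neg (not_le.2 hx), if_pos hx1, fluxRatio, avgFactor, ← sq_massFlux hα₀ hx.le hx1,
    ← sq_soundFactor hα₀ hx]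
  generalize massFlux α x = m at *
  generalize √α * x ^ ((α - 1) / 2) = c at *
  generalize trapDefect α x = G at *
  generalize 1 - x = d at *
  field_simp
  ring

include hα₁

lemma fluxRatio_pos {x : ℝ} (hx : 0 < x) (hx1 : x < 1) : 0 < fluxRatio α x :=
  div_pos (massFlux_pos hα₀ hx.le hx1) (soundFactor_pos hα₀ hx)

lemma fluxRatio_lt_one {x : ℝ} (hx : 0 < x) (hx1 : x < 1) : fluxRatio α x < 1 :=
  (div_lt_one (soundFactor_pos hα₀ hx)).2 (massFlux_lt_soundFactor hα₀ hα₁ hx hx1)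

lemma sq_fluxRatio {x : ℝ} (hx : 0 < x) (hx1 : x < 1) :
    fluxRatio α x ^ 2 = (1 - (1 - x ^ (1 - α)) / (1 - x)) / α := by
  have hd : 0 < 1 - x := by linarith
  have hxp : 0 < x ^ α := Real.rpow_pos_of_pos hx α
  have h := sq_massFlux hα₀ hx.le hx1
  rw [fluxRatio, div_pow, sq_soundFactor hα₀ hx, Real.rpow_sub_one hx.ne', Real.rpow_sub hx,
    Real.rpow_one, eq_div_of_mul_eq hd.ne' h]
  field_simp
  ring

lemma strictMonoOn_fluxRatio : StrictMonoOn (fluxRatio α) (Ioo 0 1) := by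
  intro x hx y hy hxy
  apply lt_of_pow_lt_pow_left₀ 2 (fluxRatio_pos hα₀ hα₁ hy.1 hy.2).le
  rw [sq_fluxRatio hα₀ hα₁ hx.1 hx.2, sq_fluxRatio hα₀ hα₁ hy.1 hy.2]
  have hs := (Real.strictConcaveOn_rpow (p := 1 - α) (by linarith) (by linarith)).slope_anti_adjacent
    (x := x) (y := y) (z := 1) hx.1.le (by simp) hxy hy.2
  rw [Real.one_rpow] at hs
  have hdx : 0 < 1 - x := by linarith [hx.2]
  have hdy : 0 < 1 - y := by linarith [hy.2]
  have hxy' : 0 < y - x := by linarith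
  rw [div_lt_div_iff₀ hdy hxy'] at hs
  apply div_lt_div_of_pos_right _ hα₀
  apply sub_lt_sub_left
  rw [div_lt_div_iff₀ hdy hdx]
  nlinarith

lemma trapDefect_le {x : ℝ} (hx : 0 ≤ x) : trapDefect α x ≤ (1 - x) * (1 - x ^ α) / 2 := by
  have h := tangent_le_rpow (p := 1 + α) (by linarith) hx
  have : (1 - x ^ (1 + α)) / (1 + α) ≤ 1 - x := by
    rw [div_le_iff₀ (by linarith)]; linarith
  unfold trapDefect; linarith

lemma strictAntiOn_avgFactor : StrictAntiOn (avgFactor α) (Ico 0 1) := by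
  have hG := continuous_trapDefect hα₀ hα₁
  have hp : Continuous fun x : ℝ => x ^ α := Real.continuous_rpow_const hα₀.le
  apply strictAntiOn_of_deriv_neg (convex_Ico 0 1)
  · intro x hx
    apply ContinuousAt.continuousWithinAt
    exact (hG.continuousAt.div (by fun_prop) (by linarith [hx.2])).add
      (continuous_const.sub hp).continuousAt
  · intro x hx
    rw [interior_Ico] at hx
    have hd : 0 < 1 - x := by linarith [hx.2]
    have a := (Real.hasDerivAt_rpow_const (x := x) (p := α) (Or.inl hx.1.ne')).const_sub 1
    have b := (hasDerivAt_id x).const_sub 1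
    have c : HasDerivAt (avgFactor α) _ x :=
      ((hasDerivAt_trapDefect hα₀ hx.1).div b hd.ne').add a
    rw [c.deriv]
    have h1 := trapDefect_le hα₀ hα₁ hx.1.le
    have h2 := one_sub_rpow_lt_mul hα₀ hα₁ hx.1 hx.2
    simp only [id]
    rw [add_neg_lt_iff_lt_add, zero_add, div_lt_iff₀ (by positivity)]
    have h3 := mul_lt_mul_of_pos_right h2 hd
    have h4 : 0 ≤ (1 - x ^ α) * (1 - x) := mul_nonneg (one_sub_rpow_pos hα₀ hx.1.le hx.2).le hd.le
    linarith

lemma avgFactor_zero : avgFactor α 0 = 3 / 2 - α / (1 + α) := by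
  have : (1 : ℝ) + α ≠ 0 := by positivity
  simp [avgFactor, trapDefect, Real.zero_rpow hα₀.ne', Real.zero_rpow this]
  field_simp; ring

lemma avgFactor_pos {x : ℝ} (hx : 0 < x) (hx1 : x < 1) : 0 < avgFactor α x := by
  have hd : 0 < 1 - x := by linarith
  have hP := one_sub_rpow_pos hα₀ hx.le hx1
  have h := tangent_le_rpow (p := 1 + α) (by linarith) (inv_pos.2 hx).le
  have hxp : 0 < x ^ (1 + α) := Real.rpow_pos_of_pos hx _
  rw [Real.inv_rpow hx.le] at h
  have h2 := mul_le_mul_of_nonneg_left h hxp.le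
  rw [mul_inv_cancel₀ hxp.ne'] at h2
  have e : x ^ (1 + α) = x ^ α * x := by rw [add_comm, Real.rpow_add_one hx.ne']
  have e2 : x ^ (1 + α) * (1 + (1 + α) * (x⁻¹ - 1)) = x ^ (1 + α) + (1 + α) * x ^ α * (1 - x) := by
    rw [e]; field_simp
  have h3 : x ^ α * (1 - x) ≤ (1 - x ^ (1 + α)) / (1 + α) := by
    rw [le_div_iff₀ (by linarith)]; linarith
  have h4 : -(1 - x ^ α) / 2 ≤ trapDefect α x / (1 - x) := by
    rw [le_div_iff₀ hd, trapDefect]; linarith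
  unfold avgFactor; linarith

lemma dissSlope_pos {x : ℝ} (hx1 : x < 1) : 0 < dissSlope α x := by
  unfold dissSlope
  split_ifs with h
  · have : α / (1 + α) < 1 := (div_lt_one (by linarith)).2 (by linarith)
    nlinarith
  · push Not at h
    have := fluxRatio_lt_one hα₀ hα₁ h hx1
    have := fluxRatio_pos hα₀ hα₁ h hx1
    have := avgFactor_pos hα₀ hα₁ h hx1
    have : 0 < 1 - fluxRatio α x := by linarith
    positivity

lemma strictAntiOn_dissSlope : StrictAntiOn (dissSlope α) (Iic 1) := by
  intro x hx y hy hxy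
  simp only [mem_Iic] at hx hy
  rcases hy.eq_or_lt with rfl | hy1
  · rw [dissSlope_of_one_le le_rfl]; exact dissSlope_pos hα₀ hα₁ hxy
  by_cases hy0 : y ≤ 0
  · rw [dissSlope, dissSlope, if_pos hy0, if_pos (hxy.le.trans hy0)]; nlinarith
  push Not at hy0
  have hq := fluxRatio_lt_one hα₀ hα₁ hy0 hy1
  have hq0 := fluxRatio_pos hα₀ hα₁ hy0 hy1
  have ha := avgFactor_pos hα₀ hα₁ hy0 hy1
  rw [dissSlope, if_neg (not_le.2 hy0), if_pos hy1]
  by_cases hx0 : x ≤ 0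
  · rw [dissSlope, if_pos hx0]
    have h1 : (1 - fluxRatio α y) / (1 + fluxRatio α y) < 1 := by
      rw [div_lt_one (by linarith)]; linarith
    have h2 := strictAntiOn_avgFactor hα₀ hα₁ (left_mem_Ico.2 one_pos) ⟨hy0.le, hy1⟩ hy0
    rw [avgFactor_zero hα₀ hα₁] at h2
    nlinarith
  · push Not at hx0
    have hx1 := hxy.trans hy1
    rw [dissSlope, if_neg (not_le.2 hx0), if_pos hx1]
    have hqx := fluxRatio_pos hα₀ hα₁ hx0 hx1
    have h1 := strictMonoOn_fluxRatio hα₀ hα₁ ⟨hx0, hx1⟩ ⟨hy0, hy1⟩ hxy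
    have h2 := strictAntiOn_avgFactor hα₀ hα₁ ⟨hx0.le, hx1⟩ ⟨hy0.le, hy1⟩ hxy
    apply mul_lt_mul'' _ h2 (div_nonneg (by linarith) (by linarith)) ha.le
    rw [div_lt_div_iff₀ (by linarith) (by linarith)]
    nlinarith

/-- Cauchy's mean value theorem for the wave curve, on an interval not containing `0` or `1`. -/
lemma exists_dissSlope {a b : ℝ} (hab : a < b) (h : b ≤ 0 ∨ 0 ≤ a ∧ b ≤ 1) :
    ∃ c ∈ Ioo a b, parDiss α b - parDiss α a = dissSlope α c * (parVel α b - parVel α a) := by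
  have key : ∃ t : ℝ → ℝ, ∀ x ∈ Ioo a b, t x ≠ 0 ∧ HasDerivAt (parVel α) (t x) x ∧
      HasDerivAt (parDiss α) (dissSlope α x * t x) x := by
    rcases h with h | h
    · refine ⟨fun _ => 1, fun x hx => ⟨one_ne_zero, ?_, ?_⟩⟩
      · refine ((hasDerivAt_id x).sub_const 1).congr_of_eventuallyEq ?_
        filter_upwards [Iio_mem_nhds (hx.2.trans_le h)] with y hy
        simp [parVel, mem_Iio.1 hy]
      · have h1 := (hasDerivAt_id x).const_sub 1
        have h2 := (((h1.pow 3).div_const 2).sub (h1.const_mul (α / (1 + α)))).neg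
        refine (h2.congr_of_eventuallyEq ?_).congr_deriv ?_
        · filter_upwards [Iio_mem_nhds (hx.2.trans_le h)] with y hy
          simp [parDiss, mem_Iio.1 hy]
        · rw [dissSlope, if_pos (hx.2.trans_le h).le]
          simp only [id]; push_cast; ring
    · refine ⟨fun x => (√α * x ^ ((α - 1) / 2) + massFlux α x) ^ 2 / (2 * massFlux α x),
        fun x hx => ?_⟩
      have hx0 : 0 < x := by linarith [hx.1]
      have hx1 : x < 1 := by linarith [hx.2]
      refine ⟨?_, hasDerivAt_parVel hα₀ hx0 hx1, hasDerivAt_parDiss hα₀ hx0 hx1⟩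
      have := massFlux_pos hα₀ hx0.le hx1
      have := soundFactor_pos hα₀ hx0
      positivity
  obtain ⟨t, ht⟩ := key
  obtain ⟨c, hc, e⟩ := exists_ratio_hasDerivAt_eq_ratio_slope (parDiss α)
    (fun x => dissSlope α x * t x) hab (continuous_parDiss hα₀ hα₁).continuousOn
    (fun x hx => (ht x hx).2.2) (parVel α) t (continuous_parVel hα₀).continuousOn
    (fun x hx => (ht x hx).2.1)
  refine ⟨c, hc, mul_right_cancel₀ (ht c hc).1 ?_⟩
  linear_combination -e

lemma dissSlope_bounds {a b : ℝ} (hab : a < b) (ha : a < 1) :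
    dissSlope α b * (parVel α b - parVel α a) < parDiss α b - parDiss α a ∧
      parDiss α b - parDiss α a < dissSlope α a * (parVel α b - parVel α a) := by
  have hs := strictAntiOn_dissSlope hα₀ hα₁
  have hT := strictMono_parVel hα₀
  have piece : ∀ a b : ℝ, a < b → (b ≤ 0 ∨ 0 ≤ a ∧ b ≤ 1) →
      dissSlope α b * (parVel α b - parVel α a) < parDiss α b - parDiss α a ∧
      parDiss α b - parDiss α a < dissSlope α a * (parVel α b - parVel α a) := by
    intro a b hab h
    obtain ⟨c, hc, e⟩ := exists_dissSlope hα₀ hα₁ hab h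
    have hb1 : b ≤ 1 := by rcases h with h | h <;> linarith
    have hpos := sub_pos.2 (hT hab)
    rw [e]
    exact ⟨mul_lt_mul_of_pos_right (hs (hc.2.le.trans hb1) hb1 hc.2) hpos,
      mul_lt_mul_of_pos_right (hs (hab.le.trans hb1) (hc.2.le.trans hb1) hc.1) hpos⟩
  have upto : ∀ a b : ℝ, a < b → b ≤ 1 →
      dissSlope α b * (parVel α b - parVel α a) < parDiss α b - parDiss α a ∧
      parDiss α b - parDiss α a < dissSlope α a * (parVel α b - parVel α a) := by
    intro a b hab hb1
    by_cases h0 : b ≤ 0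
    · exact piece a b hab (Or.inl h0)
    by_cases h1 : 0 ≤ a
    · exact piece a b hab (Or.inr ⟨h1, hb1⟩)
    push Not at h0 h1
    have p1 := piece a 0 h1 (Or.inl le_rfl)
    have p2 := piece 0 b h0 (Or.inr ⟨le_rfl, hb1⟩)
    have s1 := hs (h1.le.trans zero_le_one) (mem_Iic.2 zero_le_one) h1
    have s2 := hs (mem_Iic.2 zero_le_one) hb1 h0
    have t1 := sub_pos.2 (hT h1)
    have t2 := sub_pos.2 (hT h0)
    constructor <;> nlinarith [p1.1, p1.2, p2.1, p2.2]
  by_cases hb : b ≤ 1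
  · exact upto a b hab hb
  · push Not at hb
    have p1 := upto a 1 ha le_rfl
    have hz := dissSlope_pos hα₀ hα₁ ha
    have t2 := sub_pos.2 (hT hb)
    rw [dissSlope_of_one_le le_rfl, parDiss_of_one_le le_rfl] at p1
    rw [dissSlope_of_one_le hb.le, parDiss_of_one_le hb.le]
    constructor <;> nlinarith [p1.1, p1.2]

lemma parDiss_neg {x : ℝ} (hx : x < 1) : parDiss α x < 0 := by
  have := (dissSlope_bounds hα₀ hα₁ hx hx).1
  rw [dissSlope_of_one_le le_rfl, parDiss_of_one_le le_rfl] at this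
  linarith

lemma parDiss_nonpos (x : ℝ) : parDiss α x ≤ 0 := by
  rcases lt_or_ge x 1 with h | h
  · exact (parDiss_neg hα₀ hα₁ h).le
  · exact (parDiss_of_one_le h).le

lemma parDiss_zero_le {x : ℝ} (hx : 0 ≤ x) : parDiss α 0 ≤ parDiss α x := by
  rcases hx.eq_or_lt with rfl | h
  · exact le_rfl
  have h1 := (dissSlope_bounds hα₀ hα₁ h one_pos).1
  have h2 := sub_pos.2 (strictMono_parVel hα₀ h)
  have h3 : 0 ≤ dissSlope α x := by
    rcases lt_or_ge x 1 with h | h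
    · exact (dissSlope_pos hα₀ hα₁ h).le
    · exact (dissSlope_of_one_le h).ge
  nlinarith

end

/-- The parameter on the wave curve of a given limiting velocity. -/
def velParam (α y : ℝ) : ℝ := Function.invFun (parVel α) y

/-- The normalized limiting dissipation as a function of the velocity of the dense state. -/
def limDiss (α y : ℝ) : ℝ := parDiss α (velParam α y)

section

variable {α : ℝ} (hα₀ : 0 < α) (hα₁ : α < 1)
include hα₀

lemma parVel_velParam (y : ℝ) : parVel α (velParam α y) = y :=
  Function.rightInverse_invFun (surjective_parVel hα₀) y

lemma velParam_parVel (x : ℝ) : velParam α (parVel α x) = x :=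
  Function.leftInverse_invFun (strictMono_parVel hα₀).injective x

lemma velParam_lt_iff {x y : ℝ} : velParam α y < x ↔ y < parVel α x := by
  conv_rhs => rw [← parVel_velParam hα₀ y]
  exact (strictMono_parVel hα₀).lt_iff_lt.symm

include hα₁

lemma limDiss_parVel (x : ℝ) : limDiss α (parVel α x) = parDiss α x := by
  rw [limDiss, velParam_parVel hα₀]

lemma limDiss_neg {y : ℝ} (hy : y < kap α) : limDiss α y < 0 :=
  parDiss_neg hα₀ hα₁ ((velParam_lt_iff hα₀).2 (by rwa [parVel_one]))

lemma limDiss_of_le {y : ℝ} (hy : kap α ≤ y) : limDiss α y = 0 := by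
  apply parDiss_of_one_le
  by_contra h
  push Not at h
  rw [velParam_lt_iff hα₀, parVel_one] at h
  linarith

lemma strictConcaveOn_limDiss : StrictConcaveOn ℝ (Iic (kap α)) (limDiss α) := by
  apply strictConcaveOn_of_slope_strict_anti_adjacent (convex_Iic _)
  intro x y z _ hz hxy hyz
  have hmono : ∀ {a b : ℝ}, a < b → velParam α a < velParam α b := fun {a b} h => by
    rw [velParam_lt_iff hα₀, parVel_velParam hα₀]; exact h
  have hy1 : velParam α y < 1 := by
    rw [velParam_lt_iff hα₀, parVel_one]; exact hyz.trans_le hz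
  have h1 := (dissSlope_bounds hα₀ hα₁ (hmono hxy) ((hmono hxy).trans hy1)).1
  have h2 := (dissSlope_bounds hα₀ hα₁ (hmono hyz) hy1).2
  simp only [parVel_velParam hα₀] at h1 h2
  refine lt_trans (b := dissSlope α (velParam α y)) ?_ ?_
  · rw [div_lt_iff₀ (by linarith)]; exact h2
  · rw [lt_div_iff₀ (by linarith)]; exact h1

lemma concaveOn_limDiss : ConcaveOn ℝ univ (limDiss α) := by
  apply concaveOn_of_slope_anti_adjacent convex_univ
  intro x y z _ _ hxy hyz
  have hmono : ∀ {a b : ℝ}, a < b → velParam α a < velParam α b := fun {a b} h => by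
    rw [velParam_lt_iff hα₀, parVel_velParam hα₀]; exact h
  rcases lt_or_ge y (kap α) with hy | hy
  · have hy1 : velParam α y < 1 := by
      rwa [velParam_lt_iff hα₀, parVel_one]
    have h1 := (dissSlope_bounds hα₀ hα₁ (hmono hxy) ((hmono hxy).trans hy1)).1
    have h2 := (dissSlope_bounds hα₀ hα₁ (hmono hyz) hy1).2
    simp only [parVel_velParam hα₀] at h1 h2
    refine le_trans (b := dissSlope α (velParam α y)) ?_ ?_
    · rw [div_le_iff₀ (by linarith)]; exact h2.le
    · rw [le_div_iff₀ (by linarith)]; exact h1.le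
  · rw [limDiss_of_le hα₀ hα₁ hy, limDiss_of_le hα₀ hα₁ (hy.trans hyz.le)]
    simp only [sub_self, zero_div, zero_sub]
    apply div_nonneg _ (by linarith)
    have := parDiss_nonpos hα₀ hα₁ (velParam α x)
    simp only [limDiss]; linarith

lemma continuous_limDiss : Continuous (limDiss α) := by
  rw [← continuousOn_univ]; exact (concaveOn_limDiss hα₀ hα₁).continuousOn isOpen_univ

end

/-- `ρ^{-(1+α)/2}`, the sound speed up to the factor `√α`. -/
def volPow (α ρ : ℝ) : ℝ := ρ ^ (-((1 + α) / 2))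

/-- The flux of the energy density `energy α`. -/
def energyFlux (α : ℝ) (U : State) : ℝ :=
  1 / 2 * U.1 * U.2 ^ 3 - α / (1 + α) * U.1 ^ (-α) * U.2

/-- The dissipation of a wave from density `ρ` to density `ρ'`. -/
def waveDiss (α ρ ρ' : ℝ) : ℝ := ρ ^ (-α) * volPow α ρ * parDiss α (ρ / ρ')

/-- Reflection of a state under `x ↦ -x`. -/
def refl (U : State) : State := (U.1, -U.2)

@[simp] lemma refl_fst (U : State) : (refl U).1 = U.1 := rfl
@[simp] lemma refl_snd (U : State) : (refl U).2 = -U.2 := rfl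
@[simp] lemma refl_refl (U : State) : refl (refl U) = U := by simp [refl]
lemma lam₁_refl (α : ℝ) (U : State) : lam₁ α (refl U) = -lam₂ α U := by simp [lam₁, lam₂]; ring
lemma lam₂_refl (α : ℝ) (U : State) : lam₂ α (refl U) = -lam₁ α U := by simp [lam₁, lam₂]; ring
lemma energy_refl (α : ℝ) (U : State) : energy α (refl U) = energy α U := by simp [energy]
lemma energyFlux_refl (α : ℝ) (U : State) : energyFlux α (refl U) = -energyFlux α U := by
  simp [energyFlux]; ring

lemma rankineHugoniot_iff {α : ℝ} {Ul Ur : State} {s : ℝ} : RankineHugoniot α Ul Ur s ↔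
    Ur.1 * Ur.2 - Ul.1 * Ul.2 = s * (Ur.1 - Ul.1) ∧
    (Ur.1 * Ur.2 ^ 2 - Ur.1 ^ (-α)) - (Ul.1 * Ul.2 ^ 2 - Ul.1 ^ (-α)) =
      s * (Ur.1 * Ur.2 - Ul.1 * Ul.2) := by
  simp [RankineHugoniot, flux, conserved, Prod.ext_iff]

lemma rankineHugoniot_refl {α : ℝ} {Ul Ur : State} {s : ℝ} (h : RankineHugoniot α Ul Ur s) :
    RankineHugoniot α (refl Ur) (refl Ul) (-s) := by
  rw [rankineHugoniot_iff] at h ⊢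
  simp only [refl_fst, refl_snd]
  constructor
  · linear_combination h.1
  · linear_combination -h.2

lemma IsShock₁.refl {α : ℝ} {Ul Ur : State} {s : ℝ} (h : IsShock₁ α Ul Ur s) :
    IsShock₂ α (refl Ur) (refl Ul) (-s) := by
  obtain ⟨h1, h2, h3, h4⟩ := h
  refine ⟨rankineHugoniot_refl h1, ?_, ?_, ?_⟩ <;> simp only [lam₁_refl, lam₂_refl] <;> linarith

lemma IsShock₂.refl {α : ℝ} {Ul Ur : State} {s : ℝ} (h : IsShock₂ α Ul Ur s) :
    IsShock₁ α (GenChaplygin.refl Ur) (GenChaplygin.refl Ul) (-s) := by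
  obtain ⟨h1, h2, h3, h4⟩ := h
  refine ⟨rankineHugoniot_refl h1, ?_, ?_, ?_⟩ <;> simp only [lam₁_refl, lam₂_refl] <;> linarith

/-! ### Powers of the density -/

section

variable {α : ℝ} (hα₀ : 0 < α) (hα₁ : α < 1)
include hα₀

lemma volPow_pos {ρ : ℝ} (hρ : 0 < ρ) : 0 < volPow α ρ := Real.rpow_pos_of_pos hρ _

lemma mul_sq_volPow {ρ : ℝ} (hρ : 0 < ρ) : ρ * volPow α ρ ^ 2 = ρ ^ (-α) := by
  rw [volPow, ← Real.rpow_natCast, ← Real.rpow_mul hρ.le]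
  conv_lhs => rw [← Real.rpow_one ρ, ← Real.rpow_mul hρ.le, ← Real.rpow_add hρ]
  congr 1; push_cast; ring

lemma volPow_eq {ρ ρ' : ℝ} (hρ : 0 < ρ) (hρ' : 0 < ρ') :
    volPow α ρ' = volPow α ρ * (ρ / ρ') ^ ((1 + α) / 2) := by
  rw [volPow, volPow, Real.div_rpow hρ.le hρ'.le, Real.rpow_neg hρ.le, Real.rpow_neg hρ'.le]
  have := Real.rpow_pos_of_pos hρ ((1 + α) / 2)
  field_simp

lemma rpow_neg_eq {ρ ρ' : ℝ} (hρ : 0 < ρ) (hρ' : 0 < ρ') :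
    ρ' ^ (-α) = ρ ^ (-α) * (ρ / ρ') ^ α := by
  rw [Real.div_rpow hρ.le hρ'.le, Real.rpow_neg hρ.le, Real.rpow_neg hρ'.le]
  have := Real.rpow_pos_of_pos hρ α
  field_simp

lemma volPow_lt {ρ ρ' : ℝ} (hρ : 0 < ρ) (h : ρ < ρ') : volPow α ρ' < volPow α ρ :=
  Real.rpow_lt_rpow_of_neg hρ h (by linarith)

lemma velCurve_of_lt_one {x : ℝ} (hx : 0 ≤ x) (hx1 : x < 1) :
    velCurve α x = -(massFlux α x * (1 - x)) := by
  have hd : 0 < 1 - x := by linarith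
  have hP := one_sub_rpow_pos hα₀ hx hx1
  rw [velCurve, if_pos hx1.le, massFlux, Real.sqrt_mul hP.le, Real.sqrt_div hP.le]
  have : √(1 - x) ^ 2 = 1 - x := Real.sq_sqrt hd.le
  have h2 : 0 < √(1 - x) := Real.sqrt_pos.2 hd
  congr 1
  rw [div_mul_eq_mul_div, eq_div_iff h2.ne']
  linear_combination √(1 - x ^ α) * this

/-! ### Shocks of the first family -/

lemma lam₁_eq (U : State) : lam₁ α U = U.2 - √α * volPow α U.1 := rfl
lemma lam₂_eq (U : State) : lam₂ α U = U.2 + √α * volPow α U.1 := rfl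

include hα₁

lemma mul_volPow_lt_iff {ρ ρ' : ℝ} (hρ : 0 < ρ) (hρ' : 0 < ρ') :
    ρ * volPow α ρ < ρ' * volPow α ρ' ↔ ρ < ρ' := by
  have e : ∀ r : ℝ, 0 < r → r * volPow α r = r ^ ((1 - α) / 2) := fun r hr => by
    rw [volPow]
    conv_lhs => rw [← Real.rpow_one r, ← Real.rpow_mul hr.le, ← Real.rpow_add hr]
    congr 1; ring
  rw [e ρ hρ, e ρ' hρ']
  exact Real.rpow_lt_rpow_iff hρ.le hρ'.le (by linarith)

/-- A Lax 1-shock is compressive and has the mass flux `ρₗ zₗ massFlux`. -/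
lemma IsShock₁.spec {Ul Ur : State} {s : ℝ} (hl : 0 < Ul.1) (hr : 0 < Ur.1)
    (h : IsShock₁ α Ul Ur s) : Ul.1 < Ur.1 ∧
      Ur.2 = Ul.2 + volPow α Ul.1 * velCurve α (Ul.1 / Ur.1) ∧
      s = Ul.2 - volPow α Ul.1 * massFlux α (Ul.1 / Ur.1) ∧ s < Ur.2 := by
  obtain ⟨hRH, h1, h2, -⟩ := h
  rw [rankineHugoniot_iff] at hRH
  rw [lam₁_eq hα₀] at h1 h2
  obtain ⟨ρ, u⟩ := Ul
  obtain ⟨ρ', u'⟩ := Ur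
  simp only at *
  have hz := volPow_pos hα₀ hl
  have hz' := volPow_pos hα₀ hr
  have hsα : 0 < √α := Real.sqrt_pos.2 hα₀
  have hm : ρ * (u - s) = ρ' * (u' - s) := by linear_combination -hRH.1
  have hlt : ρ < ρ' := by
    rw [← mul_volPow_lt_iff hα₀ hα₁ hl hr]
    have a : ρ * (√α * volPow α ρ) < ρ * (u - s) := mul_lt_mul_of_pos_left (by linarith) hl
    have b : ρ' * (u' - s) < ρ' * (√α * volPow α ρ') := mul_lt_mul_of_pos_left (by linarith) hr
    have : √α * (ρ * volPow α ρ) < √α * (ρ' * volPow α ρ') := by linarith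
    exact lt_of_mul_lt_mul_left this hsα.le
  have hx0 : 0 < ρ / ρ' := div_pos hl hr
  have hx1 : ρ / ρ' < 1 := (div_lt_one hr).2 hlt
  have hd : 0 < 1 - ρ / ρ' := by linarith
  have hus : 0 < u - s := by nlinarith [mul_pos hsα hz]
  have hx : ρ = ρ / ρ' * ρ' := by field_simp
  have huu : u - u' = (u - s) * (1 - ρ / ρ') := by
    have : u' - s = ρ / ρ' * (u - s) := by field_simp; linarith
    linear_combination -this
  have hmom : ρ * (u - s) * (u - u') = ρ ^ (-α) - ρ' ^ (-α) := by
    linear_combination -hRH.2 + u' * hRH.1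
  have hmf : u - s = volPow α ρ * massFlux α (ρ / ρ') := by
    have e1 : (u - s) ^ 2 = (volPow α ρ * massFlux α (ρ / ρ')) ^ 2 := by
      have q := sq_massFlux hα₀ hx0.le hx1
      rw [rpow_neg_eq hα₀ hl hr, ← mul_sq_volPow hα₀ hl, huu] at hmom
      have : ρ * (1 - ρ / ρ') * ((u - s) ^ 2) =
          ρ * (1 - ρ / ρ') * (volPow α ρ * massFlux α (ρ / ρ')) ^ 2 := by
        linear_combination hmom - ρ * volPow α ρ ^ 2 * q
      exact mul_left_cancel₀ (mul_pos hl hd).ne' this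
    have hp := massFlux_pos hα₀ hx0.le hx1
    exact (pow_left_inj₀ hus.le (mul_pos hz hp).le two_ne_zero).1 e1
  refine ⟨hlt, ?_, by linarith, ?_⟩
  · rw [velCurve_of_lt_one hα₀ hx0.le hx1]
    rw [hmf] at huu; linarith
  · have : 0 < ρ' * (u' - s) := hm ▸ mul_pos hl hus
    linarith [pos_of_mul_pos_right this hr.le]

lemma isShock₁_of_lt {Ul Ur : State} (hl : 0 < Ul.1) (hlt : Ul.1 < Ur.1)
    (hu : Ur.2 = Ul.2 + volPow α Ul.1 * velCurve α (Ul.1 / Ur.1)) :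
    IsShock₁ α Ul Ur (Ul.2 - volPow α Ul.1 * massFlux α (Ul.1 / Ur.1)) := by
  obtain ⟨ρ, u⟩ := Ul
  obtain ⟨ρ', u'⟩ := Ur
  simp only at *
  have hr : 0 < ρ' := hl.trans hlt
  have hx0 : 0 < ρ / ρ' := div_pos hl hr
  have hx1 : ρ / ρ' < 1 := (div_lt_one hr).2 hlt
  have q := sq_massFlux hα₀ hx0.le hx1
  have hp := massFlux_pos hα₀ hx0.le hx1
  have hz := volPow_pos hα₀ hl
  have hz' := volPow_pos hα₀ hr
  have hsα : 0 < √α := Real.sqrt_pos.2 hα₀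
  have c1 := sqrt_lt_massFlux hα₀ hα₁ hx0.le hx1
  have c2 := massFlux_lt_soundFactor hα₀ hα₁ hx0 hx1
  have hzz : volPow α ρ' = volPow α ρ * (ρ / ρ') ^ ((1 + α) / 2) := volPow_eq hα₀ hl hr
  have e1 : (ρ / ρ') ^ ((1 + α) / 2) = (ρ / ρ') * (ρ / ρ') ^ ((α - 1) / 2) := by
    conv_rhs => rw [← Real.rpow_one_add' hx0.le (by linarith)]
    congr 1; ring
  have hb := rpow_neg_eq hα₀ hl hr
  have ha := mul_sq_volPow hα₀ hl
  rw [velCurve_of_lt_one hα₀ hx0.le hx1] at hu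
  have hx : ρ' * (ρ / ρ') = ρ := by field_simp
  have hus : u' - (u - volPow α ρ * massFlux α (ρ / ρ')) =
      ρ / ρ' * (volPow α ρ * massFlux α (ρ / ρ')) := by rw [hu]; ring
  refine ⟨rankineHugoniot_iff.2 ⟨?_, ?_⟩, ?_, ?_, ?_⟩
  · simp only
    linear_combination ρ' * hus + (volPow α ρ * massFlux α (ρ / ρ')) * hx
  · simp only
    rw [hb, ← ha, hu]
    generalize volPow α ρ = z at *
    generalize massFlux α (ρ / ρ') = m at *
    generalize (ρ / ρ') ^ α = P at *
    generalize ρ / ρ' = x at *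
    subst hx
    have : P = 1 - m ^ 2 * (1 - x) := by linarith
    rw [this]; ring
  · rw [lam₁_eq hα₀]
    simp only
    have : ρ / ρ' * (volPow α ρ * massFlux α (ρ / ρ')) < √α * volPow α ρ' := by
      rw [hzz, e1]
      have := mul_lt_mul_of_pos_left c2 (mul_pos hx0 hz)
      linarith
    linarith
  · rw [lam₁_eq hα₀]
    simp only
    nlinarith
  · rw [lam₂_eq hα₀]
    simp only
    have : 0 < ρ / ρ' * (volPow α ρ * massFlux α (ρ / ρ')) := by positivity
    nlinarith

/-- The energy dissipated by a shock. -/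
lemma IsShock₁.dissipation {Ul Ur : State} {s : ℝ} (hl : 0 < Ul.1) (hr : 0 < Ur.1)
    (h : IsShock₁ α Ul Ur s) :
    (energyFlux α Ur - s * energy α Ur) - (energyFlux α Ul - s * energy α Ul) =
      waveDiss α Ul.1 Ur.1 := by
  obtain ⟨hlt, hu, hs, -⟩ := h.spec hα₀ hα₁ hl hr
  obtain ⟨ρ, u⟩ := Ul
  obtain ⟨ρ', u'⟩ := Ur
  simp only at *
  have hx0 : 0 < ρ / ρ' := div_pos hl hr
  have hx1 : ρ / ρ' < 1 := (div_lt_one hr).2 hlt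
  have q := sq_massFlux hα₀ hx0.le hx1
  have hb := rpow_neg_eq hα₀ hl hr
  have ha := mul_sq_volPow hα₀ hl
  have e : (ρ / ρ') ^ (1 + α) = ρ / ρ' * (ρ / ρ') ^ α := by
    rw [Real.rpow_one_add' hx0.le (by linarith)]
  have hx : ρ' * (ρ / ρ') = ρ := by field_simp
  rw [velCurve_of_lt_one hα₀ hx0.le hx1] at hu
  rw [waveDiss, parDiss, if_neg (not_lt.2 hx0.le), if_pos hx1, trapDefect, e]
  simp only [energyFlux, energy]
  rw [hb, ← ha, hu, hs]
  generalize volPow α ρ = z at *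
  generalize massFlux α (ρ / ρ') = m at *
  generalize (ρ / ρ') ^ α = P at *
  generalize ρ / ρ' = x at *
  subst hx
  have : P = 1 - m ^ 2 * (1 - x) := by linarith
  rw [this]
  have : 1 + α ≠ 0 := by positivity
  field_simp
  ring

end

/-! ### Rarefaction waves -/

lemma hasDerivAt_density {w : ℝ → State} {ζ : ℝ} {w' : State} (hw : HasDerivAt w w' ζ) :
    HasDerivAt (fun z => (w z).1) w'.1 ζ := by
  exact (hasFDerivAt_fst (𝕜 := ℝ) (p := w ζ)).comp_hasDerivAt ζ hw

lemma hasDerivAt_velocity {w : ℝ → State} {ζ : ℝ} {w' : State} (hw : HasDerivAt w w' ζ) :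
    HasDerivAt (fun z => (w z).2) w'.2 ζ := by
  exact (hasFDerivAt_snd (𝕜 := ℝ) (p := w ζ)).comp_hasDerivAt ζ hw

lemma hasDerivAt_energy {α : ℝ} {w : ℝ → State} {ζ : ℝ} {w' : State} (hρ : 0 < (w ζ).1)
    (hw : HasDerivAt w w' ζ) : HasDerivAt (fun z => energy α (w z))
      (1 / 2 * w'.1 * (w ζ).2 ^ 2 + (w ζ).1 * (w ζ).2 * w'.2
        - α / (1 + α) * (w ζ).1 ^ (-α - 1) * w'.1) ζ := by
  have h1 := hasDerivAt_density hw
  have h2 := hasDerivAt_velocity hw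
  have h3 := h1.rpow_const (p := -α) (Or.inl hρ.ne')
  refine (((h1.const_mul (1 / 2)).mul (h2.pow 2)).add
    (h3.const_mul (1 / (1 + α)))).congr_deriv ?_
  simp only [Pi.pow_apply]
  push_cast
  ring

lemma hasDerivAt_conserved {w : ℝ → State} {ζ : ℝ} {w' : State} (hw : HasDerivAt w w' ζ) :
    HasDerivAt (fun z => conserved (w z)) (w'.1, w'.1 * (w ζ).2 + (w ζ).1 * w'.2) ζ := by
  have h1 := hasDerivAt_density hw
  have h2 := hasDerivAt_velocity hw
  exact h1.prodMk (h1.mul h2)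

lemma hasDerivAt_flux {α : ℝ} {w : ℝ → State} {ζ : ℝ} {w' : State} (hρ : 0 < (w ζ).1)
    (hw : HasDerivAt w w' ζ) : HasDerivAt (fun z => flux α (w z))
      (w'.1 * (w ζ).2 + (w ζ).1 * w'.2, w'.1 * (w ζ).2 ^ 2 + 2 * (w ζ).1 * (w ζ).2 * w'.2
        + α * (w ζ).1 ^ (-α - 1) * w'.1) ζ := by
  have h1 := hasDerivAt_density hw
  have h2 := hasDerivAt_velocity hw
  have h3 := h1.rpow_const (p := -α) (Or.inl hρ.ne')
  refine ((h1.mul h2).prodMk ((h1.mul (h2.pow 2)).sub h3)).congr_deriv ?_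
  simp only [Pi.pow_apply]
  push_cast
  ext
  · ring
  · simp only; ring

lemma hasDerivAt_energyFlux {α : ℝ} {w : ℝ → State} {ζ : ℝ} {w' : State} (hρ : 0 < (w ζ).1)
    (hw : HasDerivAt w w' ζ) : HasDerivAt (fun z => energyFlux α (w z))
      (1 / 2 * w'.1 * (w ζ).2 ^ 3 + 3 / 2 * (w ζ).1 * (w ζ).2 ^ 2 * w'.2
        + α ^ 2 / (1 + α) * (w ζ).1 ^ (-α - 1) * w'.1 * (w ζ).2
        - α / (1 + α) * (w ζ).1 ^ (-α) * w'.2) ζ := by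
  have h1 := hasDerivAt_density hw
  have h2 := hasDerivAt_velocity hw
  have h3 := h1.rpow_const (p := -α) (Or.inl hρ.ne')
  refine (((h1.const_mul (1 / 2)).mul (h2.pow 3)).sub
    ((h3.const_mul (α / (1 + α))).mul h2)).congr_deriv ?_
  simp only [Pi.pow_apply]
  push_cast
  ring

lemma eq_of_deriv_zero {f : ℝ → ℝ} {a b : ℝ} (hf : ContinuousOn f (Icc a b))
    (hd : ∀ x ∈ Ioo a b, HasDerivAt f 0 x) : ∀ x ∈ Icc a b, f x = f a := by
  intro x hx
  rcases hx.1.eq_or_lt with rfl | h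
  · rfl
  obtain ⟨c, -, e⟩ := exists_hasDerivAt_eq_slope f (fun _ => 0) h
    (hf.mono (Icc_subset_Icc_right hx.2)) (fun y hy => hd y ⟨hy.1, hy.2.trans_le hx.2⟩)
  have : f x - f a = 0 := by
    rw [eq_comm, div_eq_zero_iff] at e
    rcases e with e | e <;> linarith
  linarith

lemma IsRarefaction.deriv_eqs {α : ℝ} {lam : State → ℝ} {Ul Ur : State} {a b : ℝ} {w : ℝ → State}
    (h : IsRarefaction α lam Ul Ur a b w) {ζ : ℝ} (hζ : ζ ∈ Ioo a b) : ∃ w' : State,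
      HasDerivAt w w' ζ ∧
      w'.1 * (w ζ).2 + (w ζ).1 * w'.2 = ζ * w'.1 ∧
      w'.1 * (w ζ).2 ^ 2 + 2 * (w ζ).1 * (w ζ).2 * w'.2 + α * (w ζ).1 ^ (-α - 1) * w'.1 =
        ζ * (w'.1 * (w ζ).2 + (w ζ).1 * w'.2) := by
  obtain ⟨-, -, -, -, h1, h2⟩ := h
  obtain ⟨hd, e⟩ := h2 ζ hζ
  have hρ := (h1 ζ (Ioo_subset_Icc_self hζ)).1
  have hw := hd.hasDerivAt
  refine ⟨deriv w ζ, hw, ?_⟩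
  rw [(hasDerivAt_flux hρ hw).deriv, (hasDerivAt_conserved hw).deriv] at e
  simpa [Prod.ext_iff] using e

lemma continuousOn_energy_comp {α : ℝ} {w : ℝ → State} {s : Set ℝ} (hw : ContinuousOn w s)
    (hρ : ∀ x ∈ s, 0 < (w x).1) : ContinuousOn (fun z => energy α (w z)) s := by
  have h1 := hw.fst
  have h2 := hw.snd
  have h3 : ContinuousOn (fun z => (w z).1 ^ (-α)) s :=
    h1.rpow_const fun x hx => Or.inl (hρ x hx).ne'
  unfold energy; fun_prop

lemma continuousOn_energyFlux_comp {α : ℝ} {w : ℝ → State} {s : Set ℝ} (hw : ContinuousOn w s)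
    (hρ : ∀ x ∈ s, 0 < (w x).1) : ContinuousOn (fun z => energyFlux α (w z)) s := by
  have h1 := hw.fst
  have h2 := hw.snd
  have h3 : ContinuousOn (fun z => (w z).1 ^ (-α)) s :=
    h1.rpow_const fun x hx => Or.inl (hρ x hx).ne'
  unfold energyFlux; fun_prop

lemma continuousOn_flux_comp {α : ℝ} {w : ℝ → State} {s : Set ℝ} (hw : ContinuousOn w s)
    (hρ : ∀ x ∈ s, 0 < (w x).1) : ContinuousOn (fun z => flux α (w z)) s := by
  have h1 := hw.fst
  have h2 := hw.snd
  have h3 : ContinuousOn (fun z => (w z).1 ^ (-α)) s :=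
    h1.rpow_const fun x hx => Or.inl (hρ x hx).ne'
  unfold flux; fun_prop

lemma continuous_conserved : Continuous conserved := by unfold conserved; fun_prop

lemma IsRarefaction.refl {α : ℝ} {lam lam' : State → ℝ} {Ul Ur : State} {a b : ℝ} {w : ℝ → State}
    (hlam : ∀ U, lam' (GenChaplygin.refl U) = -lam U) (h : IsRarefaction α lam Ul Ur a b w) :
    IsRarefaction α lam' (GenChaplygin.refl Ur) (GenChaplygin.refl Ul) (-b) (-a)
      (fun ζ => GenChaplygin.refl (w (-ζ))) := by
  have hd := fun {ζ : ℝ} => h.deriv_eqs (ζ := ζ)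
  obtain ⟨hab, ha, hb, hc, h1, -⟩ := h
  have hmaps : MapsTo (fun ζ : ℝ => -ζ) (Icc (-b) (-a)) (Icc a b) := fun ζ hζ =>
    ⟨by linarith [hζ.2], by linarith [hζ.1]⟩
  refine ⟨by linarith, by simp [hb], by simp [ha], ?_, ?_, ?_⟩
  · have : Continuous GenChaplygin.refl := by unfold GenChaplygin.refl; fun_prop
    exact this.comp_continuousOn (hc.comp continuous_neg.continuousOn hmaps)
  · intro ζ hζ
    refine ⟨(h1 _ (hmaps hζ)).1, ?_⟩
    rw [hlam, (h1 _ (hmaps hζ)).2, neg_neg]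
  · intro ζ hζ
    have hm : -ζ ∈ Ioo a b := ⟨by linarith [hζ.2], by linarith [hζ.1]⟩
    obtain ⟨w', hw', e1, e2⟩ := hd hm
    have hρ := (h1 _ (Ioo_subset_Icc_self hm)).1
    have hc := HasDerivAt.scomp ζ hw' (hasDerivAt_neg ζ)
    have hD : HasDerivAt (fun ζ => GenChaplygin.refl (w (-ζ))) (-w'.1, w'.2) ζ := by
      have := (hasDerivAt_density hc).prodMk (hasDerivAt_velocity hc).neg
      exact this.congr_deriv (by simp)
    refine ⟨hD.differentiableAt, ?_⟩
    have hρ' : 0 < (GenChaplygin.refl (w (-ζ))).1 := hρ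
    rw [(hasDerivAt_flux (w := fun ζ => GenChaplygin.refl (w (-ζ))) hρ' hD).deriv,
      (hasDerivAt_conserved (w := fun ζ => GenChaplygin.refl (w (-ζ))) hD).deriv]
    simp only [refl_fst, refl_snd, Prod.smul_mk, smul_eq_mul]
    ext
    · simp only; linear_combination e1
    · simp only; linear_combination -e2

section

variable {α : ℝ} (hα₀ : 0 < α) (hα₁ : α < 1)
include hα₀

lemma sq_sqrt_volPow {ρ : ℝ} (hρ : 0 < ρ) : (√α * volPow α ρ) ^ 2 = α * ρ ^ (-α - 1) := by
  rw [mul_pow, Real.sq_sqrt hα₀.le, volPow, ← Real.rpow_natCast, ← Real.rpow_mul hρ.le]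
  congr 2; push_cast; ring

lemma hasDerivAt_volPow {w : ℝ → State} {ζ : ℝ} {w' : State} (hρ : 0 < (w ζ).1)
    (hw : HasDerivAt w w' ζ) : HasDerivAt (fun z => kap α * volPow α (w z).1)
      (-(√α * volPow α (w ζ).1 * w'.1 / (w ζ).1)) ζ := by
  have h3 := ((hasDerivAt_density hw).rpow_const (p := -((1 + α) / 2)) (Or.inl hρ.ne')).const_mul (kap α)
  refine h3.congr_deriv ?_
  rw [Real.rpow_sub_one hρ.ne', kap, volPow]
  field_simp

/-- The Riemann invariant is constant across a 1-rarefaction. -/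
lemma IsRarefaction.invariant₁ {Ul Ur : State} {a b : ℝ} {w : ℝ → State}
    (h : IsRarefaction α (lam₁ α) Ul Ur a b w) : ∀ ζ ∈ Icc a b,
      (w ζ).2 - kap α * volPow α (w ζ).1 = Ul.2 - kap α * volPow α Ul.1 := by
  have hd := fun {ζ : ℝ} => h.deriv_eqs (ζ := ζ)
  obtain ⟨hab, ha, hb, hc, h1, -⟩ := h
  rw [← ha]
  apply eq_of_deriv_zero (f := fun ζ => (w ζ).2 - kap α * volPow α (w ζ).1)
  · have : ContinuousOn (fun z => volPow α (w z).1) (Icc a b) :=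
      hc.fst.rpow_const fun x hx => Or.inl (h1 x hx).1.ne'
    exact hc.snd.sub (continuousOn_const.mul this)
  · intro ζ hζ
    obtain ⟨w', hw', e1, -⟩ := hd hζ
    obtain ⟨hρ, hl⟩ := h1 ζ (Ioo_subset_Icc_self hζ)
    refine ((hasDerivAt_velocity hw').sub (hasDerivAt_volPow hα₀ hρ hw')).congr_deriv ?_
    rw [lam₁_eq hα₀] at hl
    rw [sub_neg_eq_add]
    have : (w ζ).1 * (w'.2 + √α * volPow α (w ζ).1 * w'.1 / (w ζ).1) = 0 := by
      field_simp
      linear_combination e1 - w'.1 * hl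
    exact (mul_eq_zero.1 this).resolve_left hρ.ne'

lemma integral_energy_rarefaction {lam : State → ℝ} {Ul Ur : State} {a b : ℝ} {w : ℝ → State}
    (h : IsRarefaction α lam Ul Ur a b w) :
    IntervalIntegrable (fun ζ => energy α (w ζ)) volume a b ∧
    ∫ ζ in a..b, energy α (w ζ) =
      (b * energy α Ur - energyFlux α Ur) - (a * energy α Ul - energyFlux α Ul) := by
  have hd := fun {ζ : ℝ} => h.deriv_eqs (ζ := ζ)
  obtain ⟨hab, ha, hb, hc, h1, -⟩ := h
  have hη := continuousOn_energy_comp (α := α) hc fun x hx => (h1 x hx).1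
  have hQ := continuousOn_energyFlux_comp (α := α) hc fun x hx => (h1 x hx).1
  have hi : IntervalIntegrable (fun ζ => energy α (w ζ)) volume a b :=
    ContinuousOn.intervalIntegrable (by rwa [uIcc_of_le hab])
  refine ⟨hi, ?_⟩
  have := intervalIntegral.integral_eq_sub_of_hasDerivAt_of_le
    (f := fun ζ => ζ * energy α (w ζ) - energyFlux α (w ζ)) (f' := fun ζ => energy α (w ζ)) hab
    ((continuousOn_id.mul hη).sub hQ) (fun ζ hζ => ?_) hi
  · rw [this, ha, hb]
  · obtain ⟨w', hw', e1, e2⟩ := hd hζ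
    obtain ⟨hρ, -⟩ := h1 ζ (Ioo_subset_Icc_self hζ)
    refine (((hasDerivAt_id ζ).mul (hasDerivAt_energy hρ hw')).sub
      (hasDerivAt_energyFlux hρ hw')).congr_deriv ?_
    have hp : (w ζ).1 ^ (-α) = (w ζ).1 * (w ζ).1 ^ (-α - 1) := by
      rw [Real.rpow_sub_one hρ.ne']; field_simp
    simp only [id]
    rw [hp]
    generalize (w ζ).1 ^ (-α - 1) = p at *
    field_simp
    linear_combination ((1 + α) * (w ζ).2 ^ 2 + 2 * α * p) * e1
      - 2 * (1 + α) * (w ζ).2 * e2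

include hα₁

lemma kap_sub_pos : 0 < kap α - √α := by
  have : 0 < √α := Real.sqrt_pos.2 hα₀
  have e : kap α - √α = √α * (1 - α) / (1 + α) := by
    unfold kap; field_simp; ring
  rw [e]
  have : 0 < 1 - α := by linarith
  positivity

lemma IsRarefaction.spec₁ {Ul Ur : State} {a b : ℝ} {w : ℝ → State}
    (h : IsRarefaction α (lam₁ α) Ul Ur a b w) :
    0 < Ul.1 ∧ Ur.1 ≤ Ul.1 ∧ Ur.2 = Ul.2 + volPow α Ul.1 * velCurve α (Ul.1 / Ur.1) ∧
      a = lam₁ α Ul ∧ b = lam₁ α Ur := by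
  have hi := h.invariant₁ hα₀
  obtain ⟨hab, ha, hb, hc, h1, -⟩ := h
  have e := hi b (right_mem_Icc.2 hab)
  have hl := h1 a (left_mem_Icc.2 hab)
  have hr := h1 b (right_mem_Icc.2 hab)
  rw [ha] at hl
  rw [hb] at hr e
  have hk := kap_sub_pos hα₀ hα₁
  have hz : volPow α Ul.1 ≤ volPow α Ur.1 := by
    have hl2 := hl.2
    have hr2 := hr.2
    rw [lam₁_eq hα₀] at hl2 hr2
    nlinarith
  have hle : Ur.1 ≤ Ul.1 := by
    by_contra hcon
    push Not at hcon
    exact absurd (volPow_lt hα₀ hl.1 hcon) (not_lt.2 hz)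
  refine ⟨hl.1, hle, ?_, hl.2.symm, hr.2.symm⟩
  rw [velCurve_of_one_le ((one_le_div hr.1).2 hle)]
  have := volPow_eq hα₀ hl.1 hr.1
  rw [this] at e
  linarith

lemma IsRarefaction.eq₁ {Ul Ur : State} {a b : ℝ} {w w' : ℝ → State}
    (h : IsRarefaction α (lam₁ α) Ul Ur a b w) (h' : IsRarefaction α (lam₁ α) Ul Ur a b w') :
    EqOn w w' (Icc a b) := by
  intro ζ hζ
  have i1 := h.invariant₁ hα₀ ζ hζ
  have i2 := h'.invariant₁ hα₀ ζ hζ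
  obtain ⟨-, -, -, -, h1, -⟩ := h
  obtain ⟨-, -, -, -, h2, -⟩ := h'
  obtain ⟨p1, l1⟩ := h1 ζ hζ
  obtain ⟨p2, l2⟩ := h2 ζ hζ
  rw [lam₁_eq hα₀] at l1 l2
  have hk := kap_sub_pos hα₀ hα₁
  have hz : volPow α (w ζ).1 = volPow α (w' ζ).1 := by
    apply mul_left_cancel₀ hk.ne'; linarith
  have hu : (w ζ).2 = (w' ζ).2 := by rw [hz] at i1; linarith
  refine Prod.ext ?_ hu
  rcases lt_trichotomy (w ζ).1 (w' ζ).1 with g | g | g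
  · exact absurd hz (volPow_lt hα₀ p1 g).ne'
  · exact g
  · exact absurd hz (volPow_lt hα₀ p2 g).ne

lemma exists_rarefaction₁ {Ul Ur : State} (hr : 0 < Ur.1) (hle : Ur.1 ≤ Ul.1)
    (hu : Ur.2 = Ul.2 + volPow α Ul.1 * velCurve α (Ul.1 / Ur.1)) :
    ∃ w, IsRarefaction α (lam₁ α) Ul Ur (lam₁ α Ul) (lam₁ α Ur) w := by
  have hl : 0 < Ul.1 := hr.trans_le hle
  have hk := kap_sub_pos hα₀ hα₁
  have hzl := volPow_pos hα₀ hl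
  have hzr := volPow_pos hα₀ hr
  have hβ : 0 < (1 + α) / 2 := by positivity
  have hzle : volPow α Ul.1 ≤ volPow α Ur.1 :=
    Real.rpow_le_rpow_of_nonpos hr hle (by linarith)
  rw [velCurve_of_one_le ((one_le_div hr).2 hle)] at hu
  have hzeq := volPow_eq hα₀ hl hr
  have hinv : Ur.2 - kap α * volPow α Ur.1 = Ul.2 - kap α * volPow α Ul.1 := by
    rw [hzeq]; linarith
  set C := Ul.2 - kap α * volPow α Ul.1 with hC
  let Z : ℝ → ℝ := fun ζ => (ζ - C) / (kap α - √α)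
  have hZl : Z (lam₁ α Ul) = volPow α Ul.1 := by
    simp only [Z, lam₁_eq hα₀, hC]; field_simp; ring
  have hZr : Z (lam₁ α Ur) = volPow α Ur.1 := by
    simp only [Z, lam₁_eq hα₀, ← hinv]; field_simp; ring
  have hpow : ∀ ρ : ℝ, 0 < ρ → volPow α ρ ^ (-((1 + α) / 2)⁻¹) = ρ := fun ρ hρ => by
    rw [volPow, ← Real.rpow_mul hρ.le, neg_mul_neg, mul_inv_cancel₀ hβ.ne', Real.rpow_one]
  have hpow' : ∀ z : ℝ, 0 < z → volPow α (z ^ (-((1 + α) / 2)⁻¹)) = z := fun z hz => by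
    rw [volPow, ← Real.rpow_mul hz.le, neg_mul_neg, inv_mul_cancel₀ hβ.ne', Real.rpow_one]
  have hlamle : lam₁ α Ul ≤ lam₁ α Ur := by
    rw [lam₁_eq hα₀, lam₁_eq hα₀]; nlinarith
  have hpos : ∀ ζ, lam₁ α Ul ≤ ζ → 0 < Z ζ := fun ζ hζ => by
    apply lt_of_lt_of_le (hZl ▸ hzl)
    exact div_le_div_of_nonneg_right (by linarith) hk.le
  have hZeq : ∀ ζ, C + (kap α - √α) * Z ζ = ζ := fun ζ => by
    simp only [Z]; field_simp; ring
  refine ⟨fun ζ => (Z ζ ^ (-((1 + α) / 2)⁻¹), C + kap α * Z ζ), hlamle, ?_, ?_, ?_, ?_, ?_⟩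
  · simp only [hZl]; rw [hpow _ hl]; ext <;> simp [hC]
  · simp only [hZr]; rw [hpow _ hr]; ext <;> simp [← hinv]
  · have hZc : Continuous Z := by fun_prop
    refine ContinuousOn.prodMk ?_ (by fun_prop)
    exact hZc.continuousOn.rpow_const fun ζ hζ => Or.inl (hpos ζ hζ.1).ne'
  · intro ζ hζ
    have hz := hpos ζ hζ.1
    refine ⟨Real.rpow_pos_of_pos hz _, ?_⟩
    rw [lam₁_eq hα₀]
    simp only
    rw [hpow' _ hz]
    linarith [hZeq ζ]
  · intro ζ hζ
    have hz := hpos ζ hζ.1.le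
    have hZd : HasDerivAt Z (kap α - √α)⁻¹ ζ := by
      simpa [Z, div_eq_mul_inv] using ((hasDerivAt_id ζ).sub_const C).mul_const (kap α - √α)⁻¹
    have hD := (hZd.rpow_const (p := -((1 + α) / 2)⁻¹) (Or.inl hz.ne')).prodMk
      ((hZd.const_mul (kap α)).const_add C)
    refine ⟨hD.differentiableAt, ?_⟩
    have hρ : 0 < Z ζ ^ (-((1 + α) / 2)⁻¹) := Real.rpow_pos_of_pos hz _
    rw [(hasDerivAt_flux (w := fun ζ => (Z ζ ^ (-((1 + α) / 2)⁻¹), C + kap α * Z ζ)) hρ hD).deriv,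
      (hasDerivAt_conserved (w := fun ζ => (Z ζ ^ (-((1 + α) / 2)⁻¹), C + kap α * Z ζ)) hD).deriv]
    simp only [Prod.smul_mk, smul_eq_mul]
    have hs := sq_sqrt_volPow hα₀ hρ
    rw [hpow' _ hz] at hs
    have hzu := hZeq ζ
    have hpz : Z ζ ^ (-((1 + α) / 2)⁻¹ - 1) = Z ζ ^ (-((1 + α) / 2)⁻¹) / Z ζ :=
      Real.rpow_sub_one hz.ne' _
    rw [hpz]
    have hβ' : ((1 + α) / 2)⁻¹ * √α = kap α := by unfold kap; field_simp
    rw [← hs]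
    generalize Z ζ ^ (-((1 + α) / 2)⁻¹) = ρ at *
    have hzne : Z ζ ≠ 0 := hz.ne'
    generalize Z ζ = z at *
    generalize ((1 + α) / 2)⁻¹ = γ at *
    have hzu' : C + kap α * z - ζ = √α * z := by linarith
    generalize kap α - √α = δ at *
    rw [← hβ'] at hzu' ⊢
    obtain rfl : ζ = C + γ * √α * z - √α * z := by linarith
    ext
    · simp only
      field_simp
      ring
    · simp only
      field_simp
      ring

end

/-! ### Waves and fans -/

lemma IsWave₁.refl {α : ℝ} {Ul Ur : State} {a b : ℝ} {w : ℝ → State} (h : IsWave₁ α Ul Ur a b w) :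
    IsWave₂ α (GenChaplygin.refl Ur) (GenChaplygin.refl Ul) (-b) (-a)
      (fun ζ => GenChaplygin.refl (w (-ζ))) := by
  rcases h with ⟨rfl, h⟩ | h
  · exact Or.inl ⟨rfl, h.refl⟩
  · exact Or.inr (h.refl (lam₂_refl α))

lemma IsWave₂.refl {α : ℝ} {Ul Ur : State} {a b : ℝ} {w : ℝ → State} (h : IsWave₂ α Ul Ur a b w) :
    IsWave₁ α (GenChaplygin.refl Ur) (GenChaplygin.refl Ul) (-b) (-a)
      (fun ζ => GenChaplygin.refl (w (-ζ))) := by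
  rcases h with ⟨rfl, h⟩ | h
  · exact Or.inl ⟨rfl, h.refl⟩
  · exact Or.inr (h.refl (lam₁_refl α))

lemma refl_pos {U : State} (h : 0 < U.1) : 0 < (refl U).1 := h

/-- A 1-wave followed by a 2-wave, with middle state `Um`. -/
def IsFan (α : ℝ) (Ul Um Ur : State) (a₁ b₁ a₂ b₂ : ℝ) (w₁ w₂ : ℝ → State) : Prop :=
  0 < Um.1 ∧ IsWave₁ α Ul Um a₁ b₁ w₁ ∧ IsWave₂ α Um Ur a₂ b₂ w₂ ∧ b₁ ≤ a₂

lemma IsFan.refl {α : ℝ} {Ul Um Ur : State} {a₁ b₁ a₂ b₂ : ℝ} {w₁ w₂ : ℝ → State}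
    (h : IsFan α Ul Um Ur a₁ b₁ a₂ b₂ w₁ w₂) :
    IsFan α (GenChaplygin.refl Ur) (GenChaplygin.refl Um) (GenChaplygin.refl Ul)
      (-b₂) (-a₂) (-b₁) (-a₁)
      (fun ζ => GenChaplygin.refl (w₂ (-ζ))) (fun ζ => GenChaplygin.refl (w₁ (-ζ))) :=
  ⟨h.1, h.2.2.1.refl, h.2.1.refl, neg_le_neg h.2.2.2⟩

/-- The jump in velocity left over when the outer states are joined to specific volume `τ`
along the two wave curves. -/
def velBalance (α : ℝ) (Ul Ur : State) (τ : ℝ) : ℝ :=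
  Ul.2 - Ur.2 + volPow α Ul.1 * velCurve α (Ul.1 * τ) + volPow α Ur.1 * velCurve α (Ur.1 * τ)

section

variable {α : ℝ} (hα₀ : 0 < α) (hα₁ : α < 1)
include hα₀ hα₁

lemma IsWave₁.spec {Ul Ur : State} {a b : ℝ} {w : ℝ → State} (hl : 0 < Ul.1) (hr : 0 < Ur.1)
    (h : IsWave₁ α Ul Ur a b w) :
    a ≤ b ∧ Ur.2 = Ul.2 + volPow α Ul.1 * velCurve α (Ul.1 / Ur.1) ∧ b < Ur.2 := by
  rcases h with ⟨rfl, h⟩ | h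
  · obtain ⟨-, h1, -, h3⟩ := h.spec hα₀ hα₁ hl hr
    exact ⟨le_rfl, h1, h3⟩
  · obtain ⟨-, -, h3, -, h5⟩ := h.spec₁ hα₀ hα₁
    refine ⟨h.1, h3, ?_⟩
    rw [h5, lam₁_eq hα₀]
    have := mul_pos (Real.sqrt_pos.2 hα₀) (volPow_pos hα₀ hr)
    linarith

lemma IsWave₁.unique {Ul Ur : State} {a b a' b' : ℝ} {w w' : ℝ → State} (hl : 0 < Ul.1)
    (hr : 0 < Ur.1) (h : IsWave₁ α Ul Ur a b w) (h' : IsWave₁ α Ul Ur a' b' w') :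
    a = a' ∧ b = b' ∧ EqOn w w' (Ioo a b) := by
  rcases h with ⟨rfl, h⟩ | h <;> rcases h' with ⟨rfl, h'⟩ | h'
  · have e : a = a' := (h.spec hα₀ hα₁ hl hr).2.2.1.trans (h'.spec hα₀ hα₁ hl hr).2.2.1.symm
    exact ⟨e, e, by simp⟩
  · exact absurd (h.spec hα₀ hα₁ hl hr).1 (not_lt.2 (h'.spec₁ hα₀ hα₁).2.1)
  · exact absurd (h'.spec hα₀ hα₁ hl hr).1 (not_lt.2 (h.spec₁ hα₀ hα₁).2.1)
  · obtain ⟨-, -, -, rfl, rfl⟩ := h.spec₁ hα₀ hα₁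
    obtain ⟨-, -, -, rfl, rfl⟩ := h'.spec₁ hα₀ hα₁
    exact ⟨rfl, rfl, (h.eq₁ hα₀ hα₁ h').mono Ioo_subset_Icc_self⟩

lemma exists_wave₁ {Ul Ur : State} (hl : 0 < Ul.1) (hr : 0 < Ur.1)
    (hu : Ur.2 = Ul.2 + volPow α Ul.1 * velCurve α (Ul.1 / Ur.1)) :
    ∃ a b w, IsWave₁ α Ul Ur a b w := by
  rcases lt_or_ge Ul.1 Ur.1 with h | h
  · exact ⟨_, _, fun _ => Ul, Or.inl ⟨rfl, isShock₁_of_lt hα₀ hα₁ hl h hu⟩⟩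
  · obtain ⟨w, hw⟩ := exists_rarefaction₁ hα₀ hα₁ hr h hu
    exact ⟨_, _, w, Or.inr hw⟩

lemma IsWave₁.integral_energy {Ul Ur : State} {a b : ℝ} {w : ℝ → State} (hl : 0 < Ul.1)
    (hr : 0 < Ur.1) (h : IsWave₁ α Ul Ur a b w) :
    IntervalIntegrable (fun ζ => energy α (w ζ)) volume a b ∧
    ∫ ζ in a..b, energy α (w ζ) = (b * energy α Ur - energyFlux α Ur)
      - (a * energy α Ul - energyFlux α Ul) + waveDiss α Ul.1 Ur.1 := by
  rcases h with ⟨rfl, h⟩ | h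
  · have := h.dissipation hα₀ hα₁ hl hr
    refine ⟨IntervalIntegrable.refl, ?_⟩
    rw [intervalIntegral.integral_same]
    linarith
  · have := integral_energy_rarefaction hα₀ h
    have e : waveDiss α Ul.1 Ur.1 = 0 := by
      rw [waveDiss, parDiss_of_one_le ((one_le_div hr).2 (h.spec₁ hα₀ hα₁).2.1), mul_zero]
    rwa [e, add_zero]

lemma IsWave₂.integral_energy {Ul Ur : State} {a b : ℝ} {w : ℝ → State} (hl : 0 < Ul.1)
    (hr : 0 < Ur.1) (h : IsWave₂ α Ul Ur a b w) :
    IntervalIntegrable (fun ζ => energy α (w ζ)) volume a b ∧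
    ∫ ζ in a..b, energy α (w ζ) = (b * energy α Ur - energyFlux α Ur)
      - (a * energy α Ul - energyFlux α Ul) + waveDiss α Ur.1 Ul.1 := by
  obtain ⟨h1, h2⟩ := h.refl.integral_energy hα₀ hα₁ (refl_pos hr) (refl_pos hl)
  simp only [energy_refl, energyFlux_refl, refl_fst] at h1 h2
  constructor
  · simpa using (h1.comp_sub_left 0).symm
  · rw [intervalIntegral.integral_comp_neg (fun ζ => energy α (w ζ)), neg_neg, neg_neg] at h2
    rw [h2]; ring

lemma IsFan.le {Ul Um Ur : State} {a₁ b₁ a₂ b₂ : ℝ} {w₁ w₂ : ℝ → State} (hl : 0 < Ul.1)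
    (hr : 0 < Ur.1) (h : IsFan α Ul Um Ur a₁ b₁ a₂ b₂ w₁ w₂) : a₁ ≤ b₁ ∧ b₁ ≤ a₂ ∧ a₂ ≤ b₂ := by
  have h1 := h.2.1.spec hα₀ hα₁ hl h.1
  have h2 := h.2.2.1.refl.spec hα₀ hα₁ (refl_pos hr) (refl_pos h.1)
  exact ⟨h1.1, h.2.2.2, by linarith [h2.1]⟩

lemma IsFan.middle {Ul Um Ur : State} {a₁ b₁ a₂ b₂ : ℝ} {w₁ w₂ : ℝ → State} (hl : 0 < Ul.1)
    (hr : 0 < Ur.1) (h : IsFan α Ul Um Ur a₁ b₁ a₂ b₂ w₁ w₂) :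
    Um.2 = Ul.2 + volPow α Ul.1 * velCurve α (Ul.1 / Um.1) ∧
    velBalance α Ul Ur Um.1⁻¹ = 0 := by
  have h1 := h.2.1.spec hα₀ hα₁ hl h.1
  have h2 := h.2.2.1.refl.spec hα₀ hα₁ (refl_pos hr) (refl_pos h.1)
  refine ⟨h1.2.1, ?_⟩
  have e1 := h1.2.1
  have e2 := h2.2.1
  simp only [refl_fst, refl_snd, div_eq_mul_inv] at e1 e2
  rw [velBalance]
  linarith

lemma strictMonoOn_velBalance {Ul Ur : State} (hl : 0 < Ul.1) (hr : 0 < Ur.1) :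
    StrictMonoOn (velBalance α Ul Ur) (Ici 0) := by
  intro x hx y hy hxy
  simp only [mem_Ici] at hx hy
  have h1 := strictMonoOn_velCurve hα₀ (mem_Ici.2 (mul_nonneg hl.le hx))
    (mem_Ici.2 (mul_nonneg hl.le hy)) (mul_lt_mul_of_pos_left hxy hl)
  have h2 := strictMonoOn_velCurve hα₀ (mem_Ici.2 (mul_nonneg hr.le hx))
    (mem_Ici.2 (mul_nonneg hr.le hy)) (mul_lt_mul_of_pos_left hxy hr)
  have h3 := mul_lt_mul_of_pos_left h1 (volPow_pos hα₀ hl)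
  have h4 := mul_lt_mul_of_pos_left h2 (volPow_pos hα₀ hr)
  simp only [velBalance]; linarith

lemma velBalance_zero (Ul Ur : State) :
    velBalance α Ul Ur 0 = Ul.2 - Ur.2 - volPow α Ul.1 - volPow α Ur.1 := by
  simp [velBalance, velCurve_zero hα₀]; ring

lemma IsFan.unique {Ul Um Ur Um' : State} {a₁ b₁ a₂ b₂ a₁' b₁' a₂' b₂' : ℝ}
    {w₁ w₂ w₁' w₂' : ℝ → State} (hl : 0 < Ul.1) (hr : 0 < Ur.1)
    (h : IsFan α Ul Um Ur a₁ b₁ a₂ b₂ w₁ w₂) (h' : IsFan α Ul Um' Ur a₁' b₁' a₂' b₂' w₁' w₂') :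
    Um = Um' ∧ ∀ ζ, fanProfile Ul Um Ur a₁ b₁ a₂ b₂ w₁ w₂ ζ =
      fanProfile Ul Um' Ur a₁' b₁' a₂' b₂' w₁' w₂' ζ := by
  have m := h.middle hα₀ hα₁ hl hr
  have m' := h'.middle hα₀ hα₁ hl hr
  have e1 : Um.1 = Um'.1 := inv_injective ((strictMonoOn_velBalance hα₀ hα₁ hl hr).injOn
    (mem_Ici.2 (inv_pos.2 h.1).le) (mem_Ici.2 (inv_pos.2 h'.1).le) (m.2.trans m'.2.symm))
  have e : Um = Um' := Prod.ext e1 (by rw [m.1, m'.1, e1])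
  subst e
  obtain ⟨rfl, rfl, q1⟩ := h.2.1.unique hα₀ hα₁ hl h.1 h'.2.1
  obtain ⟨p1, p2, q2⟩ := h.2.2.1.refl.unique hα₀ hα₁ (refl_pos hr) (refl_pos h.1) h'.2.2.1.refl
  obtain rfl := neg_injective p1
  obtain rfl := neg_injective p2
  refine ⟨rfl, fun ζ => ?_⟩
  unfold fanProfile
  split_ifs with c1 c2 c3 c4
  · rfl
  · exact q1 ⟨by linarith, c2⟩
  · rfl
  · have := @q2 (-ζ) ⟨by linarith, by linarith⟩
    simp only [neg_neg] at this
    rw [← refl_refl (w₂ ζ), this, refl_refl]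
  · rfl

lemma exists_fan_of_velBalance {Ul Ur : State} (hl : 0 < Ul.1) (hr : 0 < Ur.1) {τ : ℝ} (hτ : 0 < τ)
    (h : velBalance α Ul Ur τ = 0) : ∃ (Um : State) (a₁ b₁ a₂ b₂ : ℝ) (w₁ w₂ : ℝ → State),
      Um.1 = τ⁻¹ ∧ IsFan α Ul Um Ur a₁ b₁ a₂ b₂ w₁ w₂ := by
  set Um : State := (τ⁻¹, Ul.2 + volPow α Ul.1 * velCurve α (Ul.1 / τ⁻¹)) with hUm
  have hm : 0 < Um.1 := inv_pos.2 hτ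
  obtain ⟨a₁, b₁, w₁, h1⟩ := exists_wave₁ hα₀ hα₁ (Ul := Ul) (Ur := Um) hl hm rfl
  obtain ⟨a, b, w, h2⟩ := exists_wave₁ hα₀ hα₁ (Ul := refl Ur) (Ur := refl Um) hr hm (by
    simp only [refl_fst, refl_snd, hUm, div_inv_eq_mul]
    rw [velBalance] at h
    linarith)
  have hb := (h1.spec hα₀ hα₁ hl hm).2.2
  have hb2 := (h2.spec hα₀ hα₁ (refl_pos hr) (refl_pos hm)).2.2
  have h3 := h2.refl
  rw [refl_refl, refl_refl] at h3
  simp only [refl_snd] at hb2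
  exact ⟨Um, a₁, b₁, -b, -a, w₁, _, rfl, hm, h1, h3, by linarith⟩

lemma exists_velBalance_eq_zero {Ul Ur : State} (hl : 0 < Ul.1) (hr : 0 < Ur.1)
    (h : Ul.2 - Ur.2 < volPow α Ul.1 + volPow α Ur.1) :
    ∃ τ > 0, velBalance α Ul Ur τ = 0 := by
  have hc : ContinuousOn (velBalance α Ul Ur) (Ici 0) := by
    have h1 : ContinuousOn (fun τ => velCurve α (Ul.1 * τ)) (Ici 0) :=
      (continuous_velCurve_Ici hα₀).comp (by fun_prop) fun τ hτ => mul_nonneg hl.le hτ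
    have h2 : ContinuousOn (fun τ => velCurve α (Ur.1 * τ)) (Ici 0) :=
      (continuous_velCurve_Ici hα₀).comp (by fun_prop) fun τ hτ => mul_nonneg hr.le hτ
    unfold velBalance; fun_prop
  have h0 : velBalance α Ul Ur 0 < 0 := by rw [velBalance_zero hα₀ hα₁]; linarith
  have hzl := volPow_pos hα₀ hl
  have hzr := volPow_pos hα₀ hr
  have hk := kap_pos hα₀
  have hβ : 0 < (1 + α) / 2 := by positivity
  obtain ⟨T, hT⟩ : ∃ T ≥ (0 : ℝ), 0 ≤ velBalance α Ul Ur T := by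
    have t1 : Tendsto (fun τ : ℝ => volPow α Ul.1 * (kap α * ((Ul.1 * τ) ^ ((1 + α) / 2) - 1)))
        atTop atTop := by
      refine Tendsto.const_mul_atTop hzl (Tendsto.const_mul_atTop hk ?_)
      refine tendsto_atTop_add_const_right _ (-1) ?_
      exact (tendsto_rpow_atTop hβ).comp (tendsto_id.const_mul_atTop hl)
    obtain ⟨T, h1, h2, h3⟩ := ((t1.eventually_ge_atTop (Ur.2 - Ul.2)).and
      ((eventually_ge_atTop Ul.1⁻¹).and (eventually_ge_atTop Ur.1⁻¹))).exists
    have hT0 : 0 < T := (inv_pos.2 hl).trans_le h2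
    have g1 : 1 ≤ Ul.1 * T := by rwa [inv_le_iff_one_le_mul₀' hl] at h2
    have g2 : 1 ≤ Ur.1 * T := by rwa [inv_le_iff_one_le_mul₀' hr] at h3
    refine ⟨T, hT0.le, ?_⟩
    rw [velBalance, velCurve_of_one_le g1, velCurve_of_one_le g2]
    have g3 : (1 : ℝ) ≤ (Ur.1 * T) ^ ((1 + α) / 2) := Real.one_le_rpow g2 hβ.le
    have : 0 ≤ volPow α Ur.1 * (kap α * ((Ur.1 * T) ^ ((1 + α) / 2) - 1)) :=
      mul_nonneg hzr.le (mul_nonneg hk.le (by linarith))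
    linarith
  obtain ⟨τ, hτ, e⟩ := intermediate_value_Icc hT.1 (hc.mono Icc_subset_Ici_self) ⟨h0.le, hT.2⟩
  refine ⟨τ, lt_of_le_of_ne hτ.1 ?_, e⟩
  rintro rfl
  linarith

lemma IsFan.sub_lt {Ul Um Ur : State} {a₁ b₁ a₂ b₂ : ℝ} {w₁ w₂ : ℝ → State} (hl : 0 < Ul.1)
    (hr : 0 < Ur.1) (h : IsFan α Ul Um Ur a₁ b₁ a₂ b₂ w₁ w₂) :
    Ul.2 - Ur.2 < volPow α Ul.1 + volPow α Ur.1 := by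
  have h1 := (h.middle hα₀ hα₁ hl hr).2
  have h2 := strictMonoOn_velBalance hα₀ hα₁ hl hr self_mem_Ici
    (mem_Ici.2 (inv_pos.2 h.1).le) (inv_pos.2 h.1)
  rw [velBalance_zero hα₀ hα₁, h1] at h2
  linarith

end

/-! ### Shadow waves -/

/-- `c` is the speed of an overcompressive shadow wave from `Ul` to `Ur`. -/
def IsShadowSpeed (α : ℝ) (Ul Ur : State) (c : ℝ) : Prop :=
  c ≤ lam₁ α Ul ∧ lam₂ α Ur ≤ c ∧
    Ul.1 * (Ul.2 - c) ^ 2 - Ul.1 ^ (-α) = Ur.1 * (Ur.2 - c) ^ 2 - Ur.1 ^ (-α)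

/-- The energy dissipation of a shadow wave with vanishing internal pressure. -/
def shadowDiss (α : ℝ) (Ul Ur : State) (c : ℝ) : ℝ :=
  (1 / 2 * Ur.1 * (Ur.2 - c) ^ 3 - α / (1 + α) * Ur.1 ^ (-α) * (Ur.2 - c))
    - (1 / 2 * Ul.1 * (Ul.2 - c) ^ 3 - α / (1 + α) * Ul.1 ^ (-α) * (Ul.2 - c))

/-- The mass concentrated in a shadow wave per unit time. -/
def shadowMass (Ul Ur : State) (c : ℝ) : ℝ := Ul.1 * (Ul.2 - c) - Ur.1 * (Ur.2 - c)

/-- The dissipation of a fan. -/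
def fanDiss (α : ℝ) (Ul Um Ur : State) : ℝ := waveDiss α Ul.1 Um.1 + waveDiss α Ur.1 Um.1

lemma IsShadowSpeed.refl {α : ℝ} {Ul Ur : State} {c : ℝ} (h : IsShadowSpeed α Ul Ur c) :
    IsShadowSpeed α (GenChaplygin.refl Ur) (GenChaplygin.refl Ul) (-c) := by
  obtain ⟨h1, h2, h3⟩ := h
  refine ⟨by rw [lam₁_refl]; linarith, by rw [lam₂_refl]; linarith, ?_⟩
  simp only [refl_fst, refl_snd]
  linear_combination -h3

lemma shadowDiss_refl (α : ℝ) (Ul Ur : State) (c : ℝ) :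
    shadowDiss α (refl Ur) (refl Ul) (-c) = shadowDiss α Ul Ur c := by
  simp only [shadowDiss, refl_fst, refl_snd]; ring

/-- The least dissipation rate `D` among the solutions of a Riemann problem: either there is a
classical solution, which beats every shadow wave, or there are only shadow waves. -/
def IsOptDiss (α : ℝ) (Ul Ur : State) (D : ℝ) : Prop :=
  (∃ (Um : State) (a₁ b₁ a₂ b₂ : ℝ) (w₁ w₂ : ℝ → State), IsFan α Ul Um Ur a₁ b₁ a₂ b₂ w₁ w₂ ∧
      D = fanDiss α Ul Um Ur ∧ ∀ c, IsShadowSpeed α Ul Ur c → D < shadowDiss α Ul Ur c) ∨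
  ((¬∃ (Um : State) (a₁ b₁ a₂ b₂ : ℝ) (w₁ w₂ : ℝ → State), IsFan α Ul Um Ur a₁ b₁ a₂ b₂ w₁ w₂) ∧
    ∃ c, IsShadowSpeed α Ul Ur c ∧ D = shadowDiss α Ul Ur c)

lemma IsOptDiss.refl {α : ℝ} {Ul Ur : State} {D : ℝ} (h : IsOptDiss α Ul Ur D) :
    IsOptDiss α (GenChaplygin.refl Ur) (GenChaplygin.refl Ul) D := by
  rcases h with ⟨Um, a₁, b₁, a₂, b₂, w₁, w₂, hf, hD, hs⟩ | ⟨hn, c, hc, hD⟩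
  · refine Or.inl ⟨_, _, _, _, _, _, _, hf.refl, ?_, fun c hc => ?_⟩
    · rw [hD]; simp [fanDiss, add_comm]
    · have := hs (-c) (by simpa using hc.refl)
      rwa [← shadowDiss_refl, neg_neg] at this
  · refine Or.inr ⟨?_, -c, hc.refl, by rw [shadowDiss_refl, hD]⟩
    rintro ⟨Um, a₁, b₁, a₂, b₂, w₁, w₂, hf⟩
    have := hf.refl
    rw [refl_refl, refl_refl] at this
    exact hn ⟨_, _, _, _, _, _, _, this⟩

lemma mem_Icc_of_weighted {A B c s₁ s₂ : ℝ} (hA : 0 < A) (hB : 0 < B) (hs : s₁ < s₂)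
    (hq : A * (c - s₁) ^ 2 = B * (c - s₂) ^ 2) (hM : 0 < A * (c - s₁) + B * (s₂ - c)) :
    s₁ ≤ c ∧ c ≤ s₂ := by
  constructor
  · by_contra hcon
    push Not at hcon
    have h0 : 0 < s₁ - c := by linarith
    have h1 := mul_pos hM h0
    have h2 := mul_pos (mul_pos hB (by linarith : 0 < s₂ - c)) (by linarith : 0 < s₂ - s₁)
    linarith only [h1, h2, hq]
  · by_contra hcon
    push Not at hcon
    have h0 : 0 < c - s₂ := by linarith
    have h1 := mul_pos hM h0
    have h2 := mul_pos (mul_pos hA (by linarith : 0 < c - s₁)) (by linarith : 0 < s₂ - s₁)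
    linarith only [h1, h2, hq]

section

variable {α : ℝ} (hα₀ : 0 < α) (hα₁ : α < 1)
include hα₀

lemma IsShadowSpeed.lt {Ul Ur : State} {c : ℝ} (hl : 0 < Ul.1) (hr : 0 < Ur.1)
    (h : IsShadowSpeed α Ul Ur c) : Ur.2 < c ∧ c < Ul.2 := by
  obtain ⟨h1, h2, -⟩ := h
  rw [lam₁_eq hα₀] at h1
  rw [lam₂_eq hα₀] at h2
  have hs := Real.sqrt_pos.2 hα₀
  have := mul_pos hs (volPow_pos hα₀ hl)
  have := mul_pos hs (volPow_pos hα₀ hr)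
  constructor <;> linarith

lemma IsShadowSpeed.unique {Ul Ur : State} {c c' : ℝ} (hl : 0 < Ul.1) (hr : 0 < Ur.1)
    (h : IsShadowSpeed α Ul Ur c) (h' : IsShadowSpeed α Ul Ur c') : c = c' := by
  have key : ∀ c c', IsShadowSpeed α Ul Ur c → IsShadowSpeed α Ul Ur c' → ¬ c < c' := by
    intro c c' h h' hlt
    obtain ⟨p1, p2⟩ := h.lt hα₀ hl hr
    obtain ⟨q1, q2⟩ := h'.lt hα₀ hl hr
    have e1 := h.2.2
    have e2 := h'.2.2
    have a : Ul.1 * (Ul.2 - c') ^ 2 < Ul.1 * (Ul.2 - c) ^ 2 :=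
      mul_lt_mul_of_pos_left (by nlinarith) hl
    have b : Ur.1 * (Ur.2 - c) ^ 2 < Ur.1 * (Ur.2 - c') ^ 2 :=
      mul_lt_mul_of_pos_left (by nlinarith) hr
    linarith
  exact le_antisymm (not_lt.1 (key _ _ h' h)) (not_lt.1 (key _ _ h h'))

lemma IsShadowSpeed.mass_pos {Ul Ur : State} {c : ℝ} (hl : 0 < Ul.1) (hr : 0 < Ur.1)
    (h : IsShadowSpeed α Ul Ur c) : 0 < shadowMass Ul Ur c := by
  obtain ⟨p1, p2⟩ := h.lt hα₀ hl hr
  have a := mul_pos hl (sub_pos.2 p2)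
  have b := mul_pos hr (sub_pos.2 p1)
  unfold shadowMass; linarith

lemma shadowDiss_eq {Ul Ur : State} {c : ℝ} (h : IsShadowSpeed α Ul Ur c) :
    shadowDiss α Ul Ur c = 1 / 2 * c ^ 2 * shadowMass Ul Ur c
      - c * (energy α Ur - energy α Ul) + (energyFlux α Ur - energyFlux α Ul) := by
  have := h.2.2
  simp only [shadowDiss, shadowMass, energy, energyFlux]
  have h1 : 1 + α ≠ 0 := by positivity
  field_simp
  linear_combination 2 * (1 + α) * c * this

include hα₁

lemma rpow_neg_ge_tangent {ρ r : ℝ} (hρ : 0 < ρ) (hr : 0 < r) :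
    r ^ (-α) - α * r ^ (-α) / r * (ρ - r) ≤ ρ ^ (-α) := by
  have hy : 0 < ρ / r := div_pos hρ hr
  have h1 : (ρ / r) ^ α ≤ 1 + α * (ρ / r - 1) := by
    have := rpow_one_add_le_one_add_mul_self (s := ρ / r - 1) (by linarith) hα₀.le hα₁.le
    simpa using this
  have h0 : 0 < (ρ / r) ^ α := Real.rpow_pos_of_pos hy α
  have h2 : 1 - α * (ρ / r - 1) ≤ (ρ / r) ^ (-α) := by
    rw [Real.rpow_neg hy.le, ← one_div, le_div_iff₀ h0]
    rcases le_or_gt (1 - α * (ρ / r - 1)) 0 with g | g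
    · nlinarith
    · nlinarith [mul_le_mul_of_nonneg_left h1 g.le, sq_nonneg (α * (ρ / r - 1))]
  have h3 : ρ ^ (-α) = r ^ (-α) * (ρ / r) ^ (-α) := by
    rw [← Real.mul_rpow hr.le hy.le]; congr 1; field_simp
  have h4 : 0 < r ^ (-α) := Real.rpow_pos_of_pos hr _
  have := mul_le_mul_of_nonneg_left h2 h4.le
  rw [h3]
  refine le_trans (le_of_eq ?_) this
  field_simp

/-- The energy density is convex in the conserved quantities. -/
lemma energy_ge_tangent {U V : State} (hU : 0 < U.1) (hV : 0 < V.1) :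
    energy α V + (-(1 / 2) * V.2 ^ 2 - 1 / (1 + α) * (α * V.1 ^ (-α) / V.1)) * (U.1 - V.1)
      + V.2 * (U.1 * U.2 - V.1 * V.2) ≤ energy α U := by
  have hi : 0 < 1 / (1 + α) := by positivity
  have := mul_le_mul_of_nonneg_left (rpow_neg_ge_tangent hα₀ hα₁ hU hV) hi.le
  have q := mul_nonneg hU.le (sq_nonneg (U.2 - V.2))
  unfold energy
  linarith only [this, q]

/-- Two shocks dissipate strictly more energy than a shadow wave between the same states. -/
lemma fanDiss_lt_shadowDiss {Ul Um Ur : State} {a₁ b₁ a₂ b₂ c : ℝ} {w₁ w₂ : ℝ → State}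
    (hl : 0 < Ul.1) (hr : 0 < Ur.1) (h : IsFan α Ul Um Ur a₁ b₁ a₂ b₂ w₁ w₂)
    (h1 : Ul.1 < Um.1) (h2 : Ur.1 < Um.1) (hc : IsShadowSpeed α Ul Ur c) :
    fanDiss α Ul Um Ur < shadowDiss α Ul Ur c := by
  have hm := h.1
  obtain ⟨h11, h12, -⟩ := h.2.1.spec hα₀ hα₁ hl hm
  obtain ⟨h21, h22, -⟩ := h.2.2.1.refl.spec hα₀ hα₁ (refl_pos hr) (refl_pos hm)
  have S1 := isShock₁_of_lt hα₀ hα₁ hl h1 h12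
  have S2 := isShock₁_of_lt hα₀ hα₁ (Ul := GenChaplygin.refl Ur) (Ur := GenChaplygin.refl Um)
    (refl_pos hr) h2 h22
  have D1 := S1.dissipation hα₀ hα₁ hl hm
  have D2 := S2.dissipation hα₀ hα₁ (refl_pos hr) (refl_pos hm)
  have l1 := (S1.spec hα₀ hα₁ hl hm).2.2.2
  have l2 := (S2.spec hα₀ hα₁ (refl_pos hr) (refl_pos hm)).2.2.2
  have R1 := rankineHugoniot_iff.1 S1.1
  have R2 := rankineHugoniot_iff.1 S2.1
  generalize Ul.2 - volPow α Ul.1 * massFlux α (Ul.1 / Um.1) = s₁ at *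
  generalize (GenChaplygin.refl Ur).2 - volPow α (GenChaplygin.refl Ur).1 * massFlux α ((GenChaplygin.refl Ur).1 / (GenChaplygin.refl Um).1) = s at *
  obtain ⟨s₂, rfl⟩ : ∃ s₂, s = -s₂ := ⟨-s, by ring⟩
  simp only [energy_refl, energyFlux_refl, refl_fst, refl_snd] at D2 l2 R2
  have hs : s₁ < s₂ := by linarith
  have hM := hc.mass_pos hα₀ hl hr
  have hM' : shadowMass Ul Ur c = (Um.1 - Ul.1) * (c - s₁) + (Um.1 - Ur.1) * (s₂ - c) := by
    unfold shadowMass; linear_combination -R1.1 - R2.1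
  have hq : (Um.1 - Ul.1) * (c - s₁) ^ 2 = (Um.1 - Ur.1) * (c - s₂) ^ 2 := by
    linear_combination -hc.2.2 - R1.2 + (2 * c - s₁) * R1.1 + R2.2 + (2 * c - s₂) * R2.1
  have hA : 0 < Um.1 - Ul.1 := by linarith
  have hB : 0 < Um.1 - Ur.1 := by linarith
  obtain ⟨c1, c2⟩ := mem_Icc_of_weighted hA hB hs hq (hM' ▸ hM)
  rw [fanDiss, ← D1, ← D2, shadowDiss_eq hα₀ hc]
  have hp : 0 < α * Um.1 ^ (-α) / Um.1 := by have := Real.rpow_pos_of_pos hm (-α); positivity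
  set p := α * Um.1 ^ (-α) / Um.1 with hpdef
  have hi : 0 < 1 / (1 + α) := by positivity
  have K1 := energy_ge_tangent hα₀ hα₁ hl hm
  have K2 := energy_ge_tangent hα₀ hα₁ hr hm
  rw [← hpdef] at K1 K2
  have K3 : (-(1 / 2) * Um.2 ^ 2 - 1 / (1 + α) * p + Um.2 * c) * shadowMass Ul Ur c <
      1 / 2 * c ^ 2 * shadowMass Ul Ur c := by
    apply mul_lt_mul_of_pos_right _ hM
    have q1 := mul_pos hi hp
    have q2 := sq_nonneg (Um.2 - c)
    linarith only [q1, q2]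
  have L1 := mul_le_mul_of_nonneg_left K1 (sub_nonneg.2 c1)
  have L2 := mul_le_mul_of_nonneg_left K2 (sub_nonneg.2 c2)
  have hM2 : c * shadowMass Ul Ur c = (c - s₁) * (Um.1 * Um.2 - Ul.1 * Ul.2)
      + (s₂ - c) * (Um.1 * Um.2 - Ur.1 * Ur.2) := by
    unfold shadowMass
    linear_combination -hc.2.2 - R1.2 + R2.2
  have L3 := congrArg (Um.2 * ·) hM2
  have L4 := congrArg ((-(1 / 2) * Um.2 ^ 2 - 1 / (1 + α) * p) * ·) hM'
  beta_reduce at L3 L4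
  generalize shadowMass Ul Ur c = M at *
  generalize 1 / (1 + α) = γ at *
  generalize energyFlux α Ur = Qr at *
  generalize energyFlux α Ul = Ql at *
  generalize energyFlux α Um = Qm at *
  generalize energy α Ur = ηr at *
  generalize energy α Ul = ηl at *
  generalize energy α Um = ηm at *
  clear_value p
  linarith only [K3, L1, L2, L3, L4]

end

/-! ### Riemann problems with a very dense right state -/

/-- The limit, as `R → ∞`, of the least dissipation rate of the Riemann problem from `(ρ, u)` to
`(R, v)`. -/
def limitDiss (α ρ u v : ℝ) : ℝ :=
  ρ ^ (-α) * volPow α ρ * limDiss α ((v - u) / volPow α ρ)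

section

variable {α : ℝ} (hα₀ : 0 < α) (hα₁ : α < 1)
include hα₀ hα₁

lemma tendsto_volPow : Tendsto (volPow α) atTop (𝓝 0) :=
  tendsto_rpow_neg_atTop (by positivity : 0 < (1 + α) / 2)

lemma volPow_mul_velCurve {R τ : ℝ} (hR : 0 < R) (hτ : 0 < τ) (h : 1 ≤ R * τ) :
    volPow α R * velCurve α (R * τ) = kap α * (τ ^ ((1 + α) / 2) - volPow α R) := by
  rw [velCurve_of_one_le h, Real.mul_rpow hR.le hτ.le, volPow, Real.rpow_neg hR.le]
  have := Real.rpow_pos_of_pos hR ((1 + α) / 2)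
  field_simp

lemma parVel_mul {ρ τ : ℝ} (hρ : 0 < ρ) (hτ : 0 < τ) :
    volPow α ρ * parVel α (ρ * τ) =
      volPow α ρ * velCurve α (ρ * τ) + kap α * τ ^ ((1 + α) / 2) := by
  have h0 : 0 < ρ * τ := mul_pos hρ hτ
  rw [parVel, if_neg (not_lt.2 h0.le), Real.mul_rpow hρ.le hτ.le, volPow, Real.rpow_neg hρ.le]
  have := Real.rpow_pos_of_pos hρ ((1 + α) / 2)
  field_simp

/-- The parameter of the 1-wave is close to the one of the limiting problem. -/
lemma abs_parVel_sub_le {ρ u R v τ : ℝ} (hρ : 0 < ρ) (hR : 0 < R) (hτ : 0 < τ)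
    (h : velBalance α (ρ, u) (R, v) τ = 0) :
    |parVel α (ρ * τ) - (v - u) / volPow α ρ| ≤ (1 + kap α) * volPow α R / volPow α ρ := by
  have hz := volPow_pos hα₀ hρ
  have hZ := volPow_pos hα₀ hR
  have hk := kap_pos hα₀
  have e := parVel_mul hα₀ hα₁ hρ hτ
  simp only [velBalance] at h
  have e2 : parVel α (ρ * τ) - (v - u) / volPow α ρ =
      (kap α * τ ^ ((1 + α) / 2) - volPow α R * velCurve α (R * τ)) / volPow α ρ := by
    rw [eq_div_iff hz.ne', sub_mul, div_mul_cancel₀ _ hz.ne']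
    linarith
  rw [e2, abs_div, abs_of_pos hz]
  apply div_le_div_of_nonneg_right _ hz.le
  rcases le_or_gt 1 (R * τ) with g | g
  · rw [volPow_mul_velCurve hα₀ hα₁ hR hτ g, abs_le]
    have := mul_pos hk hZ
    constructor <;> linarith
  · have h1 := velCurve_mem hα₀ (mul_pos hR hτ).le g.le
    have h2 : τ ^ ((1 + α) / 2) ≤ volPow α R := by
      rw [volPow, Real.rpow_neg hR.le, ← Real.inv_rpow hR.le]
      apply Real.rpow_le_rpow hτ.le _ (by positivity)
      rw [le_inv_comm₀ hτ hR, ← one_div, le_div_iff₀ hτ]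
      exact g.le
    have h3 : 0 < τ ^ ((1 + α) / 2) := Real.rpow_pos_of_pos hτ _
    have h4 := mul_le_mul_of_nonneg_left h2 hk.le
    have h5 := mul_pos hk h3
    rw [abs_le]
    constructor <;> nlinarith [h1.1, h1.2]

lemma continuous_limitDiss (ρ u : ℝ) : Continuous (limitDiss α ρ u) := by
  have := continuous_limDiss hα₀ hα₁
  unfold limitDiss; fun_prop

/-- The dissipation of a fan is close to its limit. -/
lemma abs_fanDiss_sub_le {ρ u R v : ℝ} {Um : State} (hρ : 0 < ρ) (hR : 0 < R) (hm : 0 < Um.1) :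
    |fanDiss α (ρ, u) Um (R, v) - limitDiss α ρ u v| ≤
      ρ ^ (-α) * volPow α ρ *
        |limDiss α (parVel α (ρ / Um.1)) - limDiss α ((v - u) / volPow α ρ)|
      + R ^ (-α) * volPow α R * |parDiss α 0| := by
  have hz := volPow_pos hα₀ hρ
  have hZ := volPow_pos hα₀ hR
  have hp : 0 < ρ ^ (-α) := Real.rpow_pos_of_pos hρ _
  have hP : 0 < R ^ (-α) := Real.rpow_pos_of_pos hR _
  rw [limDiss_parVel hα₀ hα₁]
  have e : fanDiss α (ρ, u) Um (R, v) - limitDiss α ρ u v =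
      ρ ^ (-α) * volPow α ρ * (parDiss α (ρ / Um.1) - limDiss α ((v - u) / volPow α ρ))
      + R ^ (-α) * volPow α R * parDiss α (R / Um.1) := by
    simp only [fanDiss, waveDiss, limitDiss]; ring
  rw [e]
  refine (abs_add_le _ _).trans (add_le_add ?_ ?_)
  · rw [abs_mul, abs_of_pos (mul_pos hp hz)]
  · rw [abs_mul, abs_of_pos (mul_pos hP hZ)]
    apply mul_le_mul_of_nonneg_left _ (mul_pos hP hZ).le
    rw [abs_of_nonpos (parDiss_nonpos hα₀ hα₁ _), abs_of_nonpos (parDiss_nonpos hα₀ hα₁ _)]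
    exact neg_le_neg (parDiss_zero_le hα₀ hα₁ (div_pos hR hm).le)

lemma tendsto_dense_coeff : Tendsto (fun R : ℝ => R ^ (-α) * volPow α R * |parDiss α 0|)
    atTop (𝓝 0) := by
  have h1 := (tendsto_rpow_neg_atTop hα₀).mul (tendsto_volPow hα₀ hα₁)
  simpa using h1.mul_const |parDiss α 0|

lemma fan_fast {ρ u R v : ℝ} {Um : State} {a₁ b₁ a₂ b₂ : ℝ} {w₁ w₂ : ℝ → State} (hρ : 0 < ρ)
    (hR : ρ ≤ R) (h : IsFan α (ρ, u) Um (R, v) a₁ b₁ a₂ b₂ w₁ w₂)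
    (hv : u + kap α * volPow α ρ ≤ v) : fanDiss α (ρ, u) Um (R, v) = 0 := by
  have hR0 : 0 < R := hρ.trans_le hR
  have hz := volPow_pos hα₀ hρ
  have hZ := volPow_pos hα₀ hR0
  have hk := kap_pos hα₀
  have hm := h.1
  have hτ := inv_pos.2 hm
  have hb := (h.middle hα₀ hα₁ hρ hR0).2
  have g : 1 ≤ ρ * Um.1⁻¹ := by
    by_contra hcon
    push Not at hcon
    have h1 := velCurve_mem hα₀ (mul_pos hρ hτ).le hcon.le
    simp only [velBalance] at hb
    have h2 : volPow α R * velCurve α (R * Um.1⁻¹) ≤ kap α * Um.1⁻¹ ^ ((1 + α) / 2) := by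
      have h3 : 0 < Um.1⁻¹ ^ ((1 + α) / 2) := Real.rpow_pos_of_pos hτ _
      rcases le_or_gt 1 (R * Um.1⁻¹) with g | g
      · rw [volPow_mul_velCurve hα₀ hα₁ hR0 hτ g]; nlinarith
      · have := velCurve_mem hα₀ (mul_pos hR0 hτ).le g.le
        have h5 := mul_pos hk h3
        have := mul_nonpos_of_nonneg_of_nonpos hZ.le this.2
        linarith
    have h4 : Um.1⁻¹ ^ ((1 + α) / 2) < volPow α ρ := by
      rw [volPow, Real.rpow_neg hρ.le, ← Real.inv_rpow hρ.le]
      apply Real.rpow_lt_rpow hτ.le _ (by positivity)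
      rw [lt_inv_comm₀ hτ hρ, ← one_div, lt_div_iff₀ hτ]
      exact hcon
    have h5 := mul_lt_mul_of_pos_left h4 hk
    have h6 : volPow α ρ * velCurve α (ρ * Um.1⁻¹) ≤ 0 := mul_nonpos_of_nonneg_of_nonpos hz.le h1.2
    linarith
  have g' : 1 ≤ R * Um.1⁻¹ := g.trans (mul_le_mul_of_nonneg_right hR hτ.le)
  simp only [fanDiss, waveDiss, div_eq_mul_inv]
  rw [parDiss_of_one_le g, parDiss_of_one_le g', mul_zero, mul_zero, add_zero]

lemma not_isShadowSpeed {ρ u v : ℝ} (hρ : 0 < ρ) (hv : u - volPow α ρ < v) :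
    ∀ᶠ R in atTop, ∀ c, ¬ IsShadowSpeed α (ρ, u) (R, v) c := by
  have hz := volPow_pos hα₀ hρ
  rcases lt_or_ge u v with h | h
  · filter_upwards [eventually_gt_atTop 0] with R hR c hc
    have := hc.lt hα₀ hρ hR
    simp only at this
    linarith
  · have hg : 0 < ρ ^ (-α) - ρ * (u - v) ^ 2 := by
      rw [← mul_sq_volPow hα₀ hρ]
      have : (u - v) ^ 2 < volPow α ρ ^ 2 := by nlinarith
      nlinarith
    filter_upwards [eventually_gt_atTop 0, (tendsto_rpow_neg_atTop hα₀).eventually_lt_const hg]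
      with R hR hlt c hc
    have h1 := hc.lt hα₀ hρ hR
    have h2 := hc.2.2
    simp only at h1 h2
    have h3 : ρ * (u - c) ^ 2 ≤ ρ * (u - v) ^ 2 := mul_le_mul_of_nonneg_left (by nlinarith) hρ.le
    have h4 : 0 ≤ R * (v - c) ^ 2 := by positivity
    linarith

lemma isFan_two_shocks {ρ u R v : ℝ} {Um : State} {a₁ b₁ a₂ b₂ : ℝ} {w₁ w₂ : ℝ → State}
    (hρ : 0 < ρ) (hR : ρ ≤ R) (h : IsFan α (ρ, u) Um (R, v) a₁ b₁ a₂ b₂ w₁ w₂)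
    (hv : v ≤ u - volPow α ρ) : ρ < Um.1 ∧ R < Um.1 := by
  have hR0 : 0 < R := hρ.trans_le hR
  have hz := volPow_pos hα₀ hρ
  have hk := kap_pos hα₀
  have hm := h.1
  have hτ := inv_pos.2 hm
  have hb := (h.middle hα₀ hα₁ hρ hR0).2
  have g : R * Um.1⁻¹ < 1 := by
    by_contra hcon
    push Not at hcon
    simp only [velBalance] at hb
    have h1 := strictMonoOn_velCurve hα₀ self_mem_Ici (mem_Ici.2 (mul_pos hρ hτ).le) (mul_pos hρ hτ)
    rw [velCurve_zero hα₀] at h1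
    have h2 : 0 ≤ velCurve α (R * Um.1⁻¹) := by
      rw [velCurve_of_one_le hcon]
      have := Real.one_le_rpow hcon (by positivity : 0 ≤ (1 + α) / 2)
      exact mul_nonneg hk.le (by linarith)
    have h3 := mul_nonneg (volPow_pos hα₀ hR0).le h2
    nlinarith
  have g' : R < Um.1 := by rwa [← div_eq_mul_inv, div_lt_one hm] at g
  exact ⟨hR.trans_lt g', g'⟩

lemma limitDiss_of_le {ρ u v : ℝ} (hρ : 0 < ρ) (hv : v < u - volPow α ρ) :
    limitDiss α ρ u v =
      -(1 / 2 * ρ * (u - v) ^ 3 - α / (1 + α) * ρ ^ (-α) * (u - v)) := by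
  have hz := volPow_pos hα₀ hρ
  have hy : (v - u) / volPow α ρ + 1 < 0 := by
    rw [div_add_one hz.ne']; exact div_neg_of_neg_of_pos (by linarith) hz
  have e : parVel α ((v - u) / volPow α ρ + 1) = (v - u) / volPow α ρ := by
    rw [parVel, if_pos hy]; ring
  have e2 : limDiss α ((v - u) / volPow α ρ) = parDiss α ((v - u) / volPow α ρ + 1) := by
    conv_lhs => rw [← e]
    rw [limDiss_parVel hα₀ hα₁]
  rw [limitDiss, e2, parDiss, if_pos hy, ← mul_sq_volPow hα₀ hρ]
  field_simp
  ring

lemma tendsto_shadowDiss {ρ u v : ℝ} (hρ : 0 < ρ) (hv : v < u - volPow α ρ) {δ : ℝ} (hδ : 0 < δ) :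
    ∀ᶠ R in atTop, ∀ c, IsShadowSpeed α (ρ, u) (R, v) c →
      |shadowDiss α (ρ, u) (R, v) c - limitDiss α ρ u v| < δ := by
  set f : ℝ → ℝ := fun c => 1 / 2 * ρ * (u - c) ^ 3 - α / (1 + α) * ρ ^ (-α) * (u - c) with hf
  have hfc : Continuous f := by fun_prop
  obtain ⟨η, hη, hfη⟩ := Metric.continuousAt_iff.1 (hfc.continuousAt (x := v)) (δ / 2)
    (by positivity)
  set K := ρ * (u - v) ^ 2 + 1 with hK
  have hKpos : 0 < K := by positivity
  have hs : Tendsto (fun R : ℝ => √(K / R)) atTop (𝓝 0) := by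
    have : Tendsto (fun R : ℝ => K / R) atTop (𝓝 0) := tendsto_const_nhds.div_atTop tendsto_id
    simpa [Function.comp_def] using (Real.continuous_sqrt.tendsto 0).comp this
  have hm : 0 < min η (δ / 2 / (K + 1)) := by positivity
  filter_upwards [eventually_ge_atTop 1, hs.eventually_lt_const hm] with R hR hlt c hc
  have hR0 : 0 < R := by linarith
  obtain ⟨h1, h2⟩ := hc.lt hα₀ hρ hR0
  have h3 := hc.2.2
  simp only at h1 h2 h3
  have hRp : R ^ (-α) ≤ 1 := Real.rpow_le_one_of_one_le_of_nonpos hR (by linarith)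
  have hRp0 : 0 < R ^ (-α) := Real.rpow_pos_of_pos hR0 _
  have hρp : 0 < ρ ^ (-α) := Real.rpow_pos_of_pos hρ _
  have h4 : ρ * (u - c) ^ 2 ≤ ρ * (u - v) ^ 2 := mul_le_mul_of_nonneg_left (by nlinarith) hρ.le
  have h5 : R * (c - v) ^ 2 ≤ K := by
    have : (v - c) ^ 2 = (c - v) ^ 2 := by ring
    rw [this] at h3; linarith
  have h6 : c - v ≤ √(K / R) := by
    apply Real.le_sqrt_of_sq_le
    rw [le_div_iff₀ hR0]; linarith
  have h7 : c - v < η := h6.trans_lt (hlt.trans_le (min_le_left _ _))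
  have h8 : (c - v) * (K + 1) < δ / 2 := by
    rw [← lt_div_iff₀ (by positivity)]
    exact h6.trans_lt (hlt.trans_le (min_le_right _ _))
  have h9 := hfη (x := c) (by rw [Real.dist_eq, abs_lt]; constructor <;> linarith)
  rw [Real.dist_eq] at h9
  have e : shadowDiss α (ρ, u) (R, v) c - limitDiss α ρ u v =
      (-(1 / 2 * (R * (c - v) ^ 2) * (c - v)) + α / (1 + α) * R ^ (-α) * (c - v)) - (f c - f v) := by
    rw [limitDiss_of_le hα₀ hα₁ hρ hv, shadowDiss, hf]; ring
  have hcv : 0 < c - v := by linarith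
  have ha : α / (1 + α) ≤ 1 := (div_le_one (by linarith)).2 (by linarith)
  have ha0 : 0 < α / (1 + α) := by positivity
  have i1 : α / (1 + α) * R ^ (-α) * (c - v) ≤ c - v := by
    have : α / (1 + α) * R ^ (-α) ≤ 1 := mul_le_one₀ ha hRp0.le hRp
    exact mul_le_of_le_one_left hcv.le this
  have i2 : 0 ≤ α / (1 + α) * R ^ (-α) * (c - v) := by positivity
  have i3 := mul_le_mul_of_nonneg_right h5 hcv.le
  have i4 : 0 ≤ R * (c - v) ^ 2 * (c - v) := by positivity
  have i5 : 0 < K * (c - v) := by positivity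
  rw [e, abs_lt]
  rw [abs_lt] at h9
  constructor <;> linarith [h9.1, h9.2]

lemma exists_shadowSpeed {ρ u v : ℝ} (hρ : 0 < ρ) (hv : v < u - volPow α ρ) :
    ∀ᶠ R in atTop, ∃ c, IsShadowSpeed α (ρ, u) (R, v) c := by
  have hz := volPow_pos hα₀ hρ
  have hsα : √α < 1 := by rw [Real.sqrt_lt' one_pos]; simpa using hα₁
  have hsα0 : 0 < √α := Real.sqrt_pos.2 hα₀
  have hg : 0 < u - √α * volPow α ρ - v := by nlinarith
  have hg2 : 0 < u - v - volPow α ρ := by linarith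
  filter_upwards [eventually_ge_atTop 1, eventually_ge_atTop (1 / (u - √α * volPow α ρ - v) ^ 2),
    (tendsto_volPow hα₀ hα₁).eventually_lt_const hg,
    (tendsto_volPow hα₀ hα₁).eventually_lt_const hg2] with R hR hRg hZg hZg2
  have hR0 : 0 < R := by linarith
  have hZ := volPow_pos hα₀ hR0
  have hZs : √α * volPow α R < volPow α R := by nlinarith
  have hRp : R ^ (-α) ≤ 1 := Real.rpow_le_one_of_one_le_of_nonpos hR (by linarith)
  rw [div_le_iff₀ (by positivity)] at hRg
  have hab : v + √α * volPow α R ≤ u - √α * volPow α ρ := by linarith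
  have q1 := mul_sq_volPow hα₀ hρ
  have q2 := mul_sq_volPow hα₀ hR0
  have qα : √α ^ 2 = α := Real.sq_sqrt hα₀.le
  have hc : ContinuousOn (fun c => (R * (v - c) ^ 2 - R ^ (-α)) - (ρ * (u - c) ^ 2 - ρ ^ (-α)))
      (Icc (v + √α * volPow α R) (u - √α * volPow α ρ)) := by fun_prop
  obtain ⟨c, hcm, hc0⟩ := intermediate_value_Icc hab hc (show (0 : ℝ) ∈ _ from by
    constructor
    · have e : R * (v - (v + √α * volPow α R)) ^ 2 = α * R ^ (-α) := by
        linear_combination R * volPow α R ^ 2 * qα + α * q2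
      have h1 : volPow α ρ ^ 2 ≤ (u - (v + √α * volPow α R)) ^ 2 := by
        apply pow_le_pow_left₀ hz.le; linarith
      have h2 := mul_le_mul_of_nonneg_left h1 hρ.le
      have h3 : 0 < R ^ (-α) := Real.rpow_pos_of_pos hR0 _
      rw [e]
      nlinarith
    · have e : ρ * (u - (u - √α * volPow α ρ)) ^ 2 = α * ρ ^ (-α) := by
        linear_combination ρ * volPow α ρ ^ 2 * qα + α * q1
      have h3 : 0 < ρ ^ (-α) := Real.rpow_pos_of_pos hρ _
      rw [e]
      have : R * (v - (u - √α * volPow α ρ)) ^ 2 = R * (u - √α * volPow α ρ - v) ^ 2 := by ring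
      rw [this]
      nlinarith)
  exact ⟨c, hcm.2, hcm.1, by simp only at hc0 ⊢; linarith⟩

/-- The least dissipation rate of the Riemann problem with a dense right state exists, and tends
to `limitDiss`. -/
theorem eventually_isOptDiss {ρ u : ℝ} (hρ : 0 < ρ) (v : ℝ) {δ : ℝ} (hδ : 0 < δ) :
    ∀ᶠ R in atTop, ∃ D, IsOptDiss α (ρ, u) (R, v) D ∧ |D - limitDiss α ρ u v| < δ ∧
      (u + kap α * volPow α ρ ≤ v → D = 0) := by
  have hz := volPow_pos hα₀ hρ
  rcases le_or_gt (u - volPow α ρ) v with hv | hv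
  · have hp : 0 < ρ ^ (-α) * volPow α ρ := mul_pos (Real.rpow_pos_of_pos hρ _) hz
    obtain ⟨η, hη, hcont⟩ := Metric.continuousAt_iff.1
      ((continuous_limDiss hα₀ hα₁).continuousAt (x := (v - u) / volPow α ρ))
      (δ / 2 / (ρ ^ (-α) * volPow α ρ)) (by positivity)
    have t1 : Tendsto (fun R => (1 + kap α) * volPow α R / volPow α ρ) atTop (𝓝 0) := by
      simpa using ((tendsto_volPow hα₀ hα₁).const_mul (1 + kap α)).div_const (volPow α ρ)
    have hns : ∀ᶠ R in atTop, u - volPow α ρ < v → ∀ c, ¬ IsShadowSpeed α (ρ, u) (R, v) c := by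
      by_cases h : u - volPow α ρ < v
      · filter_upwards [not_isShadowSpeed hα₀ hα₁ hρ h] with R hR _ using hR
      · exact Eventually.of_forall fun R h' => absurd h' h
    filter_upwards [eventually_ge_atTop ρ, hns, t1.eventually_lt_const hη,
      (tendsto_dense_coeff hα₀ hα₁).eventually_lt_const (half_pos hδ)] with R hR hns ht hd
    have hR0 : 0 < R := hρ.trans_le hR
    have hZ := volPow_pos hα₀ hR0
    obtain ⟨τ, hτ, hb⟩ := exists_velBalance_eq_zero hα₀ hα₁ (Ul := (ρ, u)) (Ur := (R, v)) hρ hR0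
      (by simp only; linarith)
    obtain ⟨Um, a₁, b₁, a₂, b₂, w₁, w₂, hm, hf⟩ :=
      exists_fan_of_velBalance hα₀ hα₁ (Ul := (ρ, u)) (Ur := (R, v)) hρ hR0 hτ hb
    have hfan : IsFan α (ρ, u) Um (R, v) a₁ b₁ a₂ b₂ w₁ w₂ := hf
    refine ⟨fanDiss α (ρ, u) Um (R, v), Or.inl ⟨Um, a₁, b₁, a₂, b₂, w₁, w₂, hf, rfl, ?_⟩, ?_,
      fan_fast hα₀ hα₁ hρ hR hf⟩
    · intro c hc
      rcases hv.lt_or_eq with h | h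
      · exact absurd hc (hns h c)
      · obtain ⟨g1, g2⟩ := isFan_two_shocks hα₀ hα₁ hρ hR hf h.ge
        exact fanDiss_lt_shadowDiss hα₀ hα₁ hρ hR0 hf g1 g2 hc
    · refine (abs_fanDiss_sub_le hα₀ hα₁ hρ hR0 hf.1).trans_lt ?_
      have hc := hcont (x := parVel α (ρ / Um.1)) (by
        rw [Real.dist_eq, hm, div_inv_eq_mul]
        exact (abs_parVel_sub_le hα₀ hα₁ hρ hR0 hτ hb).trans_lt ht)
      rw [Real.dist_eq, lt_div_iff₀ hp] at hc
      linarith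
  · have hg : 0 < u - volPow α ρ - v := by linarith
    filter_upwards [eventually_ge_atTop ρ, tendsto_shadowDiss hα₀ hα₁ hρ hv hδ,
      exists_shadowSpeed hα₀ hα₁ hρ hv, (tendsto_volPow hα₀ hα₁).eventually_lt_const hg]
      with R hR h1 h2 h3
    have hR0 : 0 < R := hρ.trans_le hR
    obtain ⟨c, hc⟩ := h2
    refine ⟨_, Or.inr ⟨?_, c, hc, rfl⟩, h1 c hc, fun h => ?_⟩
    · rintro ⟨Um, a₁, b₁, a₂, b₂, w₁, w₂, hf⟩
      have := hf.sub_lt hα₀ hα₁ hρ hR0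
      simp only at this
      linarith
    · have := mul_pos (kap_pos hα₀) hz
      linarith

/-! ### The limiting dissipation -/

lemma limitDiss_neg {ρ u v : ℝ} (hρ : 0 < ρ) (hv : v < A₂ α ρ u) : limitDiss α ρ u v < 0 := by
  have hz := volPow_pos hα₀ hρ
  have hp : 0 < ρ ^ (-α) * volPow α ρ := mul_pos (Real.rpow_pos_of_pos hρ _) hz
  have hv' : v < u + kap α * volPow α ρ := hv
  have := limDiss_neg hα₀ hα₁ (y := (v - u) / volPow α ρ) (by rw [div_lt_iff₀ hz]; linarith)
  exact mul_neg_of_pos_of_neg hp this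

lemma limitDiss_eq_zero {ρ u v : ℝ} (hρ : 0 < ρ) (hv : A₂ α ρ u ≤ v) : limitDiss α ρ u v = 0 := by
  have hz := volPow_pos hα₀ hρ
  have hv' : u + kap α * volPow α ρ ≤ v := hv
  rw [limitDiss, limDiss_of_le hα₀ hα₁ (by rw [le_div_iff₀ hz]; linarith), mul_zero]

lemma strictConcaveOn_limitDiss {ρ : ℝ} (hρ : 0 < ρ) (u : ℝ) :
    StrictConcaveOn ℝ (Iic (A₂ α ρ u)) (limitDiss α ρ u) := by
  have hz := volPow_pos hα₀ hρ
  have hp : 0 < ρ ^ (-α) * volPow α ρ := mul_pos (Real.rpow_pos_of_pos hρ _) hz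
  refine ⟨convex_Iic _, fun x hx y hy hxy a b ha hb hab => ?_⟩
  have mem : ∀ x, x ∈ Iic (A₂ α ρ u) → (x - u) / volPow α ρ ∈ Iic (kap α) := fun x hx => by
    have : x ≤ u + kap α * volPow α ρ := hx
    rw [mem_Iic, div_le_iff₀ hz]; linarith
  have := (strictConcaveOn_limDiss hα₀ hα₁).2 (mem x hx) (mem y hy) (by
    intro h
    rw [div_left_inj' hz.ne'] at h
    exact hxy (by linarith)) ha hb hab
  simp only [smul_eq_mul, limitDiss] at this ⊢
  have e : (a * x + b * y - u) / volPow α ρ =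
      a * ((x - u) / volPow α ρ) + b * ((y - u) / volPow α ρ) := by
    field_simp; linear_combination (-u) * hab * (-1)
  rw [e]
  have h2 := mul_lt_mul_of_pos_left this hp
  linarith

end

/-! ### Energies of nets -/

/-- `f` is integrable on the interval from `a` to `b`, with integral `I`. -/
def HasIntegralOn {E : Type*} [NormedAddCommGroup E] [NormedSpace ℝ E] (f : ℝ → E) (a b : ℝ)
    (I : E) : Prop :=
  IntervalIntegrable f volume a b ∧ ∫ x in a..b, f x = I

lemma HasIntegralOn.trans {E : Type*} [NormedAddCommGroup E] [NormedSpace ℝ E] {f : ℝ → E}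
    {a b c : ℝ} {I J : E} (h : HasIntegralOn f a b I)
    (h' : HasIntegralOn f b c J) : HasIntegralOn f a c (I + J) :=
  ⟨h.1.trans h'.1, by rw [← intervalIntegral.integral_add_adjacent_intervals h.1 h'.1, h.2, h'.2]⟩

lemma HasIntegralOn.congr {E : Type*} [NormedAddCommGroup E] [NormedSpace ℝ E] {f g : ℝ → E}
    {a b : ℝ} {I : E} (hab : a ≤ b) (h : HasIntegralOn g a b I)
    (hfg : ∀ x ∈ Ioo a b, f x = g x) : HasIntegralOn f a b I :=
  ⟨h.1.congr_uIoo (by rw [uIoo_of_le hab]; exact fun x hx => (hfg x hx).symm),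
    by rw [← h.2]; exact intervalIntegral.integral_congr_Ioo_of_le hab hfg⟩

lemma hasIntegralOn_const {f : ℝ → ℝ} {a b c : ℝ} (hab : a ≤ b) (h : ∀ x ∈ Ioo a b, f x = c) :
    HasIntegralOn f a b ((b - a) * c) :=
  HasIntegralOn.congr hab (g := fun _ => c) ⟨intervalIntegrable_const, by simp⟩ h

lemma HasIntegralOn.scale {f : ℝ → ℝ} {a b I x₀ t : ℝ} (h : HasIntegralOn f a b I) (ht : 0 < t) :
    HasIntegralOn (fun x => f ((x - x₀) / t)) (x₀ + t * a) (x₀ + t * b) (t * I) := by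
  constructor
  · have := (h.1.comp_mul_left (c := t⁻¹)).comp_sub_right x₀
    simp only [div_inv_eq_mul] at this
    convert this using 1
    · ext x; congr 1; field_simp
    · ring
    · ring
  · rw [intervalIntegral.integral_comp_sub_right (fun y => f (y / t)) x₀,
      intervalIntegral.integral_comp_div _ ht.ne', smul_eq_mul, ← h.2]
    congr 2 <;> field_simp <;> ring

lemma HasIntegralOn.eq {E : Type*} [NormedAddCommGroup E] [NormedSpace ℝ E] {f : ℝ → E}
    {a b : ℝ} {I J : E} (h : HasIntegralOn f a b I) (e : I = J) :
    HasIntegralOn f a b J := e ▸ h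

/-- The energy of the self-similar net `V` differs from the one expected from the fluxes by
the dissipation rates `d ε`. -/
def IsEnergyProfile (α : ℝ) (Ul Ur : State) (V : ℝ → ℝ → State) (d : ℝ → ℝ) : Prop :=
  ∃ M > 0, ∀ᶠ ε in 𝓝[>] (0 : ℝ), (∀ ζ, ζ < -M → V ε ζ = Ul) ∧ (∀ ζ, M < ζ → V ε ζ = Ur) ∧
    HasIntegralOn (fun ζ => energy α (V ε ζ)) (-M) M
      (M * (energy α Ul + energy α Ur) + (energyFlux α Ul - energyFlux α Ur) + d ε)

/-- `V` is the shadow wave with speed `c` and intermediate states `U₀`, `U₁`. -/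
def IsShadowNet (α : ℝ) (Ul Ur : State) (V : ℝ → ℝ → State) (c : ℝ) (U₀ U₁ : ℝ → State) : Prop :=
  (∀ ε > 0, 0 < (U₀ ε).1 ∧ 0 < (U₁ ε).1) ∧
    c ≤ lam₁ α Ul ∧ lam₂ α Ur ≤ c ∧
    Tendsto (fun ε : ℝ => -(c • (conserved Ur - conserved Ul)) + (flux α Ur - flux α Ul)
        + (ε / 2) • (conserved (U₀ ε) + conserved (U₁ ε))) (𝓝[>] 0) (𝓝 0) ∧
    Tendsto (fun ε : ℝ => (ε / 2) • (c • (conserved (U₀ ε) + conserved (U₁ ε))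
        - (flux α (U₀ ε) + flux α (U₁ ε)))) (𝓝[>] 0) (𝓝 0) ∧
    ∀ ε > 0, ∀ ζ, V ε ζ =
      if ζ ≤ c - ε / 2 then Ul
      else if ζ < c then U₀ ε
      else if ζ < c + ε / 2 then U₁ ε
      else Ur

/-- The total internal pressure of the intermediate states of a shadow wave. -/
def internalPressure (α : ℝ) (U₀ U₁ : ℝ → State) (ε : ℝ) : ℝ :=
  ε / 2 * ((U₀ ε).1 ^ (-α) + (U₁ ε).1 ^ (-α))

/-- `V` is a solution of a Riemann problem with dissipation rates `d`. -/
def IsRiemannDiss (α : ℝ) (Ul Ur : State) (V : ℝ → ℝ → State) (d : ℝ → ℝ) : Prop :=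
  IsEnergyProfile α Ul Ur V d ∧
  ((∃ (Um : State) (a₁ b₁ a₂ b₂ : ℝ) (w₁ w₂ : ℝ → State), IsFan α Ul Um Ur a₁ b₁ a₂ b₂ w₁ w₂ ∧
      (∀ ε > 0, ∀ ζ, V ε ζ = fanProfile Ul Um Ur a₁ b₁ a₂ b₂ w₁ w₂ ζ) ∧
      ∀ ε, d ε = fanDiss α Ul Um Ur) ∨
    ∃ c U₀ U₁, IsShadowNet α Ul Ur V c U₀ U₁ ∧
      Tendsto (fun ε => d ε - (1 / 2 + 1 / (1 + α)) * internalPressure α U₀ U₁ ε) (𝓝[>] 0)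
        (𝓝 (shadowDiss α Ul Ur c)))

lemma fanProfile_of_lt {Ul Um Ur : State} {a₁ b₁ a₂ b₂ ζ : ℝ} {w₁ w₂ : ℝ → State} (h : ζ ≤ a₁) :
    fanProfile Ul Um Ur a₁ b₁ a₂ b₂ w₁ w₂ ζ = Ul := by simp [fanProfile, h]

lemma fanProfile_wave₁ {Ul Um Ur : State} {a₁ b₁ a₂ b₂ ζ : ℝ} {w₁ w₂ : ℝ → State}
    (h : ζ ∈ Ioo a₁ b₁) : fanProfile Ul Um Ur a₁ b₁ a₂ b₂ w₁ w₂ ζ = w₁ ζ := by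
  simp [fanProfile, not_le.2 h.1, h.2]

lemma fanProfile_middle {Ul Um Ur : State} {a₁ b₁ a₂ b₂ ζ : ℝ} {w₁ w₂ : ℝ → State} (h0 : a₁ ≤ b₁)
    (h : ζ ∈ Ioo b₁ a₂) : fanProfile Ul Um Ur a₁ b₁ a₂ b₂ w₁ w₂ ζ = Um := by
  simp [fanProfile, not_le.2 (h0.trans_lt h.1), not_lt.2 h.1.le, h.2.le]

lemma fanProfile_wave₂ {Ul Um Ur : State} {a₁ b₁ a₂ b₂ ζ : ℝ} {w₁ w₂ : ℝ → State} (h0 : a₁ ≤ b₁)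
    (h1 : b₁ ≤ a₂) (h : ζ ∈ Ioo a₂ b₂) :
    fanProfile Ul Um Ur a₁ b₁ a₂ b₂ w₁ w₂ ζ = w₂ ζ := by
  have := h1.trans_lt h.1
  simp [fanProfile, not_le.2 (h0.trans_lt this), not_lt.2 this.le, not_le.2 h.1, h.2]

lemma fanProfile_of_gt {Ul Um Ur : State} {a₁ b₁ a₂ b₂ ζ : ℝ} {w₁ w₂ : ℝ → State} (h0 : a₁ ≤ b₁)
    (h1 : b₁ ≤ a₂) (h2 : a₂ ≤ b₂) (h : b₂ < ζ) :
    fanProfile Ul Um Ur a₁ b₁ a₂ b₂ w₁ w₂ ζ = Ur := by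
  have h3 := h2.trans_lt h
  have h4 := h1.trans_lt h3
  simp [fanProfile, not_le.2 (h0.trans_lt h4), not_lt.2 h4.le, not_le.2 h3, not_lt.2 h.le]

section

variable {α : ℝ} (hα₀ : 0 < α) (hα₁ : α < 1)
include hα₀

/-- The limits of the total density, momentum and momentum flux of a shadow wave. -/
lemma IsShadowNet.limits {Ul Ur : State} {V : ℝ → ℝ → State} {c : ℝ} {U₀ U₁ : ℝ → State}
    (h : IsShadowNet α Ul Ur V c U₀ U₁) :
    IsShadowSpeed α Ul Ur c ∧
    Tendsto (fun ε => ε / 2 * ((U₀ ε).1 + (U₁ ε).1)) (𝓝[>] 0) (𝓝 (shadowMass Ul Ur c)) ∧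
    Tendsto (fun ε => ε / 2 * ((U₀ ε).1 * (U₀ ε).2 + (U₁ ε).1 * (U₁ ε).2)) (𝓝[>] 0)
      (𝓝 (c * shadowMass Ul Ur c)) ∧
    Tendsto (fun ε => ε / 2 * ((U₀ ε).1 * (U₀ ε).2 ^ 2 + (U₁ ε).1 * (U₁ ε).2 ^ 2)
      - internalPressure α U₀ U₁ ε) (𝓝[>] 0) (𝓝 (c ^ 2 * shadowMass Ul Ur c)) := by
  obtain ⟨-, hc1, hc2, T1, T2, -⟩ := h
  have T1a := (continuous_fst.tendsto (0 : ℝ × ℝ)).comp T1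
  have T1b := (continuous_snd.tendsto (0 : ℝ × ℝ)).comp T1
  have T2a := (continuous_fst.tendsto (0 : ℝ × ℝ)).comp T2
  have T2b := (continuous_snd.tendsto (0 : ℝ × ℝ)).comp T2
  simp only [Function.comp_def, conserved, flux, Prod.fst_add, Prod.snd_add, Prod.fst_sub,
    Prod.snd_sub, Prod.smul_fst, Prod.smul_snd, Prod.fst_neg, Prod.snd_neg, smul_eq_mul,
    Prod.fst_zero, Prod.snd_zero] at T1a T1b T2a T2b
  have m1 : Tendsto (fun ε => ε / 2 * ((U₀ ε).1 + (U₁ ε).1)) (𝓝[>] 0)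
      (𝓝 (shadowMass Ul Ur c)) := by
    have := T1a.add_const (shadowMass Ul Ur c)
    rw [zero_add] at this
    refine this.congr fun ε => ?_
    unfold shadowMass; ring
  have m2 : Tendsto (fun ε => ε / 2 * ((U₀ ε).1 * (U₀ ε).2 + (U₁ ε).1 * (U₁ ε).2)) (𝓝[>] 0)
      (𝓝 (c * shadowMass Ul Ur c)) := by
    have := (m1.const_mul c).sub T2a
    rw [sub_zero] at this
    refine this.congr fun ε => ?_
    ring
  have m3 := T1b.sub m2
  have key : (0 : ℝ) - c * shadowMass Ul Ur c =
      -(c * (Ur.1 * Ur.2 - Ul.1 * Ul.2)) +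
        (Ur.1 * Ur.2 ^ 2 - Ur.1 ^ (-α) - (Ul.1 * Ul.2 ^ 2 - Ul.1 ^ (-α))) := by
    refine tendsto_nhds_unique m3 (tendsto_const_nhds.congr fun ε => ?_)
    ring
  refine ⟨⟨hc1, hc2, ?_⟩, m1, m2, ?_⟩
  · unfold shadowMass at key; linear_combination key
  · have := (m2.const_mul c).sub T2b
    rw [sub_zero] at this
    have e : c * (c * shadowMass Ul Ur c) = c ^ 2 * shadowMass Ul Ur c := by ring
    rw [e] at this
    refine this.congr fun ε => ?_
    unfold internalPressure; ring

include hα₁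

lemma IsFan.isEnergyProfile {Ul Um Ur : State} {a₁ b₁ a₂ b₂ : ℝ} {w₁ w₂ : ℝ → State}
    (hl : 0 < Ul.1) (hr : 0 < Ur.1) (h : IsFan α Ul Um Ur a₁ b₁ a₂ b₂ w₁ w₂)
    {V : ℝ → ℝ → State} (hV : ∀ ε > 0, ∀ ζ, V ε ζ = fanProfile Ul Um Ur a₁ b₁ a₂ b₂ w₁ w₂ ζ) :
    IsEnergyProfile α Ul Ur V (fun _ => fanDiss α Ul Um Ur) := by
  obtain ⟨l1, l2, l3⟩ := h.le hα₀ hα₁ hl hr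
  have hM1 := neg_abs_le a₁
  have hM2 := le_abs_self b₂
  refine ⟨|a₁| + |b₂| + 1, by positivity, ?_⟩
  have p1 := abs_nonneg a₁
  have p2 := abs_nonneg b₂
  set M := |a₁| + |b₂| + 1 with hM
  filter_upwards [self_mem_nhdsWithin] with ε hε
  have hVε := hV ε hε
  refine ⟨fun ζ hζ => ?_, fun ζ hζ => ?_, ?_⟩
  · rw [hVε, fanProfile_of_lt (by linarith)]
  · rw [hVε, fanProfile_of_gt l1 l2 l3 (by linarith)]
  have i1 : HasIntegralOn (fun ζ => energy α (V ε ζ)) (-M) a₁ ((a₁ - -M) * energy α Ul) :=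
    hasIntegralOn_const (by linarith) fun x hx => by rw [hVε, fanProfile_of_lt hx.2.le]
  have i2 := HasIntegralOn.congr (f := fun ζ => energy α (V ε ζ)) l1
    (h.2.1.integral_energy hα₀ hα₁ hl h.1) fun x hx => by rw [hVε, fanProfile_wave₁ hx]
  have i3 : HasIntegralOn (fun ζ => energy α (V ε ζ)) b₁ a₂ ((a₂ - b₁) * energy α Um) :=
    hasIntegralOn_const l2 fun x hx => by rw [hVε, fanProfile_middle l1 hx]
  have i4 := HasIntegralOn.congr (f := fun ζ => energy α (V ε ζ)) l3
    (h.2.2.1.integral_energy hα₀ hα₁ h.1 hr) fun x hx => by rw [hVε, fanProfile_wave₂ l1 l2 hx]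
  have i5 : HasIntegralOn (fun ζ => energy α (V ε ζ)) b₂ M ((M - b₂) * energy α Ur) :=
    hasIntegralOn_const (by linarith) fun x hx => by
      rw [hVε, fanProfile_of_gt l1 l2 l3 hx.1]
  refine ((((i1.trans i2).trans i3).trans i4).trans i5).eq ?_
  simp only [fanDiss]; ring

lemma IsShadowNet.isEnergyProfile {Ul Ur : State} {V : ℝ → ℝ → State} {c : ℝ} {U₀ U₁ : ℝ → State}
    (h : IsShadowNet α Ul Ur V c U₀ U₁) : ∃ d, IsEnergyProfile α Ul Ur V d ∧
      Tendsto (fun ε => d ε - (1 / 2 + 1 / (1 + α)) * internalPressure α U₀ U₁ ε) (𝓝[>] 0)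
        (𝓝 (shadowDiss α Ul Ur c)) := by
  obtain ⟨hc, -, -, m3⟩ := h.limits hα₀
  obtain ⟨-, -, -, -, -, hV⟩ := h
  refine ⟨fun ε => c * (energy α Ul - energy α Ur) - ε / 2 * (energy α Ul + energy α Ur)
    + ε / 2 * (energy α (U₀ ε) + energy α (U₁ ε)) - (energyFlux α Ul - energyFlux α Ur), ?_, ?_⟩
  · refine ⟨|c| + 1, by positivity, ?_⟩
    have hM1 := neg_abs_le c
    have hM2 := le_abs_self c
    set M := |c| + 1 with hM
    filter_upwards [Ioo_mem_nhdsGT (zero_lt_one' ℝ)] with ε hε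
    have hVε := hV ε hε.1
    have e0 := hε.1
    have e1 := hε.2
    refine ⟨fun ζ hζ => ?_, fun ζ hζ => ?_, ?_⟩
    · rw [hVε, if_pos (by linarith)]
    · rw [hVε, if_neg (by linarith), if_neg (by linarith), if_neg (by linarith)]
    have i1 : HasIntegralOn (fun ζ => energy α (V ε ζ)) (-M) (c - ε / 2) _ :=
      hasIntegralOn_const (c := energy α Ul) (by linarith) fun x hx => by
        rw [hVε, if_pos hx.2.le]
    have i2 : HasIntegralOn (fun ζ => energy α (V ε ζ)) (c - ε / 2) c _ :=
      hasIntegralOn_const (c := energy α (U₀ ε)) (by linarith) fun x hx => by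
        rw [hVε, if_neg (not_le.2 hx.1), if_pos hx.2]
    have i3 : HasIntegralOn (fun ζ => energy α (V ε ζ)) c (c + ε / 2) _ :=
      hasIntegralOn_const (c := energy α (U₁ ε)) (by linarith) fun x hx => by
        rw [hVε, if_neg (by linarith [hx.1]), if_neg (not_lt.2 hx.1.le), if_pos hx.2]
    have i4 : HasIntegralOn (fun ζ => energy α (V ε ζ)) (c + ε / 2) M _ :=
      hasIntegralOn_const (c := energy α Ur) (by linarith) fun x hx => by
        rw [hVε, if_neg (by linarith [hx.1]), if_neg (by linarith [hx.1]), if_neg (not_lt.2 hx.1.le)]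
    refine (((i1.trans i2).trans i3).trans i4).eq ?_
    ring
  · have t0 : Tendsto (fun ε : ℝ => ε / 2 * (energy α Ul + energy α Ur)) (𝓝[>] 0) (𝓝 0) := by
      have : Continuous fun ε : ℝ => ε / 2 * (energy α Ul + energy α Ur) := by fun_prop
      simpa using (this.tendsto 0).mono_left nhdsWithin_le_nhds
    have := ((m3.const_mul (1 / 2)).sub t0).add_const
      (c * (energy α Ul - energy α Ur) - (energyFlux α Ul - energyFlux α Ur))
    refine (this.congr fun ε => ?_).trans_eq ?_
    · simp only [internalPressure]
      rw [energy.eq_def α (U₀ ε), energy.eq_def α (U₁ ε)]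
      ring
    · rw [shadowDiss_eq hα₀ hc]; congr 1; ring

lemma IsRiemannSolution.exists_diss {Ul Ur : State} {V : ℝ → ℝ → State} (hl : 0 < Ul.1)
    (hr : 0 < Ur.1) (h : IsRiemannSolution α Ul Ur V) : ∃ d, IsRiemannDiss α Ul Ur V d := by
  rcases h with ⟨Um, a₁, b₁, a₂, b₂, w₁, w₂, hm, h1, h2, h3, hV⟩ | ⟨c, U₀, U₁, h⟩
  · have hf : IsFan α Ul Um Ur a₁ b₁ a₂ b₂ w₁ w₂ := ⟨hm, h1, h2, h3⟩
    exact ⟨_, hf.isEnergyProfile hα₀ hα₁ hl hr hV, Or.inl ⟨_, _, _, _, _, _, _, hf, hV,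
      fun _ => rfl⟩⟩
  · have hs : IsShadowNet α Ul Ur V c U₀ U₁ := h
    obtain ⟨d, hd, ht⟩ := hs.isEnergyProfile hα₀ hα₁
    exact ⟨d, hd, Or.inr ⟨c, U₀, U₁, hs, ht⟩⟩

omit hα₁ in
lemma internalPressure_nonneg {Ul Ur : State} {V : ℝ → ℝ → State} {c : ℝ} {U₀ U₁ : ℝ → State}
    (h : IsShadowNet α Ul Ur V c U₀ U₁) {ε : ℝ} (hε : 0 < ε) :
    0 ≤ internalPressure α U₀ U₁ ε := by
  obtain ⟨p0, p1⟩ := h.1 ε hε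
  unfold internalPressure; positivity

/-- No solution of a Riemann problem dissipates energy at a rate below the optimal one. -/
lemma IsRiemannDiss.eventually_ge {Ul Ur : State} {V : ℝ → ℝ → State} {d : ℝ → ℝ} {D : ℝ}
    (hl : 0 < Ul.1) (hr : 0 < Ur.1) (h : IsRiemannDiss α Ul Ur V d) (hD : IsOptDiss α Ul Ur D)
    {δ : ℝ} (hδ : 0 < δ) : ∀ᶠ ε in 𝓝[>] (0 : ℝ), D - δ < d ε := by
  have shadow : ∀ c U₀ U₁, IsShadowNet α Ul Ur V c U₀ U₁ →
      Tendsto (fun ε => d ε - (1 / 2 + 1 / (1 + α)) * internalPressure α U₀ U₁ ε) (𝓝[>] 0)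
        (𝓝 (shadowDiss α Ul Ur c)) → D ≤ shadowDiss α Ul Ur c →
      ∀ᶠ ε in 𝓝[>] (0 : ℝ), D - δ < d ε := by
    intro c U₀ U₁ hs ht hle
    filter_upwards [ht.eventually_const_lt (by linarith : D - δ < shadowDiss α Ul Ur c),
      self_mem_nhdsWithin] with ε h1 h2
    have := internalPressure_nonneg hα₀ hs h2
    have : 0 ≤ (1 / 2 + 1 / (1 + α)) * internalPressure α U₀ U₁ ε := by positivity
    linarith
  obtain ⟨-, h⟩ := h
  rcases hD with ⟨Um, a₁, b₁, a₂, b₂, w₁, w₂, hf, rfl, hsh⟩ | ⟨hn, c', hc', rfl⟩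
  · rcases h with ⟨Um', _, _, _, _, _, _, hf', hV, hd⟩ | ⟨c, U₀, U₁, hs, ht⟩
    · rw [(hf.unique hα₀ hα₁ hl hr hf').1]
      exact Eventually.of_forall fun ε => by rw [hd]; linarith
    · exact shadow c U₀ U₁ hs ht (hsh c (hs.limits hα₀).1).le
  · rcases h with ⟨Um', _, _, _, _, _, _, hf', hV, hd⟩ | ⟨c, U₀, U₁, hs, ht⟩
    · exact absurd ⟨_, _, _, _, _, _, _, hf'⟩ hn
    · exact shadow c U₀ U₁ hs ht (by rw [hc'.unique hα₀ hl hr (hs.limits hα₀).1])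

end

/-! ### Weak formulation for self-similar profiles -/

/-- The self-similar profiles `W`, `F` of the conserved quantities and the flux connect constant
states and satisfy the weak form of `F' = ζ W'` up to the error `e`. -/
structure IsWeakProfile (W F : ℝ → ℝ × ℝ) (Wl Wr Fl Fr : ℝ × ℝ) (M e : ℝ) : Prop where
  left : ∀ ζ < -M, W ζ = Wl ∧ F ζ = Fl
  right : ∀ ζ > M, W ζ = Wr ∧ F ζ = Fr
  measurable : Measurable W ∧ Measurable F
  bounded : ∃ C, ∀ ζ, ‖W ζ‖ ≤ C ∧ ‖F ζ‖ ≤ C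
  weak : ∀ (Φ Φ' : ℝ → ℝ) (B : ℝ), (∀ ζ, HasDerivAt Φ (Φ' ζ) ζ) → Continuous Φ' →
    (∀ ζ, |Φ' ζ| ≤ B) →
    ‖(∫ ζ in (-M)..M, (Φ ζ • W ζ + Φ' ζ • (ζ • W ζ - F ζ)))
      - (Φ M • (M • Wr - Fr) + Φ (-M) • (M • Wl + Fl))‖ ≤ e * B

/-- A jump at `0`. -/
def stepFun (a b : ℝ × ℝ) (x : ℝ) : ℝ × ℝ := if x < 0 then a else b

lemma measurable_stepFun (a b : ℝ × ℝ) : Measurable (stepFun a b) :=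
  Measurable.ite measurableSet_Iio measurable_const measurable_const

lemma norm_stepFun_le (a b : ℝ × ℝ) (x : ℝ) : ‖stepFun a b x‖ ≤ ‖a‖ + ‖b‖ := by
  unfold stepFun
  have := norm_nonneg a
  have := norm_nonneg b
  split_ifs <;> linarith

lemma stepFun_div (a b : ℝ × ℝ) (x : ℝ) {t : ℝ} (ht : 0 < t) :
    stepFun a b (x / t) = stepFun a b x := by
  have : x / t < 0 ↔ x < 0 := by rw [div_lt_iff₀ ht, zero_mul]
  simp only [stepFun, this]

lemma integrable_smul_of_hasCompactSupport {a : ℝ × ℝ → ℝ} {H : ℝ × ℝ → ℝ × ℝ} {C : ℝ}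
    (ha : Continuous a) (hc : HasCompactSupport a) (hH : Measurable H) (hb : ∀ p, ‖H p‖ ≤ C) :
    Integrable (fun p => a p • H p) volume :=
  (ha.integrable_of_hasCompactSupport hc).smul_bdd C hH.aestronglyMeasurable (ae_of_all _ hb)

lemma integrable_slice {a : ℝ × ℝ → ℝ} {H : ℝ → ℝ × ℝ} {C : ℝ}
    (ha : Continuous a) (hc : HasCompactSupport a) (hH : Measurable H) (hb : ∀ p, ‖H p‖ ≤ C)
    (t : ℝ) : Integrable fun x => a (x, t) • H x := by
  have h1 : Continuous fun x => a (x, t) := by fun_prop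
  have h2 : HasCompactSupport fun x => a (x, t) :=
    HasCompactSupport.intro (hc.isCompact.image continuous_fst) fun x hx =>
      image_eq_zero_of_notMem_tsupport fun h => hx ⟨(x, t), h, rfl⟩
  exact (h1.integrable_of_hasCompactSupport h2).smul_bdd C hH.aestronglyMeasurable (ae_of_all _ hb)

lemma intervalIntegrable_smul_bdd {a : ℝ → ℝ} {H : ℝ → ℝ × ℝ} {C : ℝ} (ha : Continuous a)
    (hH : Measurable H) (hb : ∀ p, ‖H p‖ ≤ C) (x y : ℝ) :
    IntervalIntegrable (fun ζ => a ζ • H ζ) volume x y := by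
  rw [intervalIntegrable_iff]
  exact (intervalIntegrable_iff.1 (ha.intervalIntegrable x y)).smul_bdd C
    hH.aestronglyMeasurable (ae_of_all _ hb)

/-- The integrand in the weak form of `F' = ζ W'` for a constant state. -/
lemma hasIntegralOn_weak_const {Φ Φ' : ℝ → ℝ} (h : ∀ ζ, HasDerivAt Φ (Φ' ζ) ζ)
    (hc : Continuous Φ') (X Y : ℝ × ℝ) (a b : ℝ) :
    HasIntegralOn (fun ζ => Φ ζ • X + Φ' ζ • (ζ • X - Y)) a b
      (Φ b • (b • X - Y) - Φ a • (a • X - Y)) := by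
  have hΦ : Continuous Φ := continuous_iff_continuousAt.2 fun ζ => (h ζ).continuousAt
  have hi : IntervalIntegrable (fun ζ => Φ ζ • X + Φ' ζ • (ζ • X - Y)) volume a b :=
    Continuous.intervalIntegrable (by fun_prop) _ _
  refine ⟨hi, intervalIntegral.integral_eq_sub_of_hasDerivAt
    (f := fun ζ => Φ ζ • (ζ • X - Y)) (fun ζ _ => ?_) hi⟩
  have := (h ζ).fun_smul (((hasDerivAt_id ζ).smul_const X).sub_const Y)
  simpa [add_comm] using this

/-- The weak form of `F' = ζ W'` for a jump at `0`. -/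
lemma integral_weak_stepFun {Φ Φ' : ℝ → ℝ} (h : ∀ ζ, HasDerivAt Φ (Φ' ζ) ζ) (hc : Continuous Φ')
    (Wl Wr Fl Fr : ℝ × ℝ) {M : ℝ} (hM : 0 ≤ M) :
    ∫ ζ in (-M)..M, (Φ ζ • stepFun Wl Wr ζ + Φ' ζ • (ζ • stepFun Wl Wr ζ - stepFun Fl Fr ζ)) =
      Φ M • (M • Wr - Fr) + Φ (-M) • (M • Wl + Fl) - Φ 0 • (Fl - Fr) := by
  have c1 := (hasIntegralOn_weak_const h hc Wl Fl (-M) 0).congr (f := fun ζ => Φ ζ •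
    stepFun Wl Wr ζ + Φ' ζ • (ζ • stepFun Wl Wr ζ - stepFun Fl Fr ζ)) (by linarith) fun x hx => by
    simp only [stepFun, if_pos hx.2]
  have c2 := (hasIntegralOn_weak_const h hc Wr Fr 0 M).congr (f := fun ζ => Φ ζ •
    stepFun Wl Wr ζ + Φ' ζ • (ζ • stepFun Wl Wr ζ - stepFun Fl Fr ζ)) hM fun x hx => by
    simp only [stepFun, if_neg (not_lt.2 hx.1.le)]
  rw [(c1.trans c2).2]
  module

/-- Passing from Cartesian coordinates to self-similar ones in one variable. -/
lemma integral_eq_smul_selfSimilar {G : ℝ → ℝ × ℝ} {x₀ t M : ℝ} (ht : 0 < t) (hM : 0 ≤ M)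
    (hG : ∀ ζ, ζ ∉ Icc (-M) M → G (x₀ + t * ζ) = 0) :
    ∫ x, G x = t • ∫ ζ in (-M)..M, G (x₀ + t * ζ) := by
  rw [intervalIntegral.integral_of_le (by linarith), ← integral_Icc_eq_integral_Ioc,
    setIntegral_eq_integral_of_forall_compl_eq_zero hG,
    Measure.integral_comp_mul_left (fun y => G (x₀ + y)) t, integral_add_left_eq_self,
    smul_smul, abs_of_pos (inv_pos.2 ht), mul_inv_cancel₀ ht.ne', one_smul]

lemma integral_slice_split {a : ℝ × ℝ → ℝ} (ha : Continuous a) (hc : HasCompactSupport a)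
    {H : ℝ → ℝ × ℝ} {Hl Hr : ℝ × ℝ} {M C x₀ t : ℝ} (hM : 0 ≤ M) (ht : 0 < t) (hH : Measurable H)
    (hb : ∀ ζ, ‖H ζ‖ ≤ C) (hl : ∀ ζ < -M, H ζ = Hl) (hr : ∀ ζ > M, H ζ = Hr) :
    ∫ x, a (x, t) • H ((x - x₀) / t) = (∫ x, a (x, t) • stepFun Hl Hr (x - x₀))
      + t • ∫ ζ in (-M)..M, a (x₀ + t * ζ, t) • (H ζ - stepFun Hl Hr ζ) := by
  have i1 : Integrable fun x => a (x, t) • H ((x - x₀) / t) :=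
    integrable_slice ha hc (H := fun x => H ((x - x₀) / t)) (hH.comp (by fun_prop))
      (fun x => hb _) t
  have i2 : Integrable fun x => a (x, t) • stepFun Hl Hr (x - x₀) :=
    integrable_slice ha hc (H := fun x => stepFun Hl Hr (x - x₀))
      ((measurable_stepFun Hl Hr).comp (by fun_prop)) (fun x => norm_stepFun_le _ _ _) t
  have e : ∀ ζ, (x₀ + t * ζ - x₀) / t = ζ := fun ζ => by field_simp; ring
  have key := integral_eq_smul_selfSimilar
    (G := fun x => a (x, t) • H ((x - x₀) / t) - a (x, t) • stepFun Hl Hr (x - x₀)) (x₀ := x₀)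
    ht hM fun ζ hζ => by
      rw [← stepFun_div Hl Hr _ ht, e, ← smul_sub]
      rcases lt_or_ge ζ (-M) with h | h
      · rw [hl ζ h, stepFun, if_pos (by linarith), sub_self, smul_zero]
      · have h' : M < ζ := by by_contra hcon; exact hζ ⟨h, not_lt.1 hcon⟩
        rw [hr ζ h', stepFun, if_neg (by linarith), sub_self, smul_zero]
  rw [integral_sub i1 i2, sub_eq_iff_eq_add'] at key
  rw [key]
  simp only [← stepFun_div Hl Hr (x₀ + t * _ - x₀) ht, e, ← smul_sub]

section

variable {φ : ℝ × ℝ → ℝ} (hφ : ContDiff ℝ ∞ φ)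
include hφ

lemma continuous_fderiv_apply (v : ℝ × ℝ) : Continuous fun p => fderiv ℝ φ p v :=
  (hφ.continuous_fderiv (by simp)).clm_apply continuous_const

lemma hasDerivAt_comp_curve {x y : ℝ → ℝ} {a b s : ℝ} (hx : HasDerivAt x a s)
    (hy : HasDerivAt y b s) : HasDerivAt (fun s => φ (x s, y s))
    (a * fderiv ℝ φ (x s, y s) (1, 0) + b * fderiv ℝ φ (x s, y s) (0, 1)) s := by
  have h := HasFDerivAt.comp_hasDerivAt s
    (hφ.differentiable (by simp) (x s, y s)).hasFDerivAt (hx.prodMk hy)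
  have e : ((a, b) : ℝ × ℝ) = a • (1, 0) + b • (0, 1) := by ext <;> simp
  rw [e, map_add, map_smul, map_smul, smul_eq_mul, smul_eq_mul] at h
  exact h

lemma hasDerivAt_comp_ray (x₀ ζ t : ℝ) : HasDerivAt (fun t => φ (x₀ + t * ζ, t))
    (ζ * fderiv ℝ φ (x₀ + t * ζ, t) (1, 0) + fderiv ℝ φ (x₀ + t * ζ, t) (0, 1)) t := by
  simpa using hasDerivAt_comp_curve hφ
    (((hasDerivAt_id t).mul_const ζ).const_add x₀) (hasDerivAt_id t)

lemma hasDerivAt_comp_selfSimilar (x₀ ζ t : ℝ) : HasDerivAt (fun ζ => φ (x₀ + t * ζ, t))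
    (t * fderiv ℝ φ (x₀ + t * ζ, t) (1, 0)) ζ := by
  simpa using hasDerivAt_comp_curve hφ
    (((hasDerivAt_id ζ).const_mul t).const_add x₀) (hasDerivAt_const ζ t)

lemma hasDerivAt_comp_left (x t : ℝ) : HasDerivAt (fun x => φ (x, t))
    (fderiv ℝ φ (x, t) (1, 0)) x := by
  simpa using hasDerivAt_comp_curve hφ (hasDerivAt_id x) (hasDerivAt_const x t)

lemma hasDerivAt_comp_right (x t : ℝ) : HasDerivAt (fun t => φ (x, t))
    (fderiv ℝ φ (x, t) (0, 1)) t := by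
  simpa using hasDerivAt_comp_curve hφ (hasDerivAt_const t x) (hasDerivAt_id t)

variable (hc : HasCompactSupport φ)
include hc

lemma hasCompactSupport_fderiv_apply (v : ℝ × ℝ) : HasCompactSupport fun p => fderiv ℝ φ p v :=
  (hc.fderiv ℝ).comp_left (g := fun A : ℝ × ℝ →L[ℝ] ℝ => A v) rfl

lemma exists_time_bound : ∃ T > 0, ∀ p : ℝ × ℝ, T ≤ p.2 →
    φ p = 0 ∧ ∀ v, fderiv ℝ φ p v = 0 := by
  obtain ⟨R, hR⟩ := hc.isCompact.isBounded.exists_norm_le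
  refine ⟨|R| + 1, by positivity, fun p hp => ?_⟩
  have hn : p ∉ tsupport φ := fun h => by
    have := hR p h
    have := (norm_snd_le p).trans this
    have := (le_abs_self p.2).trans this
    linarith [le_abs_self R]
  exact ⟨image_eq_zero_of_notMem_tsupport hn, fun v => by
    rw [fderiv_of_notMem_tsupport (𝕜 := ℝ) hn]; rfl⟩

lemma hasCompactSupport_comp_left (t : ℝ) : HasCompactSupport fun x => φ (x, t) :=
  HasCompactSupport.intro (hc.isCompact.image continuous_fst) fun x hx =>
    image_eq_zero_of_notMem_tsupport fun h => hx ⟨(x, t), h, rfl⟩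

lemma integral_left_Iic (x₀ t : ℝ) : ∫ x in Iic x₀, fderiv ℝ φ (x, t) (1, 0) = φ (x₀, t) := by
  have h1 : ContDiff ℝ 1 fun x => φ (x, t) :=
    (hφ.of_le (by simp)).comp (contDiff_prodMk_left t)
  have := (hasCompactSupport_comp_left hφ hc t).integral_Iic_deriv_eq h1 x₀
  simpa [(hasDerivAt_comp_left hφ _ t).deriv] using this

lemma integral_left_Ioi (x₀ t : ℝ) : ∫ x in Ioi x₀, fderiv ℝ φ (x, t) (1, 0) = -φ (x₀, t) := by
  have h1 : ContDiff ℝ 1 fun x => φ (x, t) :=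
    (hφ.of_le (by simp)).comp (contDiff_prodMk_left t)
  have := (hasCompactSupport_comp_left hφ hc t).integral_Ioi_deriv_eq h1 x₀
  simpa [(hasDerivAt_comp_left hφ _ t).deriv] using this

lemma integral_left_smul_stepFun (a b : ℝ × ℝ) (x₀ t : ℝ) :
    ∫ x, fderiv ℝ φ (x, t) (1, 0) • stepFun a b (x - x₀) = φ (x₀, t) • (a - b) := by
  have hi : Integrable fun x => fderiv ℝ φ (x, t) (1, 0) • stepFun a b (x - x₀) := by
    exact integrable_slice (continuous_fderiv_apply hφ _) (hasCompactSupport_fderiv_apply hφ hc _)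
      ((measurable_stepFun a b).comp (by fun_prop)) (fun x => norm_stepFun_le _ _ _) t
  rw [← integral_add_compl (measurableSet_Iic (a := x₀)) hi, compl_Iic,
    integral_Iic_eq_integral_Iio,
    setIntegral_congr_fun measurableSet_Iio (g := fun x => fderiv ℝ φ (x, t) (1, 0) • a)
      fun x hx => by simp only [stepFun, if_pos (sub_neg.2 (mem_Iio.1 hx))],
    setIntegral_congr_fun measurableSet_Ioi (g := fun x => fderiv ℝ φ (x, t) (1, 0) • b)
      fun x hx => by simp only [stepFun, if_neg (not_lt.2 (sub_nonneg.2 (mem_Ioi.1 hx).le))],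
    integral_smul_const, integral_smul_const, ← integral_Iic_eq_integral_Iio,
    integral_left_Iic hφ hc, integral_left_Ioi hφ hc, neg_smul, smul_sub, sub_eq_add_neg]

/-- A self-similar function whose profile satisfies the weak form of `F' = ζ W'` up to an error
solves the conservation laws with Riemann data up to a comparable error. -/
theorem exists_norm_weak_le : ∃ K, ∀ (W F : ℝ → ℝ × ℝ) (Wl Wr Fl Fr : ℝ × ℝ) (M e x₀ : ℝ),
    0 ≤ M → 0 ≤ e → IsWeakProfile W F Wl Wr Fl Fr M e →
    ‖(∫ p in {p : ℝ × ℝ | 0 < p.2}, (fderiv ℝ φ p (0, 1) • W ((p.1 - x₀) / p.2)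
        + fderiv ℝ φ p (1, 0) • F ((p.1 - x₀) / p.2)))
      + ∫ x, φ (x, 0) • stepFun Wl Wr (x - x₀)‖ ≤ K * e := by
  obtain ⟨T, hT, h0⟩ := exists_time_bound hφ hc
  have cx := continuous_fderiv_apply hφ (1, 0)
  have ct := continuous_fderiv_apply hφ (0, 1)
  have sx := hasCompactSupport_fderiv_apply hφ hc (1, 0)
  have st := hasCompactSupport_fderiv_apply hφ hc (0, 1)
  obtain ⟨B, hB⟩ := sx.exists_bound_of_continuous cx
  refine ⟨B * T * T, fun W F Wl Wr Fl Fr M e x₀ hM he hW => ?_⟩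
  obtain ⟨C, hC⟩ := hW.bounded
  obtain ⟨mW, mF⟩ := hW.measurable
  set S := stepFun Wl Wr with hS
  set G : ℝ × ℝ → ℝ × ℝ := fun p => fderiv ℝ φ p (0, 1) • W ((p.1 - x₀) / p.2)
        + fderiv ℝ φ p (1, 0) • F ((p.1 - x₀) / p.2) with hG
  have mq : Measurable fun p : ℝ × ℝ => (p.1 - x₀) / p.2 := by fun_prop
  have iG : Integrable G volume :=
    (integrable_smul_of_hasCompactSupport ct st (mW.comp mq) fun p => (hC _).1).add
      (integrable_smul_of_hasCompactSupport cx sx (mF.comp mq) fun p => (hC _).2)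
  have iA : Integrable (fun p : ℝ × ℝ => fderiv ℝ φ p (0, 1) • S (p.1 - x₀)) volume :=
    integrable_smul_of_hasCompactSupport ct st
      ((measurable_stepFun Wl Wr).comp (by fun_prop : Measurable fun p : ℝ × ℝ => p.1 - x₀))
      fun p => norm_stepFun_le _ _ _
  have eν : (volume : Measure (ℝ × ℝ)).restrict (univ ×ˢ Ioc 0 T) =
      (volume : Measure ℝ).prod (volume.restrict (Ioc 0 T)) := by
    rw [Measure.volume_eq_prod, ← Measure.prod_restrict, Measure.restrict_univ]
  have slab : ∀ g : ℝ × ℝ → ℝ × ℝ, Integrable g volume →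
      Integrable g ((volume : Measure ℝ).prod (volume.restrict (Ioc 0 T))) := fun g hg => by
    rw [← eν]; exact hg.restrict
  have e1 : ∫ p in {p : ℝ × ℝ | 0 < p.2}, G p = ∫ t in (0 : ℝ)..T, ∫ x, G (x, t) := by
    rw [intervalIntegral.integral_of_le hT.le, ← integral_prod_symm _ (slab G iG), ← eν]
    refine (setIntegral_eq_of_subset_of_forall_sdiff_eq_zero
      (measurableSet_lt measurable_const measurable_snd) (fun p hp => hp.2.1) fun p hp => ?_)
    have : T ≤ p.2 := by
      by_contra hcon
      exact hp.2 ⟨mem_univ _, hp.1, (not_le.1 hcon).le⟩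
    simp only [hG, (h0 p this).2, zero_smul, add_zero]
  have e2 : ∫ t in (0 : ℝ)..T, ∫ x, fderiv ℝ φ (x, t) (0, 1) • S (x - x₀) =
      -∫ x, φ (x, 0) • S (x - x₀) := by
    rw [intervalIntegral.integral_of_le hT.le, ← integral_prod_symm _ (slab _ iA),
      integral_prod _ (slab _ iA), ← integral_neg]
    refine integral_congr_ae (ae_of_all _ fun x => ?_)
    simp only
    rw [integral_smul_const, ← intervalIntegral.integral_of_le hT.le,
      intervalIntegral.integral_eq_sub_of_hasDerivAt (fun t _ => hasDerivAt_comp_right hφ x t)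
        (Continuous.intervalIntegrable (ct.comp (by fun_prop)) _ _), (h0 (x, T) le_rfl).1,
      zero_sub, neg_smul]
  set Y : ℝ → ℝ → ℝ := fun t ζ => φ (x₀ + t * ζ, t) + t * (ζ * fderiv ℝ φ (x₀ + t * ζ, t) (1, 0)
    + fderiv ℝ φ (x₀ + t * ζ, t) (0, 1)) with hY
  have cφ := hφ.continuous
  have cY : Continuous (Function.uncurry Y) := by
    have c1 : Continuous fun p : ℝ × ℝ => (x₀ + p.1 * p.2, p.1) := by fun_prop
    have c2 := cφ.comp c1
    have c3 := cx.comp c1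
    have c4 := ct.comp c1
    simp only [Function.comp_def] at c2 c3 c4
    exact c2.add (continuous_fst.mul ((continuous_snd.mul c3).add c4))
  have mD : Measurable fun ζ => W ζ - S ζ := mW.sub (measurable_stepFun Wl Wr)
  have bD : ∀ ζ, ‖W ζ - S ζ‖ ≤ C + (‖Wl‖ + ‖Wr‖) := fun ζ =>
    (norm_sub_le _ _).trans (add_le_add (hC ζ).1 (norm_stepFun_le _ _ _))
  have iY : IntegrableOn (Function.uncurry fun t ζ => Y t ζ • (W ζ - S ζ))
      (uIoc 0 T ×ˢ uIoc (-M) M) := by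
    have hI : IntegrableOn (Function.uncurry Y) (uIoc 0 T ×ˢ uIoc (-M) M) :=
      (cY.continuousOn.integrableOn_compact (isCompact_uIcc.prod isCompact_uIcc)).mono_set
        (prod_mono uIoc_subset_uIcc uIoc_subset_uIcc)
    exact hI.smul_bdd _ (mD.comp measurable_snd).aestronglyMeasurable (ae_of_all _ fun p => bD p.2)
  have e3 : ∫ t in (0 : ℝ)..T, ∫ ζ in (-M)..M, Y t ζ • (W ζ - S ζ) = 0 := by
    rw [intervalIntegral_intervalIntegral_swap iY]
    refine (intervalIntegral.integral_congr (g := fun _ => 0) fun ζ _ => ?_).trans (by simp)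
    simp only
    rw [intervalIntegral.integral_smul_const]
    have hd : ∀ t, HasDerivAt (fun t => t * φ (x₀ + t * ζ, t)) (Y t ζ) t := fun t => by
      simpa [hY] using (hasDerivAt_id t).fun_mul (hasDerivAt_comp_ray hφ x₀ ζ t)
    rw [intervalIntegral.integral_eq_sub_of_hasDerivAt (fun t _ => hd t)
      (Continuous.intervalIntegrable (cY.comp (by fun_prop : Continuous fun t => (t, ζ))) _ _),
      (h0 (_, T) le_rfl).1]
    simp
  have jG : IntervalIntegrable (fun t => ∫ x, G (x, t)) volume 0 T := by
    rw [intervalIntegrable_iff, uIoc_of_le hT.le]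
    exact (slab G iG).integral_prod_right
  have jA : IntervalIntegrable (fun t => ∫ x, fderiv ℝ φ (x, t) (0, 1) • S (x - x₀)) volume 0 T := by
    rw [intervalIntegrable_iff, uIoc_of_le hT.le]
    exact (slab _ iA).integral_prod_right
  have jY : IntervalIntegrable (fun t => ∫ ζ in (-M)..M, Y t ζ • (W ζ - S ζ)) volume 0 T := by
    have hM' : -M ≤ M := by linarith
    rw [intervalIntegrable_iff]
    rw [IntegrableOn, Measure.volume_eq_prod, ← Measure.prod_restrict] at iY
    have := iY.integral_prod_left
    simp only [intervalIntegral.integral_of_le hM']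
    rwa [uIoc_of_le hM'] at this
  have e4 : (∫ p in {p : ℝ × ℝ | 0 < p.2}, G p) + ∫ x, φ (x, 0) • S (x - x₀) =
      ∫ t in (0 : ℝ)..T, ((∫ x, G (x, t)) - (∫ x, fderiv ℝ φ (x, t) (0, 1) • S (x - x₀))
        - ∫ ζ in (-M)..M, Y t ζ • (W ζ - S ζ)) := by
    rw [intervalIntegral.integral_sub (jG.sub jA) jY, intervalIntegral.integral_sub jG jA, e1, e2,
      e3]
    simp
  rw [e4]
  have hB0 : 0 ≤ B := (norm_nonneg _).trans (hB 0)
  refine (intervalIntegral.norm_integral_le_of_norm_le_const (C := e * (T * B)) fun t ht => ?_).trans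
    (by rw [sub_zero, abs_of_pos hT]; exact le_of_eq (by ring))
  rw [uIoc_of_le hT.le] at ht
  have ht0 := ht.1
  have c1 : Continuous fun ζ : ℝ => (x₀ + t * ζ, t) := by fun_prop
  have cΦ : Continuous fun ζ => φ (x₀ + t * ζ, t) := cφ.comp c1
  have cΦx : Continuous fun ζ => fderiv ℝ φ (x₀ + t * ζ, t) (1, 0) := cx.comp c1
  have cΦt : Continuous fun ζ => fderiv ℝ φ (x₀ + t * ζ, t) (0, 1) := ct.comp c1
  have weak := hW.weak (fun ζ => φ (x₀ + t * ζ, t))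
    (fun ζ => t * fderiv ℝ φ (x₀ + t * ζ, t) (1, 0)) (T * B)
    (hasDerivAt_comp_selfSimilar hφ x₀ · t) (by fun_prop) (fun ζ => by
      rw [abs_mul, abs_of_pos ht0]
      exact mul_le_mul ht.2 (hB _) (abs_nonneg _) hT.le)
  have step := integral_weak_stepFun (hasDerivAt_comp_selfSimilar hφ x₀ · t) (by fun_prop)
    Wl Wr Fl Fr hM
  refine le_trans (le_of_eq ?_) weak
  rw [← norm_neg]
  congr 1
  have mF' : Measurable fun ζ => F ζ - stepFun Fl Fr ζ := mF.sub (measurable_stepFun Fl Fr)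
  have bF' : ∀ ζ, ‖F ζ - stepFun Fl Fr ζ‖ ≤ C + (‖Fl‖ + ‖Fr‖) := fun ζ =>
    (norm_sub_le _ _).trans (add_le_add (hC ζ).2 (norm_stepFun_le _ _ _))
  have i1 : IntervalIntegrable (fun ζ => fderiv ℝ φ (x₀ + t * ζ, t) (0, 1) • (W ζ - S ζ))
      volume (-M) M := intervalIntegrable_smul_bdd cΦt mD bD _ _
  have i2 : IntervalIntegrable
      (fun ζ => fderiv ℝ φ (x₀ + t * ζ, t) (1, 0) • (F ζ - stepFun Fl Fr ζ))
      volume (-M) M := intervalIntegrable_smul_bdd cΦx mF' bF' _ _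
  have i3 : IntervalIntegrable (fun ζ => Y t ζ • (W ζ - S ζ)) volume (-M) M :=
    intervalIntegrable_smul_bdd (cY.comp (by fun_prop : Continuous fun ζ => (t, ζ))) mD bD _ _
  have i4 : ∀ (w f : ℝ → ℝ × ℝ) (c c' : ℝ), Measurable w → Measurable f → (∀ ζ, ‖w ζ‖ ≤ c) →
      (∀ ζ, ‖f ζ‖ ≤ c') → IntervalIntegrable (fun ζ => φ (x₀ + t * ζ, t) • w ζ
        + (t * fderiv ℝ φ (x₀ + t * ζ, t) (1, 0)) • (ζ • w ζ - f ζ)) volume (-M) M := by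
    intro w f c c' hw hf hcw hcf
    refine (((intervalIntegrable_smul_bdd (a := fun ζ => φ (x₀ + t * ζ, t)
      + t * fderiv ℝ φ (x₀ + t * ζ, t) (1, 0) * ζ) (by fun_prop) hw hcw (-M) M)).sub
      (intervalIntegrable_smul_bdd (a := fun ζ => t * fderiv ℝ φ (x₀ + t * ζ, t) (1, 0))
        (by fun_prop) hf hcf (-M) M)).congr fun ζ _ => ?_
    module
  have iW := i4 W F C C mW mF (fun ζ => (hC ζ).1) fun ζ => (hC ζ).2
  have iS := i4 _ _ _ _ (measurable_stepFun Wl Wr) (measurable_stepFun Fl Fr)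
    (norm_stepFun_le Wl Wr) (norm_stepFun_le Fl Fr)
  have eG : ∫ x, G (x, t) = (∫ x, fderiv ℝ φ (x, t) (0, 1) • S (x - x₀))
      + t • (∫ ζ in (-M)..M, fderiv ℝ φ (x₀ + t * ζ, t) (0, 1) • (W ζ - S ζ))
      + (φ (x₀, t) • (Fl - Fr)
      + t • ∫ ζ in (-M)..M, fderiv ℝ φ (x₀ + t * ζ, t) (1, 0) • (F ζ - stepFun Fl Fr ζ)) := by
    have q1 := integral_slice_split ct st (x₀ := x₀) hM ht0 mW (fun ζ => (hC ζ).1)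
      (fun ζ hζ => (hW.left ζ hζ).1) fun ζ hζ => (hW.right ζ hζ).1
    have q2 := integral_slice_split cx sx (x₀ := x₀) hM ht0 mF (fun ζ => (hC ζ).2)
      (fun ζ hζ => (hW.left ζ hζ).2) fun ζ hζ => (hW.right ζ hζ).2
    rw [integral_left_smul_stepFun hφ hc] at q2
    rw [← q1, ← q2]
    exact integral_add
      (integrable_slice ct st (H := fun x => W ((x - x₀) / t)) (mW.comp (by fun_prop))
        (fun x => (hC _).1) t)
      (integrable_slice cx sx (H := fun x => F ((x - x₀) / t)) (mF.comp (by fun_prop))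
        (fun x => (hC _).2) t)
  have eI : (∫ ζ in (-M)..M, Y t ζ • (W ζ - S ζ))
      - t • (∫ ζ in (-M)..M, fderiv ℝ φ (x₀ + t * ζ, t) (0, 1) • (W ζ - S ζ))
      - t • (∫ ζ in (-M)..M, fderiv ℝ φ (x₀ + t * ζ, t) (1, 0) • (F ζ - stepFun Fl Fr ζ)) =
      (∫ ζ in (-M)..M, (φ (x₀ + t * ζ, t) • W ζ
        + (t * fderiv ℝ φ (x₀ + t * ζ, t) (1, 0)) • (ζ • W ζ - F ζ)))
      - ∫ ζ in (-M)..M, (φ (x₀ + t * ζ, t) • stepFun Wl Wr ζ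
        + (t * fderiv ℝ φ (x₀ + t * ζ, t) (1, 0)) • (ζ • stepFun Wl Wr ζ - stepFun Fl Fr ζ)) := by
    have i1' : IntervalIntegrable
        (fun ζ => t • fderiv ℝ φ (x₀ + t * ζ, t) (0, 1) • (W ζ - S ζ)) volume (-M) M := i1.smul t
    have i2' : IntervalIntegrable
        (fun ζ => t • fderiv ℝ φ (x₀ + t * ζ, t) (1, 0) • (F ζ - stepFun Fl Fr ζ)) volume (-M) M :=
      i2.smul t
    rw [← intervalIntegral.integral_sub iW iS, ← intervalIntegral.integral_smul,
      ← intervalIntegral.integral_smul, ← intervalIntegral.integral_sub i3 i1',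
      ← intervalIntegral.integral_sub (i3.sub i1') i2']
    refine intervalIntegral.integral_congr fun ζ _ => ?_
    simp only [hY, hS]
    module
  rw [step, mul_zero, add_zero] at eI
  rw [eG, ← sub_eq_zero]
  linear_combination (norm := module) eI

end

/-! ### Weak formulation for nets -/

/-- The self-similar net `V` joins `Ul` to `Ur` and satisfies the weak form of the conservation
laws up to an error that vanishes as `ε → 0`. -/
def IsWeakNet (α : ℝ) (Ul Ur : State) (V : ℝ → ℝ → State) : Prop :=
  ∃ M > 0, ∃ e : ℝ → ℝ, Tendsto e (𝓝[>] 0) (𝓝 0) ∧ ∀ ε > 0, 0 ≤ e ε ∧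
    (ε < 1 → (∀ ζ < -M, V ε ζ = Ul) ∧ (∀ ζ > M, V ε ζ = Ur) ∧
    IsWeakProfile (fun ζ => conserved (V ε ζ)) (fun ζ => flux α (V ε ζ))
      (conserved Ul) (conserved Ur) (flux α Ul) (flux α Ur) M (e ε))

lemma measurable_conserved : Measurable conserved := continuous_conserved.measurable

lemma measurable_flux (α : ℝ) : Measurable (flux α) := by unfold flux; fun_prop

lemma norm_sub_le_of_hasDerivAt {Φ Φ' : ℝ → ℝ} {B : ℝ} (h : ∀ ζ, HasDerivAt Φ (Φ' ζ) ζ)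
    (hB : ∀ ζ, |Φ' ζ| ≤ B) {x y : ℝ} (hxy : x ≤ y) : |Φ y - Φ x| ≤ B * (y - x) := by
  have := Convex.norm_image_sub_le_of_norm_hasDerivWithin_le (f := Φ) (f' := Φ') (s := univ)
    (x := x) (y := y) (fun ζ _ => (h ζ).hasDerivWithinAt) (fun ζ _ => hB ζ) convex_univ
    (mem_univ _) (mem_univ _)
  rwa [Real.norm_eq_abs, Real.norm_eq_abs, abs_of_nonneg (sub_nonneg.2 hxy)] at this

lemma isWeakProfile_const (W F : ℝ × ℝ) (M : ℝ) :
    IsWeakProfile (fun _ => W) (fun _ => F) W W F F M 0 where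
  left _ _ := ⟨rfl, rfl⟩
  right _ _ := ⟨rfl, rfl⟩
  measurable := ⟨measurable_const, measurable_const⟩
  bounded := ⟨max ‖W‖ ‖F‖, fun _ => ⟨le_max_left _ _, le_max_right _ _⟩⟩
  weak Φ Φ' B h hc _ := by
    rw [(hasIntegralOn_weak_const h hc W F (-M) M).2, zero_mul]
    refine le_of_eq (norm_eq_zero.2 ?_)
    module

/-- A shock or a centred rarefaction wave filling the sector from `a` to `b`. -/
def IsWave (α : ℝ) (lam : State → ℝ) (Ul Ur : State) (a b : ℝ) (w : ℝ → State) : Prop :=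
  (a = b ∧ RankineHugoniot α Ul Ur a) ∨ IsRarefaction α lam Ul Ur a b w

lemma IsWave₁.isWave {α : ℝ} {Ul Ur : State} {a b : ℝ} {w : ℝ → State}
    (h : IsWave₁ α Ul Ur a b w) : IsWave α (lam₁ α) Ul Ur a b w :=
  h.imp (fun h => ⟨h.1, h.2.1⟩) id

lemma IsWave₂.isWave {α : ℝ} {Ul Ur : State} {a b : ℝ} {w : ℝ → State}
    (h : IsWave₂ α Ul Ur a b w) : IsWave α (lam₂ α) Ul Ur a b w :=
  h.imp (fun h => ⟨h.1, h.2.1⟩) id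

section

variable {α : ℝ} {lam : State → ℝ} {Ul Ur : State} {a b : ℝ} {w : ℝ → State}

lemma IsWave.hasIntegralOn_weak (h : IsWave α lam Ul Ur a b w) {Φ Φ' : ℝ → ℝ}
    (hΦ : ∀ ζ, HasDerivAt Φ (Φ' ζ) ζ) (hc : Continuous Φ') :
    HasIntegralOn (fun ζ => Φ ζ • conserved (w ζ) + Φ' ζ • (ζ • conserved (w ζ) - flux α (w ζ)))
      a b (Φ b • (b • conserved Ur - flux α Ur) - Φ a • (a • conserved Ul - flux α Ul)) := by
  rcases h with ⟨rfl, h⟩ | h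
  · refine ⟨IntervalIntegrable.refl, ?_⟩
    rw [intervalIntegral.integral_same, ← smul_sub]
    unfold RankineHugoniot at h
    rw [smul_sub] at h
    have : a • conserved Ur - flux α Ur - (a • conserved Ul - flux α Ul) = 0 := by
      linear_combination (norm := module) -h
    rw [this, smul_zero]
  · have hd := fun {ζ : ℝ} => h.deriv_eqs (ζ := ζ)
    obtain ⟨hab, rfl, rfl, hw, h1, -⟩ := h
    have hρ := fun x hx => (h1 x hx).1
    have hF := continuousOn_flux_comp (α := α) hw hρ
    have hW := continuous_conserved.comp_continuousOn hw
    simp only [Function.comp_def] at hW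
    have hΦc : Continuous Φ := continuous_iff_continuousAt.2 fun ζ => (hΦ ζ).continuousAt
    have hi : IntervalIntegrable (fun ζ => Φ ζ • conserved (w ζ)
        + Φ' ζ • (ζ • conserved (w ζ) - flux α (w ζ))) volume a b := by
      refine ContinuousOn.intervalIntegrable ?_
      rw [uIcc_of_le hab]
      fun_prop
    refine ⟨hi, intervalIntegral.integral_eq_sub_of_hasDerivAt_of_le hab
      (f := fun ζ => Φ ζ • (ζ • conserved (w ζ) - flux α (w ζ))) (by fun_prop) (fun ζ hζ => ?_) hi⟩
    obtain ⟨w', q1, q2, q3⟩ := hd hζ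
    have d1 := hasDerivAt_conserved q1
    have d2 := hasDerivAt_flux (α := α) (hρ ζ (Ioo_subset_Icc_self hζ)) q1
    rw [q3, q2] at d2
    have := (hΦ ζ).fun_smul (((hasDerivAt_id ζ).fun_smul d1).fun_sub d2)
    refine this.congr_deriv ?_
    rw [q2, show (ζ * w'.1, ζ * (ζ * w'.1)) = ζ • (w'.1, ζ * w'.1) from rfl, id]
    module

lemma IsWave.exists_bound (h : IsWave α lam Ul Ur a b w) :
    ∃ C, ∀ ζ ∈ Ioo a b, ‖conserved (w ζ)‖ ≤ C ∧ ‖flux α (w ζ)‖ ≤ C := by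
  rcases h with ⟨rfl, -⟩ | ⟨hab, -, -, hw, h1, -⟩
  · exact ⟨0, by simp⟩
  · have hF := continuousOn_flux_comp (α := α) hw fun x hx => (h1 x hx).1
    have hW := continuous_conserved.comp_continuousOn hw
    obtain ⟨C₁, hC₁⟩ := isCompact_Icc.exists_bound_of_continuousOn hF
    obtain ⟨C₂, hC₂⟩ := isCompact_Icc.exists_bound_of_continuousOn hW
    exact ⟨max C₁ C₂, fun ζ hζ => ⟨(hC₂ ζ (Ioo_subset_Icc_self hζ)).trans (le_max_right _ _),
      (hC₁ ζ (Ioo_subset_Icc_self hζ)).trans (le_max_left _ _)⟩⟩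

lemma IsWave.exists_measurable (h : IsWave α lam Ul Ur a b w) :
    ∃ w' : ℝ → State, Measurable w' ∧ EqOn w w' (Ioo a b) := by
  rcases h with ⟨rfl, -⟩ | ⟨hab, -, -, hw, -, -⟩
  · exact ⟨fun _ => Ul, measurable_const, by simp⟩
  · refine ⟨IccExtend hab ((Icc a b).domRestrict w), (hw.domRestrict.Icc_extend').measurable,
      fun ζ hζ => ?_⟩
    rw [IccExtend_of_mem _ _ (Ioo_subset_Icc_self hζ)]; rfl

end

lemma fanProfile_cases (Ul Um Ur : State) (a₁ b₁ a₂ b₂ : ℝ) (w₁ w₂ : ℝ → State)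
    {P : State → Prop} (hl : P Ul) (hm : P Um) (hr : P Ur) (h₁ : ∀ ζ ∈ Ioo a₁ b₁, P (w₁ ζ))
    (h₂ : ∀ ζ ∈ Ioo a₂ b₂, P (w₂ ζ)) (ζ : ℝ) : P (fanProfile Ul Um Ur a₁ b₁ a₂ b₂ w₁ w₂ ζ) := by
  unfold fanProfile
  split_ifs with c1 c2 c3 c4
  · exact hl
  · exact h₁ _ ⟨not_le.1 c1, c2⟩
  · exact hm
  · exact h₂ _ ⟨not_le.1 c3, c4⟩
  · exact hr

lemma measurable_fanProfile {α : ℝ} {lam lam' : State → ℝ} {Ul Um Ur Ul' Um' : State}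
    {a₁ b₁ a₂ b₂ : ℝ} {w₁ w₂ : ℝ → State} (h₁ : IsWave α lam Ul Um a₁ b₁ w₁)
    (h₂ : IsWave α lam' Um Ur a₂ b₂ w₂) :
    Measurable (fanProfile Ul' Um' Ur a₁ b₁ a₂ b₂ w₁ w₂) := by
  obtain ⟨v₁, m₁, e₁⟩ := h₁.exists_measurable
  obtain ⟨v₂, m₂, e₂⟩ := h₂.exists_measurable
  have : fanProfile Ul' Um' Ur a₁ b₁ a₂ b₂ w₁ w₂ = fanProfile Ul' Um' Ur a₁ b₁ a₂ b₂ v₁ v₂ := by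
    ext1 ζ
    unfold fanProfile
    split_ifs with c1 c2 c3 c4
    · rfl
    · exact e₁ ⟨not_le.1 c1, c2⟩
    · rfl
    · exact e₂ ⟨not_le.1 c3, c4⟩
    · rfl
  rw [this]
  exact Measurable.ite measurableSet_Iic measurable_const (Measurable.ite measurableSet_Iio m₁
    (Measurable.ite measurableSet_Iic measurable_const (Measurable.ite measurableSet_Iio m₂
      measurable_const)))

section

variable {α : ℝ} (hα₀ : 0 < α) (hα₁ : α < 1)
include hα₀ hα₁

lemma IsFan.isWeakNet {Ul Um Ur : State} {a₁ b₁ a₂ b₂ : ℝ} {w₁ w₂ : ℝ → State}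
    (hl : 0 < Ul.1) (hr : 0 < Ur.1) (h : IsFan α Ul Um Ur a₁ b₁ a₂ b₂ w₁ w₂) :
    IsWeakNet α Ul Ur (fun _ => fanProfile Ul Um Ur a₁ b₁ a₂ b₂ w₁ w₂) := by
  obtain ⟨l1, l2, l3⟩ := h.le hα₀ hα₁ hl hr
  have W1 := h.2.1.isWave
  have W2 := h.2.2.1.isWave
  have p1 := abs_nonneg a₁
  have p2 := abs_nonneg b₂
  have hM1 := neg_abs_le a₁
  have hM2 := le_abs_self b₂
  set V := fanProfile Ul Um Ur a₁ b₁ a₂ b₂ w₁ w₂ with hV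
  have mV : Measurable V := measurable_fanProfile W1 W2
  refine ⟨|a₁| + |b₂| + 1, by positivity, fun _ => 0, tendsto_const_nhds, fun ε _ => ⟨le_rfl,
    fun _ => ?_⟩⟩
  set M := |a₁| + |b₂| + 1 with hM
  have vl : ∀ ζ < -M, V ζ = Ul := fun ζ hζ => fanProfile_of_lt (by linarith)
  have vr : ∀ ζ > M, V ζ = Ur := fun ζ hζ => fanProfile_of_gt l1 l2 l3 (by linarith)
  refine ⟨vl, vr, fun ζ hζ => ⟨congrArg conserved (vl ζ hζ), congrArg (flux α) (vl ζ hζ)⟩,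
    fun ζ hζ => ⟨congrArg conserved (vr ζ hζ), congrArg (flux α) (vr ζ hζ)⟩,
    ⟨measurable_conserved.comp mV, (measurable_flux α).comp mV⟩, ?_, fun Φ Φ' B hΦ hc _ => ?_⟩
  · obtain ⟨C₁, hC₁⟩ := W1.exists_bound
    obtain ⟨C₂, hC₂⟩ := W2.exists_bound
    refine ⟨|C₁| + |C₂| + (‖conserved Ul‖ + ‖flux α Ul‖ + (‖conserved Um‖ + ‖flux α Um‖)
      + (‖conserved Ur‖ + ‖flux α Ur‖)), fanProfile_cases _ _ _ _ _ _ _ _ _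
        (P := fun U => ‖conserved U‖ ≤ _ ∧ ‖flux α U‖ ≤ _) ?_ ?_ ?_ (fun ζ hζ => ?_) fun ζ hζ => ?_⟩
    all_goals
      have := abs_nonneg C₁
      have := abs_nonneg C₂
      have := norm_nonneg (conserved Ul)
      have := norm_nonneg (conserved Um)
      have := norm_nonneg (conserved Ur)
      have := norm_nonneg (flux α Ul)
      have := norm_nonneg (flux α Um)
      have := norm_nonneg (flux α Ur)
    · constructor <;> linarith
    · constructor <;> linarith
    · constructor <;> linarith
    · have := hC₁ ζ hζ
      have := le_abs_self C₁
      constructor <;> linarith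
    · have := hC₂ ζ hζ
      have := le_abs_self C₂
      constructor <;> linarith
  · set f : ℝ → ℝ × ℝ := fun ζ => Φ ζ • conserved (V ζ)
      + Φ' ζ • (ζ • conserved (V ζ) - flux α (V ζ)) with hf
    have i1 := (hasIntegralOn_weak_const hΦ hc (conserved Ul) (flux α Ul) (-M) a₁).congr (f := f)
      (by linarith) fun x hx => by simp only [hf, hV, fanProfile_of_lt hx.2.le]
    have i2 := (W1.hasIntegralOn_weak hΦ hc).congr (f := f) l1 fun x hx => by
      simp only [hf, hV, fanProfile_wave₁ hx]
    have i3 := (hasIntegralOn_weak_const hΦ hc (conserved Um) (flux α Um) b₁ a₂).congr (f := f)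
      l2 fun x hx => by simp only [hf, hV, fanProfile_middle l1 hx]
    have i4 := (W2.hasIntegralOn_weak hΦ hc).congr (f := f) l3 fun x hx => by
      simp only [hf, hV, fanProfile_wave₂ l1 l2 hx]
    have i5 := (hasIntegralOn_weak_const hΦ hc (conserved Ur) (flux α Ur) b₂ M).congr (f := f)
      (by linarith) fun x hx => by simp only [hf, hV, fanProfile_of_gt l1 l2 l3 hx.1]
    rw [((((i1.trans i2).trans i3).trans i4).trans i5).2, zero_mul]
    refine le_of_eq (norm_eq_zero.2 ?_)
    module

end

/-! ### Construction of shadow waves -/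

/-- The conserved quantities in the interior of a shadow wave. -/
def shadowConserved (Ul Ur : State) (c ε : ℝ) : ℝ × ℝ :=
  (shadowMass Ul Ur c / ε + (Ul.1 + Ur.1) / 2,
    c * shadowMass Ul Ur c / ε + (Ul.1 * Ul.2 + Ur.1 * Ur.2) / 2)

/-- The interior state of a shadow wave. -/
def shadowState (Ul Ur : State) (c ε : ℝ) : State :=
  ((shadowConserved Ul Ur c ε).1, (shadowConserved Ul Ur c ε).2 / (shadowConserved Ul Ur c ε).1)

/-- A shadow wave with equal interior states. -/
def shadowNet (Ul Ur : State) (c ε ζ : ℝ) : State :=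
  if ζ ≤ c - ε / 2 then Ul
  else if ζ < c then shadowState Ul Ur c ε
  else if ζ < c + ε / 2 then shadowState Ul Ur c ε
  else Ur

lemma tendsto_id_nhdsGT_zero : Tendsto (fun ε : ℝ => ε) (𝓝[>] 0) (𝓝 0) :=
  tendsto_id.mono_left nhdsWithin_le_nhds

section

variable {α : ℝ} (hα₀ : 0 < α) {Ul Ur : State} {c : ℝ} (hl : 0 < Ul.1) (hr : 0 < Ur.1)
  (hc : IsShadowSpeed α Ul Ur c)
include hα₀ hl hr hc

lemma shadowConserved_pos {ε : ℝ} (hε : 0 < ε) : 0 < (shadowConserved Ul Ur c ε).1 := by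
  have := hc.mass_pos hα₀ hl hr
  unfold shadowConserved; positivity

lemma conserved_shadowState {ε : ℝ} (hε : 0 < ε) :
    conserved (shadowState Ul Ur c ε) = shadowConserved Ul Ur c ε := by
  have := (shadowConserved_pos hα₀ hl hr hc hε).ne'
  unfold conserved shadowState
  ext
  · rfl
  · simp only; field_simp

lemma smul_shadowConserved {ε : ℝ} (hε : 0 < ε) : ε • shadowConserved Ul Ur c ε =
    c • (conserved Ur - conserved Ul) - (flux α Ur - flux α Ul)
      + (ε / 2) • (conserved Ul + conserved Ur) := by
  have h := hc.2.2
  ext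
  · simp only [shadowConserved, shadowMass, conserved, flux, Prod.smul_fst, Prod.fst_add,
      Prod.fst_sub, smul_eq_mul]
    field_simp
    ring
  · simp only [shadowConserved, shadowMass, conserved, flux, Prod.smul_snd, Prod.snd_add,
      Prod.snd_sub, smul_eq_mul]
    field_simp
    linear_combination -2 * h

lemma tendsto_internalPressure_shadowState :
    Tendsto (fun ε => ε * (shadowState Ul Ur c ε).1 ^ (-α)) (𝓝[>] 0) (𝓝 0) := by
  have h0 : Tendsto (fun ε : ℝ => ε * ((Ul.1 + Ur.1) / 2) ^ (-α)) (𝓝[>] 0) (𝓝 0) := by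
    simpa using tendsto_id_nhdsGT_zero.mul_const (((Ul.1 + Ur.1) / 2) ^ (-α))
  have hM := hc.mass_pos hα₀ hl hr
  refine squeeze_zero' ?_ ?_ h0
  · filter_upwards [self_mem_nhdsWithin] with ε (hε : 0 < ε)
    have : 0 < (shadowState Ul Ur c ε).1 := shadowConserved_pos hα₀ hl hr hc hε
    positivity
  · filter_upwards [self_mem_nhdsWithin] with ε (hε : 0 < ε)
    refine mul_le_mul_of_nonneg_left (Real.rpow_le_rpow_of_nonpos (by linarith) ?_ (by linarith))
      hε.le
    simp only [shadowState, shadowConserved]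
    have : 0 < shadowMass Ul Ur c / ε := by positivity
    linarith

/-- The interior of the shadow wave moves with speed `c`. -/
lemma tendsto_shadow_flux_sub : Tendsto (fun ε => ε • (c • conserved (shadowState Ul Ur c ε)
    - flux α (shadowState Ul Ur c ε))) (𝓝[>] 0) (𝓝 0) := by
  have hM := hc.mass_pos hα₀ hl hr
  set κ := shadowMass Ul Ur c with hκ
  set p := (Ul.1 + Ur.1) / 2 with hp
  set q := (Ul.1 * Ul.2 + Ur.1 * Ur.2) / 2 with hq
  have hp0 : 0 < p := by positivity
  have hi := tendsto_id_nhdsGT_zero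
  have t1 : Tendsto (fun ε : ℝ => ε * (c * p - q)) (𝓝[>] 0) (𝓝 0) := by
    simpa using hi.mul_const (c * p - q)
  have t2 : Tendsto (fun ε : ℝ => (c * κ + ε * q) * (ε * (c * p - q)) / (κ + ε * p)
      + ε * (shadowState Ul Ur c ε).1 ^ (-α)) (𝓝[>] 0) (𝓝 0) := by
    have a1 := ((hi.mul_const q).const_add (c * κ)).mul t1
    have a2 := a1.div ((hi.mul_const p).const_add κ) (by simpa using hM.ne')
    simpa using a2.add (tendsto_internalPressure_shadowState hα₀ hl hr hc)
  have t3 := t1.prodMk_nhds t2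
  refine t3.congr' ?_
  filter_upwards [self_mem_nhdsWithin] with ε (hε : 0 < ε)
  have hpos := shadowConserved_pos hα₀ hl hr hc hε
  have e1 : (shadowConserved Ul Ur c ε).1 = (κ + ε * p) / ε := by
    simp only [shadowConserved, ← hκ, ← hp]; field_simp
  have e2 : (shadowConserved Ul Ur c ε).2 = (c * κ + ε * q) / ε := by
    simp only [shadowConserved, ← hκ, ← hq]; field_simp
  have h0 : 0 < κ + ε * p := by positivity
  ext
  · rw [conserved_shadowState hα₀ hl hr hc hε]
    simp only [flux, shadowState, Prod.smul_fst, Prod.fst_sub, smul_eq_mul, e1, e2]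
    field_simp
    ring
  · rw [conserved_shadowState hα₀ hl hr hc hε]
    simp only [flux, shadowState, Prod.smul_snd, Prod.snd_sub, smul_eq_mul, e1, e2]
    field_simp
    ring

lemma isShadowNet_shadowNet : IsShadowNet α Ul Ur (shadowNet Ul Ur c) c (shadowState Ul Ur c)
    (shadowState Ul Ur c) := by
  refine ⟨fun ε hε => ⟨shadowConserved_pos hα₀ hl hr hc hε, shadowConserved_pos hα₀ hl hr hc hε⟩,
    hc.1, hc.2.1, ?_, ?_, fun ε _ ζ => rfl⟩
  · have : Tendsto (fun ε : ℝ => (ε / 2) • (conserved Ul + conserved Ur)) (𝓝[>] 0) (𝓝 0) := by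
      simpa using (tendsto_id_nhdsGT_zero.div_const 2).smul_const (conserved Ul + conserved Ur)
    refine this.congr' ?_
    filter_upwards [self_mem_nhdsWithin] with ε (hε : 0 < ε)
    have := smul_shadowConserved hα₀ hl hr hc hε
    rw [conserved_shadowState hα₀ hl hr hc hε]
    linear_combination (norm := module) -this
  · refine (tendsto_shadow_flux_sub hα₀ hl hr hc).congr fun ε => ?_
    module

lemma isWeakNet_shadowNet : IsWeakNet α Ul Ur (shadowNet Ul Ur c) := by
  have hM1 := neg_abs_le c
  have hM2 := le_abs_self c
  have hpos := abs_nonneg c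
  set X : ℝ → ℝ × ℝ := fun ε => (c - ε / 2) • (conserved (shadowState Ul Ur c ε) - conserved Ul)
    - (flux α (shadowState Ul Ur c ε) - flux α Ul) with hX
  refine ⟨|c| + 1, by positivity, fun ε => ‖ε • X ε‖, ?_, fun ε hε => ⟨norm_nonneg _,
    fun hε1 => ?_⟩⟩
  · have hi := tendsto_id_nhdsGT_zero
    rw [← tendsto_zero_iff_norm_tendsto_zero]
    have t1 : Tendsto (fun ε : ℝ => (-(ε / 2)) • (c • (conserved Ur - conserved Ul)
        - (flux α Ur - flux α Ul) + (ε / 2) • (conserved Ul + conserved Ur))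
        - ε • ((c - ε / 2) • conserved Ul - flux α Ul)) (𝓝[>] 0) (𝓝 0) := by
      have : Continuous fun ε : ℝ => (-(ε / 2)) • (c • (conserved Ur - conserved Ul)
        - (flux α Ur - flux α Ul) + (ε / 2) • (conserved Ul + conserved Ur))
        - ε • ((c - ε / 2) • conserved Ul - flux α Ul) := by fun_prop
      simpa using (this.tendsto 0).mono_left nhdsWithin_le_nhds
    have t2 := (tendsto_shadow_flux_sub hα₀ hl hr hc).add t1
    rw [add_zero] at t2
    refine t2.congr' ?_
    filter_upwards [self_mem_nhdsWithin] with ε (hε : 0 < ε)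
    rw [← smul_shadowConserved hα₀ hl hr hc hε, conserved_shadowState hα₀ hl hr hc hε]
    simp only [hX, conserved_shadowState hα₀ hl hr hc hε]
    module
  set M := |c| + 1 with hM
  set V := shadowNet Ul Ur c ε with hV
  have vl : ∀ ζ ≤ c - ε / 2, V ζ = Ul := fun ζ hζ => if_pos hζ
  have vm : ∀ ζ ∈ Ioo (c - ε / 2) (c + ε / 2), V ζ = shadowState Ul Ur c ε := fun ζ hζ => by
    simp only [hV, shadowNet, if_neg (not_le.2 hζ.1), if_pos hζ.2, ite_self]
  have vr : ∀ ζ ≥ c + ε / 2, V ζ = Ur := fun ζ hζ => by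
    simp only [hV, shadowNet]
    rw [if_neg (by linarith), if_neg (by linarith), if_neg (not_lt.2 hζ)]
  have mV : Measurable V :=
    Measurable.ite measurableSet_Iic measurable_const (Measurable.ite measurableSet_Iio
      measurable_const (Measurable.ite measurableSet_Iio measurable_const measurable_const))
  refine ⟨fun ζ hζ => vl ζ (by linarith), fun ζ hζ => vr ζ (by linarith),
    fun ζ hζ => ⟨congrArg conserved (vl ζ (by linarith)), congrArg (flux α) (vl ζ (by linarith))⟩,
    fun ζ hζ => ⟨congrArg conserved (vr ζ (by linarith)), congrArg (flux α) (vr ζ (by linarith))⟩,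
    ⟨measurable_conserved.comp mV, (measurable_flux α).comp mV⟩, ?_, fun Φ Φ' B hΦ hΦc hB => ?_⟩
  · refine ⟨(‖conserved Ul‖ + ‖flux α Ul‖) + (‖conserved Ur‖ + ‖flux α Ur‖)
      + (‖conserved (shadowState Ul Ur c ε)‖ + ‖flux α (shadowState Ul Ur c ε)‖), fun ζ => ?_⟩
    have := norm_nonneg (conserved Ul)
    have := norm_nonneg (conserved (shadowState Ul Ur c ε))
    have := norm_nonneg (conserved Ur)
    have := norm_nonneg (flux α Ul)
    have := norm_nonneg (flux α (shadowState Ul Ur c ε))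
    have := norm_nonneg (flux α Ur)
    rcases le_or_gt ζ (c - ε / 2) with h1 | h1
    · change ‖conserved (V ζ)‖ ≤ _ ∧ ‖flux α (V ζ)‖ ≤ _
      rw [vl ζ h1]; constructor <;> linarith
    rcases lt_or_ge ζ (c + ε / 2) with h2 | h2
    · change ‖conserved (V ζ)‖ ≤ _ ∧ ‖flux α (V ζ)‖ ≤ _
      rw [vm ζ ⟨h1, h2⟩]; constructor <;> linarith
    · change ‖conserved (V ζ)‖ ≤ _ ∧ ‖flux α (V ζ)‖ ≤ _
      rw [vr ζ h2]; constructor <;> linarith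
  · set f : ℝ → ℝ × ℝ := fun ζ => Φ ζ • conserved (V ζ)
      + Φ' ζ • (ζ • conserved (V ζ) - flux α (V ζ)) with hf
    have i1 := (hasIntegralOn_weak_const hΦ hΦc (conserved Ul) (flux α Ul) (-M)
      (c - ε / 2)).congr (f := f) (by linarith) fun x hx => by simp only [hf, vl x hx.2.le]
    have i2 := (hasIntegralOn_weak_const hΦ hΦc (conserved (shadowState Ul Ur c ε))
      (flux α (shadowState Ul Ur c ε)) (c - ε / 2) (c + ε / 2)).congr (f := f) (by linarith)
      fun x hx => by simp only [hf, vm x hx]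
    have i3 := (hasIntegralOn_weak_const hΦ hΦc (conserved Ur) (flux α Ur)
      (c + ε / 2) M).congr (f := f) (by linarith) fun x hx => by simp only [hf, vr x hx.1.le]
    rw [((i1.trans i2).trans i3).2]
    have key := smul_shadowConserved hα₀ hl hr hc hε
    rw [← conserved_shadowState hα₀ hl hr hc hε] at key
    have e : ∀ A B C D : ℝ, (A • ((c - ε / 2) • conserved Ul - flux α Ul)
        - B • (-M • conserved Ul - flux α Ul)
        + (C • ((c + ε / 2) • conserved (shadowState Ul Ur c ε) - flux α (shadowState Ul Ur c ε))
          - A • ((c - ε / 2) • conserved (shadowState Ul Ur c ε)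
            - flux α (shadowState Ul Ur c ε)))
        + (D • (M • conserved Ur - flux α Ur) - C • ((c + ε / 2) • conserved Ur - flux α Ur)))
        - (D • (M • conserved Ur - flux α Ur) + B • (M • conserved Ul + flux α Ul)) =
        (C - A) • X ε := by
      intro A B C D
      simp only [hX]
      linear_combination (norm := module) C • key
    rw [e]
    simp only [norm_smul, Real.norm_eq_abs, abs_of_pos hε]
    have := norm_sub_le_of_hasDerivAt hΦ hB (by linarith : c - ε / 2 ≤ c + ε / 2)
    rw [show c + ε / 2 - (c - ε / 2) = ε by ring] at this
    calc _ ≤ B * ε * ‖X ε‖ := mul_le_mul_of_nonneg_right this (norm_nonneg _)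
      _ = _ := by ring

end

/-! ### Superposition of two Riemann problems -/

/-- The net which consists of the solutions `Vl` and `Vr` of the Riemann problems at `-μ/2` and
`μ/2`. -/
def gluedNet (Uin : ℝ → State) (μ : ℝ) (Vl Vr : ℝ → ℝ → State) (ε x t : ℝ) : State :=
  if t = 0 then Uin x else if x < 0 then Vl ε ((x + μ / 2) / t) else Vr ε ((x - μ / 2) / t)

/-- Outside small neighbourhoods of `±μ/2` a superposition is constant, so that every function of
it is additive. -/
lemma superposition {E : Type*} [AddCommGroup E] (f : State → E) {Vl Vr : ℝ → State} {Um : State}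
    {Ml Mr μ x t : ℝ} (ht : 0 < t) (hl : ∀ ζ > Ml, Vl ζ = Um) (hr : ∀ ζ < -Mr, Vr ζ = Um)
    (h1 : Ml * t < μ / 2) (h2 : Mr * t < μ / 2) :
    f (if x < 0 then Vl ((x + μ / 2) / t) else Vr ((x - μ / 2) / t)) =
      f (Vl ((x + μ / 2) / t)) + f (Vr ((x - μ / 2) / t)) - f Um := by
  split_ifs with h
  · rw [hr ((x - μ / 2) / t) (by rw [div_lt_iff₀ ht]; linarith), add_sub_cancel_right]
  · rw [hl ((x + μ / 2) / t) (by rw [gt_iff_lt, lt_div_iff₀ ht]; linarith), add_sub_cancel_left]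

lemma integral_add_sub {X : Type*} [MeasurableSpace X] {m : Measure X} {f g h : X → ℝ × ℝ}
    (hf : Integrable f m) (hg : Integrable g m) (hh : Integrable h m) :
    ∫ x, (f x + g x - h x) ∂m = ∫ x, f x ∂m + ∫ x, g x ∂m - ∫ x, h x ∂m := by
  rw [← integral_add hf hg]
  exact integral_sub (hf.add hg) hh

theorem exists_isApproxWeakSolution {α ξ μ v : ℝ} {Ul Ur : State} {Vl Vr : ℝ → ℝ → State}
    (hμ : 0 < μ) (hl : IsWeakNet α Ul (ξ / μ, v) Vl) (hr : IsWeakNet α (ξ / μ, v) Ur Vr) :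
    ∃ T > 0, IsApproxWeakSolution α (initialData Ul Ur ξ μ v) T
      (gluedNet (initialData Ul Ur ξ μ v) μ Vl Vr) := by
  obtain ⟨Ml, hMl, el, tl, hl⟩ := hl
  obtain ⟨Mr, hMr, er, tr, hr⟩ := hr
  set Um : State := (ξ / μ, v) with hUm
  refine ⟨μ / 2 / (Ml + Mr), by positivity, fun φ hφ hc hs => ?_⟩
  obtain ⟨K, hK⟩ := exists_norm_weak_le hφ hc
  have cx := continuous_fderiv_apply hφ (1, 0)
  have ct := continuous_fderiv_apply hφ (0, 1)
  have sx := hasCompactSupport_fderiv_apply hφ hc (1, 0)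
  have st := hasCompactSupport_fderiv_apply hφ hc (0, 1)
  have lim : Tendsto (fun ε => K * el ε + K * er ε + K * 0) (𝓝[>] 0) (𝓝 0) := by
    simpa using ((tl.const_mul K).add (tr.const_mul K)).add_const (K * 0)
  refine squeeze_zero_norm' ?_ lim
  filter_upwards [Ioo_mem_nhdsGT (zero_lt_one' ℝ)] with ε hε
  obtain ⟨el0, hl⟩ := hl ε hε.1
  obtain ⟨er0, hr⟩ := hr ε hε.1
  obtain ⟨-, vl, wl⟩ := hl hε.2
  obtain ⟨vr, -, wr⟩ := hr hε.2
  have nl := hK _ _ _ _ _ _ _ _ (-(μ / 2)) hMl.le el0 wl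
  have nr := hK _ _ _ _ _ _ _ _ (μ / 2) hMr.le er0 wr
  have nm := hK _ _ _ _ _ _ _ _ 0 zero_le_one le_rfl
    (isWeakProfile_const (conserved Um) (flux α Um) 1)
  have int : ∀ {W F : ℝ → ℝ × ℝ} {Wl Wr Fl Fr : ℝ × ℝ} {M e : ℝ} (x₀ : ℝ),
      IsWeakProfile W F Wl Wr Fl Fr M e → Integrable (fun p : ℝ × ℝ =>
        fderiv ℝ φ p (0, 1) • W ((p.1 - x₀) / p.2) + fderiv ℝ φ p (1, 0) • F ((p.1 - x₀) / p.2))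
        (volume.restrict {p : ℝ × ℝ | 0 < p.2}) := by
    intro W F Wl Wr Fl Fr M e x₀ h
    obtain ⟨C, hC⟩ := h.bounded
    have mq : Measurable fun p : ℝ × ℝ => (p.1 - x₀) / p.2 := by fun_prop
    exact ((integrable_smul_of_hasCompactSupport ct st (h.measurable.1.comp mq)
      fun p => (hC _).1).add (integrable_smul_of_hasCompactSupport cx sx (h.measurable.2.comp mq)
      fun p => (hC _).2)).restrict
  have intS : ∀ (a b : ℝ × ℝ) (x₀ : ℝ),
      Integrable fun x => φ (x, 0) • stepFun a b (x - x₀) := fun a b x₀ =>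
    integrable_slice hφ.continuous hc (H := fun x => stepFun a b (x - x₀))
      ((measurable_stepFun a b).comp (by fun_prop)) (fun x => norm_stepFun_le _ _ _) 0
  have e1 : ∀ p ∈ {p : ℝ × ℝ | 0 < p.2},
      fderiv ℝ φ p (0, 1) • conserved (gluedNet (initialData Ul Ur ξ μ v) μ Vl Vr ε p.1 p.2)
      + fderiv ℝ φ p (1, 0) • flux α (gluedNet (initialData Ul Ur ξ μ v) μ Vl Vr ε p.1 p.2) =
      (fderiv ℝ φ p (0, 1) • conserved (Vl ε ((p.1 - -(μ / 2)) / p.2))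
        + fderiv ℝ φ p (1, 0) • flux α (Vl ε ((p.1 - -(μ / 2)) / p.2)))
      + (fderiv ℝ φ p (0, 1) • conserved (Vr ε ((p.1 - μ / 2) / p.2))
        + fderiv ℝ φ p (1, 0) • flux α (Vr ε ((p.1 - μ / 2) / p.2)))
      - (fderiv ℝ φ p (0, 1) • conserved Um + fderiv ℝ φ p (1, 0) • flux α Um) := by
    intro p hp
    have hp : 0 < p.2 := hp
    by_cases hT : p ∈ tsupport φ
    · have h := hs hT
      simp only [mem_ofPred_eq] at h
      rw [lt_div_iff₀ (by positivity)] at h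
      have := mul_pos hp hMl
      have := mul_pos hp hMr
      have s : ∀ f : State → ℝ × ℝ, _ := fun f => superposition f (x := p.1) hp vl vr
        (by linarith) (by linarith : Mr * p.2 < μ / 2)
      simp only [gluedNet, if_neg hp.ne', sub_neg_eq_add]
      rw [s conserved, s (flux α)]
      module
    · rw [fderiv_of_notMem_tsupport (𝕜 := ℝ) hT]
      simp
  have e2 : ∀ x, φ (x, 0) • conserved (initialData Ul Ur ξ μ v x) =
      φ (x, 0) • stepFun (conserved Ul) (conserved Um) (x - -(μ / 2))
      + φ (x, 0) • stepFun (conserved Um) (conserved Ur) (x - μ / 2)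
      - φ (x, 0) • stepFun (conserved Um) (conserved Um) (x - 0) := by
    intro x
    rw [← smul_add, ← smul_sub]
    congr 1
    unfold initialData stepFun
    simp only [sub_neg, ite_self]
    split_ifs with h1 h2 <;> first | (exfalso; linarith) | simp [hUm]
  rw [setIntegral_congr_fun (measurableSet_lt measurable_const measurable_snd) e1,
    integral_add_sub (int _ wl) (int _ wr) (int 0 (isWeakProfile_const _ _ 1)),
    integral_congr_ae (ae_of_all _ e2), integral_add_sub (intS _ _ _) (intS _ _ _) (intS _ _ _)]
  refine le_trans (le_of_eq_of_le ?_ (norm_sub_le_of_le (norm_add_le_of_le nl nr) nm)) le_rfl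
  congr 1
  module

/-! ### Energy rates -/

/-- `U` consists of the nets `Vl` and `Vr`, for times below `T`. -/
def IsGlued (Ul Ur : State) (ξ μ v T : ℝ) (Vl Vr : ℝ → ℝ → State)
    (U : ℝ → ℝ → ℝ → State) : Prop :=
  ∀ᶠ ε in 𝓝[>] (0 : ℝ), ∀ x, U ε x 0 = initialData Ul Ur ξ μ v x ∧
    ∀ t ∈ Ioo 0 T, U ε x t = if x < 0 then Vl ε ((x + μ / 2) / t) else Vr ε ((x - μ / 2) / t)

lemma hasIntegralOn_initialData {α ξ μ v L : ℝ} {Ul Ur : State} (hμ : 0 < μ) (hL : μ / 2 < L) :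
    HasIntegralOn (fun x => energy α (initialData Ul Ur ξ μ v x)) (-L) L
      ((L - μ / 2) * (energy α Ul + energy α Ur) + μ * energy α (ξ / μ, v)) := by
  have i1 : HasIntegralOn (fun x => energy α (initialData Ul Ur ξ μ v x)) (-L) (-(μ / 2)) _ :=
    hasIntegralOn_const (c := energy α Ul) (by linarith) fun x hx => by
      rw [initialData, if_pos hx.2]
  have i2 : HasIntegralOn (fun x => energy α (initialData Ul Ur ξ μ v x)) (-(μ / 2)) (μ / 2) _ :=
    hasIntegralOn_const (c := energy α (ξ / μ, v)) (by linarith) fun x hx => by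
      rw [initialData, if_neg (not_lt.2 hx.1.le), if_pos hx.2]
  have i3 : HasIntegralOn (fun x => energy α (initialData Ul Ur ξ μ v x)) (μ / 2) L _ :=
    hasIntegralOn_const (c := energy α Ur) hL.le fun x hx => by
      rw [initialData, if_neg (by linarith [hx.1]), if_neg (not_lt.2 hx.1.le)]
  exact ((i1.trans i2).trans i3).eq (by ring)

lemma initialEnergy_sub {α ξ μ v v' L : ℝ} {Ul Ur : State} (hμ : 0 < μ) (hL : μ / 2 < L) :
    initialEnergy α L Ul Ur ξ μ v - initialEnergy α L Ul Ur ξ μ v' =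
      1 / 2 * ξ * (v ^ 2 - v' ^ 2) := by
  rw [initialEnergy, initialEnergy, (hasIntegralOn_initialData hμ hL).2,
    (hasIntegralOn_initialData hμ hL).2]
  simp only [energy]
  field_simp
  ring

lemma IsGlued.exists_hasIntegralOn {α ξ μ v T L : ℝ} {Ul Ur : State} {Vl Vr : ℝ → ℝ → State}
    {U : ℝ → ℝ → ℝ → State} {dl dr : ℝ → ℝ} (hμ : 0 < μ) (hL : μ / 2 < L) (hT : 0 < T)
    (hU : IsGlued Ul Ur ξ μ v T Vl Vr U) (hl : IsEnergyProfile α Ul (ξ / μ, v) Vl dl)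
    (hr : IsEnergyProfile α (ξ / μ, v) Ur Vr dr) :
    ∃ τ > 0, ∀ t ∈ Ioo 0 τ, ∀ᶠ ε in 𝓝[>] (0 : ℝ),
      HasIntegralOn (fun x => energy α (U ε x t)) (-L) L
        ((L - μ / 2) * (energy α Ul + energy α Ur) + μ * energy α (ξ / μ, v)
          + t * (energyFlux α Ul - energyFlux α Ur + (dl ε + dr ε))) := by
  obtain ⟨Ml, hMl, hl⟩ := hl
  obtain ⟨Mr, hMr, hr⟩ := hr
  have hL' : 0 < L - μ / 2 := by linarith
  refine ⟨min T (min (μ / 2) (L - μ / 2) / (Ml + Mr)), by positivity, fun t ht => ?_⟩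
  obtain ⟨ht0, ht⟩ := ht
  obtain ⟨h1, h2⟩ := lt_min_iff.1 ht
  rw [lt_div_iff₀ (by positivity), lt_min_iff] at h2
  obtain ⟨h2, h3⟩ := h2
  have q1 := mul_pos ht0 hMl
  have q2 := mul_pos ht0 hMr
  filter_upwards [hU, hl, hr] with ε hU hl hr
  have hx := fun x => (hU x).2 t ⟨ht0, h1⟩
  obtain ⟨l1, l2, l3⟩ := hl
  obtain ⟨r1, r2, r3⟩ := hr
  set f := fun x => energy α (U ε x t) with hf
  have i1 : HasIntegralOn f (-L) (-(μ / 2) + t * -Ml) _ :=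
    hasIntegralOn_const (c := energy α Ul) (by linarith) fun x hx' => by
      simp only [hf, hx]
      rw [if_pos (by linarith [hx'.2]), l1 _ (by rw [div_lt_iff₀ ht0]; linarith [hx'.2])]
  have i2 : HasIntegralOn f (-(μ / 2) + t * -Ml) (-(μ / 2) + t * Ml) _ :=
    (l3.scale (x₀ := -(μ / 2)) ht0).congr (by linarith) fun x hx' => by
      simp only [hf, hx]
      rw [if_pos (by linarith [hx'.2]), sub_neg_eq_add]
  have i3 : HasIntegralOn f (-(μ / 2) + t * Ml) (μ / 2 + t * -Mr) _ :=
    hasIntegralOn_const (c := energy α (ξ / μ, v)) (by linarith) fun x hx' => by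
      simp only [hf, hx]
      split_ifs with h
      · rw [l2 _ (by rw [lt_div_iff₀ ht0]; linarith [hx'.1])]
      · rw [r1 _ (by rw [div_lt_iff₀ ht0]; linarith [hx'.2])]
  have i4 : HasIntegralOn f (μ / 2 + t * -Mr) (μ / 2 + t * Mr) _ :=
    (r3.scale (x₀ := μ / 2) ht0).congr (by linarith) fun x hx' => by
      simp only [hf, hx]
      rw [if_neg (by linarith [hx'.1])]
  have i5 : HasIntegralOn f (μ / 2 + t * Mr) L _ :=
    hasIntegralOn_const (c := energy α Ur) (by linarith) fun x hx' => by
      simp only [hf, hx]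
      rw [if_neg (by linarith [hx'.1]), r2 _ (by rw [lt_div_iff₀ ht0]; linarith [hx'.1])]
  exact ((((i1.trans i2).trans i3).trans i4).trans i5).eq (by ring)

/-- The energy rate of a solution is the difference of the energy fluxes plus the limit of the
dissipation rates. -/
lemma IsGlued.hasEnergyRate_iff {α ξ μ v T L r : ℝ} {Ul Ur : State} {Vl Vr : ℝ → ℝ → State}
    {U : ℝ → ℝ → ℝ → State} {dl dr : ℝ → ℝ} (hμ : 0 < μ) (hL : μ / 2 < L) (hT : 0 < T)
    (hU : IsGlued Ul Ur ξ μ v T Vl Vr U) (hl : IsEnergyProfile α Ul (ξ / μ, v) Vl dl)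
    (hr : IsEnergyProfile α (ξ / μ, v) Ur Vr dr) :
    HasEnergyRate α L U r ↔ Tendsto (fun ε => dl ε + dr ε) (𝓝[>] 0)
      (𝓝 (r - (energyFlux α Ul - energyFlux α Ur))) := by
  obtain ⟨τ, hτ, key⟩ := hU.exists_hasIntegralOn hμ hL hT hl hr
  have zero : ∀ᶠ ε in 𝓝[>] (0 : ℝ), HasIntegralOn (fun x => energy α (U ε x 0)) (-L) L
      ((L - μ / 2) * (energy α Ul + energy α Ur) + μ * energy α (ξ / μ, v)) := by
    filter_upwards [hU] with ε hU
    simp only [fun x => (hU x).1]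
    exact hasIntegralOn_initialData hμ hL
  set E := (L - μ / 2) * (energy α Ul + energy α Ur) + μ * energy α (ξ / μ, v)
  set Q := energyFlux α Ul - energyFlux α Ur
  have hd : ∀ s, HasDerivWithinAt (fun t => E + t * (Q + s)) (Q + s) (Ici 0) 0 := fun s => by
    simpa using (((hasDerivAt_id (0 : ℝ)).mul_const (Q + s)).const_add E).hasDerivWithinAt
  have hτ' : Ico 0 τ ∈ 𝓝[≥] (0 : ℝ) := Ico_mem_nhdsGE hτ
  constructor
  · rintro ⟨H, hH, hder⟩
    have h0 : H 0 = E := by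
      have h := (hH.self_of_nhdsWithin self_mem_Ici).2
      refine tendsto_nhds_unique h (tendsto_const_nhds.congr' ?_)
      filter_upwards [zero] with ε hε using hε.2.symm
    have lim : ∀ t ∈ Ioo 0 τ, HasEnergy α L U t (H t) →
        Tendsto (fun ε => dl ε + dr ε) (𝓝[>] 0) (𝓝 ((H t - E) / t - Q)) := by
      intro t ht h
      have := ((h.2.sub_const E).div_const t).sub_const Q
      refine this.congr' ?_
      filter_upwards [key t ht] with ε hε
      rw [hε.2]
      have := ht.1.ne'
      field_simp
      ring
    obtain ⟨t₀, ht₀, hE₀⟩ : ∃ t ∈ Ioo 0 τ, HasEnergy α L U t (H t) := by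
      have h1 : ∀ᶠ t in 𝓝[>] (0 : ℝ), HasEnergy α L U t (H t) :=
        hH.filter_mono (nhdsWithin_mono _ Ioi_subset_Ici_self)
      have h2 : ∀ᶠ t in 𝓝[>] (0 : ℝ), t ∈ Ioo 0 τ := Ioo_mem_nhdsGT hτ
      exact (h2.and h1).exists
    have L₀ := lim t₀ ht₀ hE₀
    set s := (H t₀ - E) / t₀ - Q
    have hHs : H =ᶠ[𝓝[≥] 0] fun t => E + t * (Q + s) := by
      filter_upwards [hH, hτ'] with t h1 h2
      rcases h2.1.eq_or_lt with rfl | h3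
      · rw [h0]; ring
      · have := tendsto_nhds_unique L₀ (lim t ⟨h3, h2.2⟩ h1)
        rw [this]; field_simp; ring
    have h2 : HasDerivWithinAt (fun t => E + t * (Q + s)) r (Ici 0) 0 :=
      hder.congr_of_eventuallyEq hHs.symm (by rw [h0]; ring)
    rw [(uniqueDiffWithinAt_Ici (0 : ℝ)).eq_deriv _ h2 (hd s), add_sub_cancel_left]
    exact L₀
  · intro h
    refine ⟨fun t => E + t * (Q + (r - Q)), ?_, by simpa using hd (r - Q)⟩
    filter_upwards [hτ'] with t ht
    rcases ht.1.eq_or_lt with rfl | h3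
    · refine ⟨zero.mono fun ε hε => hε.1, tendsto_const_nhds.congr' ?_⟩
      filter_upwards [zero] with ε hε
      rw [hε.2]; ring
    · have k := key t ⟨h3, ht.2⟩
      refine ⟨k.mono fun ε hε => hε.1, (((h.const_add Q).const_mul t).const_add E).congr' ?_⟩
      filter_upwards [k] with ε hε using hε.2.symm

/-! ### Weak uniqueness -/

/-- The net of profiles `D` vanishes outside a bounded set and tends weakly to zero. -/
def IsWeaklyNull (D : ℝ → ℝ → ℝ × ℝ) : Prop :=
  ∃ M > 0, (∀ᶠ ε in 𝓝[>] (0 : ℝ), ∀ ζ, M < |ζ| → D ε ζ = 0) ∧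
    ∀ ψ : ℝ → ℝ, Continuous ψ → (∀ᶠ ε in 𝓝[>] (0 : ℝ), Integrable fun ζ => ψ ζ • D ε ζ) ∧
      Tendsto (fun ε => ∫ ζ, ψ ζ • D ε ζ) (𝓝[>] 0) (𝓝 0)

lemma integrable_selfSimilar {G : ℝ → ℝ × ℝ} {x₀ t : ℝ} (ht : 0 < t)
    (h : Integrable fun ζ => G (x₀ + t * ζ)) :
    Integrable G ∧ ∫ x, G x = t • ∫ ζ, G (x₀ + t * ζ) := by
  constructor
  · have := (h.comp_div ht.ne').comp_sub_right x₀
    refine this.congr (ae_of_all _ fun x => ?_)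
    simp only
    congr 1
    field_simp
    ring
  · rw [Measure.integral_comp_mul_left (fun y => G (x₀ + y)) t, integral_add_left_eq_self,
      smul_smul, abs_of_pos (inv_pos.2 ht), mul_inv_cancel₀ ht.ne', one_smul]

lemma IsGlued.weaklyEqual {ξ μ v T T' : ℝ} {Ul Ur : State} {Vl Vr Vl' Vr' : ℝ → ℝ → State}
    {U U' : ℝ → ℝ → ℝ → State} (hμ : 0 < μ) (hT : 0 < T) (hT' : 0 < T')
    (hU : IsGlued Ul Ur ξ μ v T Vl Vr U) (hU' : IsGlued Ul Ur ξ μ v T' Vl' Vr' U')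
    (hl : IsWeaklyNull fun ε ζ => conserved (Vl ε ζ) - conserved (Vl' ε ζ))
    (hr : IsWeaklyNull fun ε ζ => conserved (Vr ε ζ) - conserved (Vr' ε ζ)) :
    WeaklyEqual U U' := by
  obtain ⟨Ml, hMl, zl, hl⟩ := hl
  obtain ⟨Mr, hMr, zr, hr⟩ := hr
  refine ⟨min (min T T') (μ / 2 / (Ml + Mr)), by positivity, fun t ht ψ hψ _ => ?_⟩
  obtain ⟨ht0, ht⟩ := ht
  obtain ⟨h1, h2⟩ := lt_min_iff.1 ht
  rw [lt_div_iff₀ (by positivity)] at h2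
  have q1 := mul_pos ht0 hMl
  have q2 := mul_pos ht0 hMr
  obtain ⟨il, tl⟩ := hl (fun ζ => ψ (-(μ / 2) + t * ζ)) (by fun_prop)
  obtain ⟨ir, tr⟩ := hr (fun ζ => ψ (μ / 2 + t * ζ)) (by fun_prop)
  have lim := (tl.const_smul t).add (tr.const_smul t)
  rw [smul_zero, add_zero] at lim
  refine lim.congr' ?_
  filter_upwards [hU, hU', zl, zr, il, ir] with ε hU hU' zl zr il ir
  have e : ∀ x₀ ζ, (x₀ + t * ζ - x₀) / t = ζ := fun x₀ ζ => by field_simp; ring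
  obtain ⟨jl, el⟩ := integrable_selfSimilar (x₀ := -(μ / 2)) ht0 (G := fun x => ψ x •
    (conserved (Vl ε ((x - -(μ / 2)) / t)) - conserved (Vl' ε ((x - -(μ / 2)) / t))))
    (by simpa only [e] using il)
  obtain ⟨jr, er⟩ := integrable_selfSimilar (x₀ := μ / 2) ht0 (G := fun x => ψ x •
    (conserved (Vr ε ((x - μ / 2) / t)) - conserved (Vr' ε ((x - μ / 2) / t))))
    (by simpa only [e] using ir)
  simp only [e] at el er
  rw [← el, ← er, ← integral_add jl jr]
  refine integral_congr_ae (ae_of_all _ fun x => ?_)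
  simp only [(hU x).2 t ⟨ht0, h1.trans_le (min_le_left _ _)⟩,
    (hU' x).2 t ⟨ht0, h1.trans_le (min_le_right _ _)⟩, sub_neg_eq_add]
  rw [← smul_add]
  congr 1
  split_ifs with h
  · rw [zr ((x - μ / 2) / t) ?_, add_zero]
    rw [lt_abs]; right
    rw [lt_neg, div_lt_iff₀ ht0]; linarith
  · rw [zl ((x + μ / 2) / t) ?_, zero_add]
    rw [lt_abs]; left
    rw [lt_div_iff₀ ht0]; linarith

lemma norm_conserved_le {U : State} (h : 0 ≤ U.1) : ‖conserved U‖ ≤ U.1 + U.1 * U.2 ^ 2 := by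
  have h1 : |U.2| ≤ 1 + U.2 ^ 2 := by
    rw [← sq_abs]
    nlinarith [sq_nonneg (|U.2| - 1), abs_nonneg U.2]
  have h2 := mul_le_mul_of_nonneg_left h1 h
  have h3 := mul_nonneg h (sq_nonneg U.2)
  rw [conserved, Prod.norm_def, Real.norm_eq_abs, Real.norm_eq_abs, abs_mul, abs_of_nonneg h]
  exact max_le (by linarith) (by linarith)

lemma tendsto_average {ψ : ℝ → ℝ} (hψ : Continuous ψ) (c : ℝ) :
    Tendsto (fun ε => (ε / 2)⁻¹ * ∫ ζ in (c - ε / 2)..c, ψ ζ) (𝓝[>] 0) (𝓝 (ψ c)) ∧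
    Tendsto (fun ε => (ε / 2)⁻¹ * ∫ ζ in c..(c + ε / 2), ψ ζ) (𝓝[>] 0) (𝓝 (ψ c)) := by
  have hd : HasDerivAt (fun x => ∫ ζ in c..x, ψ ζ) (ψ c) c :=
    (hψ.integral_hasStrictDerivAt c c).hasDerivAt
  rw [hasDerivAt_iff_tendsto_slope_zero] at hd
  have h1 : Tendsto (fun ε : ℝ => ε / 2) (𝓝[>] 0) (𝓝[≠] 0) := by
    refine tendsto_nhdsWithin_iff.2 ⟨by simpa using tendsto_id_nhdsGT_zero.div_const 2, ?_⟩
    filter_upwards [self_mem_nhdsWithin] with ε (hε : 0 < ε)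
    exact (by positivity : ε / 2 ≠ 0)
  have h2 : Tendsto (fun ε : ℝ => -(ε / 2)) (𝓝[>] 0) (𝓝[≠] 0) := by
    refine tendsto_nhdsWithin_iff.2 ⟨by simpa using (tendsto_id_nhdsGT_zero.div_const 2).neg, ?_⟩
    filter_upwards [self_mem_nhdsWithin] with ε (hε : 0 < ε)
    exact neg_ne_zero.2 (by positivity : ε / 2 ≠ 0)
  constructor
  · refine (hd.comp h2).congr fun ε => ?_
    simp only [Function.comp_apply, intervalIntegral.integral_same, sub_zero, smul_eq_mul,
      ← sub_eq_add_neg]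
    rw [intervalIntegral.integral_symm, inv_neg, neg_mul_neg]
  · refine (hd.comp h1).congr fun ε => ?_
    simp only [Function.comp_apply, intervalIntegral.integral_same, sub_zero, smul_eq_mul]

section

variable {α : ℝ} (hα₀ : 0 < α)
include hα₀

/-- If the internal pressure vanishes, the conserved quantities of a shadow wave concentrate at
its front. -/
lemma IsShadowNet.tendsto_integral {Ul Ur : State} {V : ℝ → ℝ → State} {c : ℝ}
    {U₀ U₁ : ℝ → State} (h : IsShadowNet α Ul Ur V c U₀ U₁)
    (hP : Tendsto (internalPressure α U₀ U₁) (𝓝[>] 0) (𝓝 0)) {ψ : ℝ → ℝ} (hψ : Continuous ψ) :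
    ∃ I : ℝ → ℝ × ℝ, Tendsto I (𝓝[>] 0)
      (𝓝 (ψ c • (shadowMass Ul Ur c, c * shadowMass Ul Ur c))) ∧
      ∀ ε > 0, HasIntegralOn (fun ζ => ψ ζ • conserved (V ε ζ)) (c - ε / 2) (c + ε / 2) (I ε) := by
  obtain ⟨-, m1, m2, m3⟩ := h.limits hα₀
  obtain ⟨hpos, -, -, -, -, hV⟩ := h
  obtain ⟨a0, a1⟩ := tendsto_average hψ c
  set A₀ := fun ε => (ε / 2)⁻¹ * ∫ ζ in (c - ε / 2)..c, ψ ζ with hA₀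
  set A₁ := fun ε => (ε / 2)⁻¹ * ∫ ζ in c..(c + ε / 2), ψ ζ with hA₁
  refine ⟨fun ε => A₀ ε • (ε / 2) • conserved (U₀ ε) + A₁ ε • (ε / 2) • conserved (U₁ ε), ?_,
    fun ε hε => ?_⟩
  · have m12 := (m1.prodMk_nhds m2).const_smul (ψ c)
    have m4 := m3.add hP
    have bd := (m1.add m4).isBoundedUnder_le
    have b0 : IsBoundedUnder (· ≤ ·) (𝓝[>] 0) ((‖·‖) ∘ fun ε => (ε / 2) • conserved (U₀ ε)) := by
      refine bd.mono_le ?_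
      filter_upwards [self_mem_nhdsWithin] with ε (hε : 0 < ε)
      obtain ⟨p0, p1⟩ := hpos ε hε
      have n := norm_conserved_le p0.le
      have := mul_le_mul_of_nonneg_left n (by positivity : 0 ≤ ε / 2)
      have q : 0 ≤ ε / 2 * ((U₁ ε).1 + (U₁ ε).1 * (U₁ ε).2 ^ 2) := by positivity
      simp only [Function.comp_apply, norm_smul, Real.norm_eq_abs, abs_of_pos (half_pos hε)]
      linarith
    have b1 : IsBoundedUnder (· ≤ ·) (𝓝[>] 0) ((‖·‖) ∘ fun ε => (ε / 2) • conserved (U₁ ε)) := by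
      refine bd.mono_le ?_
      filter_upwards [self_mem_nhdsWithin] with ε (hε : 0 < ε)
      obtain ⟨p0, p1⟩ := hpos ε hε
      have n := norm_conserved_le p1.le
      have := mul_le_mul_of_nonneg_left n (by positivity : 0 ≤ ε / 2)
      have q : 0 ≤ ε / 2 * ((U₀ ε).1 + (U₀ ε).1 * (U₀ ε).2 ^ 2) := by positivity
      simp only [Function.comp_apply, norm_smul, Real.norm_eq_abs, abs_of_pos (half_pos hε)]
      linarith
    have d0 := (by simpa using a0.sub_const (ψ c) :
      Tendsto (fun ε => A₀ ε - ψ c) (𝓝[>] 0) (𝓝 0)).zero_smul_isBoundedUnder_le b0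
    have d1 := (by simpa using a1.sub_const (ψ c) :
      Tendsto (fun ε => A₁ ε - ψ c) (𝓝[>] 0) (𝓝 0)).zero_smul_isBoundedUnder_le b1
    have := (m12.add d0).add d1
    rw [add_zero, add_zero] at this
    refine this.congr fun ε => ?_
    have e : ((ε / 2 * ((U₀ ε).1 + (U₁ ε).1), ε / 2 * ((U₀ ε).1 * (U₀ ε).2
        + (U₁ ε).1 * (U₁ ε).2)) : ℝ × ℝ) = (ε / 2) • (conserved (U₀ ε) + conserved (U₁ ε)) := rfl
    rw [e]
    module
  · have key : ∀ (X : ℝ × ℝ) (a b : ℝ),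
        HasIntegralOn (fun ζ => ψ ζ • X) a b ((∫ ζ in a..b, ψ ζ) • X) := fun X a b =>
      ⟨Continuous.intervalIntegrable (by fun_prop) _ _, intervalIntegral.integral_smul_const _ _⟩
    have i1 := (key (conserved (U₀ ε)) (c - ε / 2) c).congr
      (f := fun ζ => ψ ζ • conserved (V ε ζ)) (by linarith) fun x hx => by
        rw [hV ε hε, if_neg (not_le.2 hx.1), if_pos hx.2]
    have i2 := (key (conserved (U₁ ε)) c (c + ε / 2)).congr
      (f := fun ζ => ψ ζ • conserved (V ε ζ)) (by linarith) fun x hx => by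
        rw [hV ε hε, if_neg (by linarith [hx.1]), if_neg (not_lt.2 hx.1.le), if_pos hx.2]
    refine (i1.trans i2).eq ?_
    simp only [hA₀, hA₁, smul_smul]
    congr 2 <;> field_simp

lemma IsShadowNet.isWeaklyNull_sub {Ul Ur : State} {V V' : ℝ → ℝ → State} {c : ℝ}
    {U₀ U₁ U₀' U₁' : ℝ → State} (h : IsShadowNet α Ul Ur V c U₀ U₁)
    (hP : Tendsto (internalPressure α U₀ U₁) (𝓝[>] 0) (𝓝 0))
    (h' : IsShadowNet α Ul Ur V' c U₀' U₁')
    (hP' : Tendsto (internalPressure α U₀' U₁') (𝓝[>] 0) (𝓝 0)) :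
    IsWeaklyNull fun ε ζ => conserved (V ε ζ) - conserved (V' ε ζ) := by
  have out : ∀ ε > 0, ∀ ζ, ζ ∉ Ioc (c - ε / 2) (c + ε / 2) →
      conserved (V ε ζ) - conserved (V' ε ζ) = 0 := by
    intro ε hε ζ hζ
    rw [h.2.2.2.2.2 ε hε, h'.2.2.2.2.2 ε hε]
    rcases le_or_gt ζ (c - ε / 2) with h1 | h1
    · rw [if_pos h1, if_pos h1, sub_self]
    · have h2 : c + ε / 2 < ζ := by by_contra hcon; exact hζ ⟨h1, not_lt.1 hcon⟩
      rw [if_neg (by linarith), if_neg (by linarith), if_neg (by linarith), if_neg (by linarith),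
        if_neg (by linarith), if_neg (by linarith), sub_self]
  refine ⟨|c| + 1, by positivity, ?_, fun ψ hψ => ?_⟩
  · filter_upwards [Ioo_mem_nhdsGT (zero_lt_one' ℝ)] with ε hε ζ hζ
    refine out ε hε.1 ζ fun hmem => ?_
    have h1 := hε.2
    have : |ζ| ≤ |c| + 1 := by
      rw [abs_le]
      have := le_abs_self c
      have := neg_abs_le c
      constructor <;> linarith [hmem.1, hmem.2]
    linarith
  · obtain ⟨I, tI, hI⟩ := h.tendsto_integral hα₀ hP hψ
    obtain ⟨I', tI', hI'⟩ := h'.tendsto_integral hα₀ hP' hψ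
    have key : ∀ ε > 0, Integrable (fun ζ => ψ ζ • (conserved (V ε ζ) - conserved (V' ε ζ))) ∧
        ∫ ζ, ψ ζ • (conserved (V ε ζ) - conserved (V' ε ζ)) = I ε - I' ε := by
      intro ε hε
      obtain ⟨i1, e1⟩ := hI ε hε
      obtain ⟨i2, e2⟩ := hI' ε hε
      have hle : c - ε / 2 ≤ c + ε / 2 := by linarith
      have i3 := i1.sub i2
      have o : ∀ ζ, ζ ∉ Ioc (c - ε / 2) (c + ε / 2) →
          ψ ζ • (conserved (V ε ζ) - conserved (V' ε ζ)) = 0 := fun ζ hζ => by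
        rw [out ε hε ζ hζ, smul_zero]
      have e3 := intervalIntegral.integral_sub i1 i2
      rw [e1, e2] at e3
      simp only [← smul_sub] at e3
      rw [intervalIntegrable_iff_integrableOn_Ioc_of_le hle] at i3
      refine ⟨IntegrableOn.integrable_of_forall_notMem_eq_zero (i3.congr_fun (fun ζ _ => ?_)
        measurableSet_Ioc) o, ?_⟩
      · simp [smul_sub]
      · rw [← e3, intervalIntegral.integral_of_le hle,
          setIntegral_eq_integral_of_forall_compl_eq_zero o]
    refine ⟨?_, ?_⟩
    · filter_upwards [self_mem_nhdsWithin] with ε hε using (key ε hε).1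
    · have := tI.sub tI'
      rw [sub_self] at this
      refine this.congr' ?_
      filter_upwards [self_mem_nhdsWithin] with ε hε using (key ε hε).2.symm

/-- Optimal solutions of a Riemann problem are weakly unique. -/
lemma IsRiemannDiss.isWeaklyNull_sub (hα₁ : α < 1) {Ul Ur : State} {V V' : ℝ → ℝ → State}
    {d d' : ℝ → ℝ} {D : ℝ} (hl : 0 < Ul.1) (hr : 0 < Ur.1) (hD : IsOptDiss α Ul Ur D)
    (h : IsRiemannDiss α Ul Ur V d) (hd : Tendsto d (𝓝[>] 0) (𝓝 D))
    (h' : IsRiemannDiss α Ul Ur V' d') (hd' : Tendsto d' (𝓝[>] 0) (𝓝 D)) :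
    IsWeaklyNull fun ε ζ => conserved (V ε ζ) - conserved (V' ε ζ) := by
  have shadow : ∀ {V d c U₀ U₁}, IsShadowNet α Ul Ur V c U₀ U₁ →
      Tendsto (fun ε => d ε - (1 / 2 + 1 / (1 + α)) * internalPressure α U₀ U₁ ε) (𝓝[>] 0)
        (𝓝 (shadowDiss α Ul Ur c)) → Tendsto d (𝓝[>] 0) (𝓝 D) → shadowDiss α Ul Ur c ≤ D ∧
        (shadowDiss α Ul Ur c = D → Tendsto (internalPressure α U₀ U₁) (𝓝[>] 0) (𝓝 0)) := by
    intro V d c U₀ U₁ hs ht hd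
    have hk : 0 < 1 / 2 + 1 / (1 + α) := by positivity
    have t := (hd.sub ht).const_mul (1 / 2 + 1 / (1 + α))⁻¹
    have t' : Tendsto (internalPressure α U₀ U₁) (𝓝[>] 0)
        (𝓝 ((1 / 2 + 1 / (1 + α))⁻¹ * (D - shadowDiss α Ul Ur c))) := by
      refine t.congr fun ε => ?_
      rw [sub_sub_cancel, inv_mul_cancel_left₀ hk.ne']
    constructor
    · have : 0 ≤ (1 / 2 + 1 / (1 + α))⁻¹ * (D - shadowDiss α Ul Ur c) := by
        refine ge_of_tendsto t' ?_
        filter_upwards [self_mem_nhdsWithin] with ε hε using internalPressure_nonneg hα₀ hs hε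
      by_contra hcon
      have := mul_neg_of_pos_of_neg (inv_pos.2 hk) (by linarith : D - shadowDiss α Ul Ur c < 0)
      linarith
    · intro e
      rwa [e, sub_self, mul_zero] at t'
  rcases hD with ⟨Um, a₁, b₁, a₂, b₂, w₁, w₂, hf, -, hsh⟩ | ⟨hn, c', hc', e'⟩
  · have fan : ∀ {V d}, IsRiemannDiss α Ul Ur V d → Tendsto d (𝓝[>] 0) (𝓝 D) → ∀ ε > 0, ∀ ζ,
        V ε ζ = fanProfile Ul Um Ur a₁ b₁ a₂ b₂ w₁ w₂ ζ := by
      intro V d h hd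
      rcases h.2 with ⟨_, _, _, _, _, _, _, hf', hV, -⟩ | ⟨c, U₀, U₁, hs, ht⟩
      · intro ε hε ζ
        rw [hV ε hε, (hf.unique hα₀ hα₁ hl hr hf').2]
      · exact absurd (hsh c (hs.limits hα₀).1) (not_lt.2 (shadow hs ht hd).1)
    have z : ∀ ε > 0, ∀ ζ, conserved (V ε ζ) - conserved (V' ε ζ) = 0 := fun ε hε ζ => by
      rw [fan h hd ε hε, fan h' hd' ε hε, sub_self]
    refine ⟨1, one_pos, ?_, fun ψ _ => ⟨?_, tendsto_const_nhds.congr' ?_⟩⟩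
    · filter_upwards [self_mem_nhdsWithin] with ε hε ζ _ using z ε hε ζ
    · filter_upwards [self_mem_nhdsWithin] with ε hε
      simp [z ε hε]
    · filter_upwards [self_mem_nhdsWithin] with ε hε
      simp [z ε hε]
  · have spec : ∀ {V d}, IsRiemannDiss α Ul Ur V d → Tendsto d (𝓝[>] 0) (𝓝 D) →
        ∃ U₀ U₁, IsShadowNet α Ul Ur V c' U₀ U₁ ∧
          Tendsto (internalPressure α U₀ U₁) (𝓝[>] 0) (𝓝 0) := by
      intro V d h hd
      rcases h.2 with ⟨_, _, _, _, _, _, _, hf', -, -⟩ | ⟨c, U₀, U₁, hs, ht⟩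
      · exact absurd ⟨_, _, _, _, _, _, _, hf'⟩ hn
      · obtain rfl := hc'.unique hα₀ hl hr (hs.limits hα₀).1
        exact ⟨U₀, U₁, hs, (shadow hs ht hd).2 e'.symm⟩
    obtain ⟨U₀, U₁, s1, p1⟩ := spec h hd
    obtain ⟨U₀', U₁', s2, p2⟩ := spec h' hd'
    exact s1.isWeaklyNull_sub hα₀ p1 s2 p2

end

/-! ### Admissible solutions for fixed `μ` -/

/-- The least total dissipation rate of the regularized problem. -/
def IsOptTotal (α : ℝ) (Ul Ur : State) (ξ v μ S : ℝ) : Prop :=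
  ∃ Dl Dr, IsOptDiss α Ul (ξ / μ, v) Dl ∧ IsOptDiss α (ξ / μ, v) Ur Dr ∧ S = Dl + Dr

lemma IsSolution.exists_glued {α ξ μ v : ℝ} {Ul Ur : State} {U : ℝ → ℝ → ℝ → State}
    (h : IsSolution α Ul Ur ξ μ v U) : ∃ T > 0, ∃ Vl Vr, IsRiemannSolution α Ul (ξ / μ, v) Vl ∧
      IsRiemannSolution α (ξ / μ, v) Ur Vr ∧ IsGlued Ul Ur ξ μ v T Vl Vr U := by
  obtain ⟨T, hT, -, Vl, Vr, h1, h2, h3⟩ := h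
  exact ⟨T, hT, Vl, Vr, h1, h2, h3⟩

section

variable {α : ℝ} (hα₀ : 0 < α) (hα₁ : α < 1) {Ul Ur : State} (hl : 0 < Ul.1) (hr : 0 < Ur.1)
include hα₀ hα₁ hl hr

lemma IsOptDiss.exists_net {D : ℝ} (h : IsOptDiss α Ul Ur D) :
    ∃ V d, IsRiemannSolution α Ul Ur V ∧ IsWeakNet α Ul Ur V ∧ IsEnergyProfile α Ul Ur V d ∧
      Tendsto d (𝓝[>] 0) (𝓝 D) := by
  rcases h with ⟨Um, a₁, b₁, a₂, b₂, w₁, w₂, hf, rfl, -⟩ | ⟨-, c, hc, rfl⟩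
  · exact ⟨_, _, Or.inl ⟨Um, a₁, b₁, a₂, b₂, w₁, w₂, hf.1, hf.2.1, hf.2.2.1, hf.2.2.2,
      fun _ _ _ => rfl⟩, hf.isWeakNet hα₀ hα₁ hl hr,
      hf.isEnergyProfile hα₀ hα₁ hl hr fun _ _ _ => rfl, tendsto_const_nhds⟩
  · have hs := isShadowNet_shadowNet hα₀ hl hr hc
    obtain ⟨d, hd, ht⟩ := hs.isEnergyProfile hα₀ hα₁
    refine ⟨_, d, Or.inr ⟨c, _, _, hs⟩, isWeakNet_shadowNet hα₀ hl hr hc, hd, ?_⟩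
    have := ht.add ((tendsto_internalPressure_shadowState hα₀ hl hr hc).const_mul
      (1 / 2 + 1 / (1 + α)))
    rw [mul_zero, add_zero] at this
    refine this.congr fun ε => ?_
    unfold internalPressure
    ring

variable {ξ μ v S : ℝ} (hξ : 0 < ξ) (hμ : 0 < μ) (hS : IsOptTotal α Ul Ur ξ v μ S)
include hξ hμ hS

lemma IsOptTotal.exists_solution : ∃ U, IsSolution α Ul Ur ξ μ v U ∧
    ∀ L, μ / 2 < L → HasEnergyRate α L U (energyFlux α Ul - energyFlux α Ur + S) := by
  obtain ⟨Dl, Dr, hDl, hDr, rfl⟩ := hS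
  have hm : 0 < ((ξ / μ, v) : State).1 := div_pos hξ hμ
  obtain ⟨Vl, dl, l1, l2, l3, l4⟩ := hDl.exists_net hα₀ hα₁ hl hm
  obtain ⟨Vr, dr, r1, r2, r3, r4⟩ := hDr.exists_net hα₀ hα₁ hm hr
  obtain ⟨T, hT, hU⟩ := exists_isApproxWeakSolution hμ l2 r2
  have hg : IsGlued Ul Ur ξ μ v T Vl Vr (gluedNet (initialData Ul Ur ξ μ v) μ Vl Vr) :=
    Eventually.of_forall fun ε x => ⟨if_pos rfl, fun t ht => if_neg ht.1.ne'⟩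
  refine ⟨_, ⟨T, hT, hU, Vl, Vr, l1, r1, hg⟩, fun L hL => ?_⟩
  rw [hg.hasEnergyRate_iff hμ hL hT l3 r3, add_sub_cancel_left]
  exact l4.add r4

lemma IsOptTotal.le_rate {U : ℝ → ℝ → ℝ → State} {L r : ℝ} (hL : μ / 2 < L)
    (hU : IsSolution α Ul Ur ξ μ v U) (h : HasEnergyRate α L U r) :
    energyFlux α Ul - energyFlux α Ur + S ≤ r := by
  obtain ⟨Dl, Dr, hDl, hDr, rfl⟩ := hS
  have hm : 0 < ((ξ / μ, v) : State).1 := div_pos hξ hμ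
  obtain ⟨T, hT, Vl, Vr, h1, h2, hg⟩ := hU.exists_glued
  obtain ⟨dl, hdl⟩ := h1.exists_diss hα₀ hα₁ hl hm
  obtain ⟨dr, hdr⟩ := h2.exists_diss hα₀ hα₁ hm hr
  rw [hg.hasEnergyRate_iff hμ hL hT hdl.1 hdr.1] at h
  refine le_of_forall_pos_le_add fun δ hδ => ?_
  have := ge_of_tendsto h (b := Dl + Dr - δ) (by
    filter_upwards [hdl.eventually_ge hα₀ hα₁ hl hm hDl (half_pos hδ),
      hdr.eventually_ge hα₀ hα₁ hm hr hDr (half_pos hδ)] with ε e1 e2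
    linarith)
  linarith

lemma IsOptTotal.weaklyEqual {U U' : ℝ → ℝ → ℝ → State} {L : ℝ} (hL : μ / 2 < L)
    (hU : IsSolution α Ul Ur ξ μ v U)
    (h : HasEnergyRate α L U (energyFlux α Ul - energyFlux α Ur + S))
    (hU' : IsSolution α Ul Ur ξ μ v U')
    (h' : HasEnergyRate α L U' (energyFlux α Ul - energyFlux α Ur + S)) : WeaklyEqual U U' := by
  obtain ⟨Dl, Dr, hDl, hDr, rfl⟩ := hS
  have hm : 0 < ((ξ / μ, v) : State).1 := div_pos hξ hμ
  have key : ∀ U, IsSolution α Ul Ur ξ μ v U →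
      HasEnergyRate α L U (energyFlux α Ul - energyFlux α Ur + (Dl + Dr)) →
      ∃ T > 0, ∃ Vl Vr dl dr, IsGlued Ul Ur ξ μ v T Vl Vr U ∧
        IsRiemannDiss α Ul (ξ / μ, v) Vl dl ∧ IsRiemannDiss α (ξ / μ, v) Ur Vr dr ∧
        Tendsto dl (𝓝[>] 0) (𝓝 Dl) ∧ Tendsto dr (𝓝[>] 0) (𝓝 Dr) := by
    intro U hU h
    obtain ⟨T, hT, Vl, Vr, h1, h2, hg⟩ := hU.exists_glued
    obtain ⟨dl, hdl⟩ := h1.exists_diss hα₀ hα₁ hl hm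
    obtain ⟨dr, hdr⟩ := h2.exists_diss hα₀ hα₁ hm hr
    rw [hg.hasEnergyRate_iff hμ hL hT hdl.1 hdr.1, add_sub_cancel_left] at h
    refine ⟨T, hT, Vl, Vr, dl, dr, hg, hdl, hdr, ?_, ?_⟩
    all_goals
      rw [Metric.tendsto_nhds] at h ⊢
      intro δ hδ
      filter_upwards [h (δ / 2) (half_pos hδ),
        hdl.eventually_ge hα₀ hα₁ hl hm hDl (half_pos hδ),
        hdr.eventually_ge hα₀ hα₁ hm hr hDr (half_pos hδ)] with ε e1 e2 e3
      rw [Real.dist_eq, abs_lt] at e1 ⊢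
      constructor <;> linarith
  obtain ⟨T, hT, Vl, Vr, dl, dr, hg, k1, k2, k3, k4⟩ := key U hU h
  obtain ⟨T', hT', Vl', Vr', dl', dr', hg', k1', k2', k3', k4'⟩ := key U' hU' h'
  exact hg.weaklyEqual hμ hT hT' hg' (k1.isWeaklyNull_sub hα₀ hα₁ hl hm hDl k3 k1' k3')
    (k2.isWeaklyNull_sub hα₀ hα₁ hm hr hDr k4 k2' k4')

lemma IsOptTotal.rate_eq {U : ℝ → ℝ → ℝ → State} {L r : ℝ} (hL : μ / 2 < L)
    (hU : IsAdmissible α L Ul Ur ξ μ v U) (h : HasEnergyRate α L U r) :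
    r = energyFlux α Ul - energyFlux α Ur + S := by
  have hm : 0 < ((ξ / μ, v) : State).1 := div_pos hξ hμ
  obtain ⟨hU, r₀, h₀, hmin⟩ := hU
  obtain ⟨U₁, hU₁, h₁⟩ := hS.exists_solution hα₀ hα₁ hl hr hξ hμ
  have e1 := hmin U₁ _ hU₁ (h₁ L hL)
  have e2 := hS.le_rate hα₀ hα₁ hl hr hξ hμ hL hU h₀
  obtain ⟨T, hT, Vl, Vr, g1, g2, hg⟩ := hU.exists_glued
  obtain ⟨dl, hdl⟩ := g1.exists_diss hα₀ hα₁ hl hm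
  obtain ⟨dr, hdr⟩ := g2.exists_diss hα₀ hα₁ hm hr
  rw [hg.hasEnergyRate_iff hμ hL hT hdl.1 hdr.1] at h h₀
  have := tendsto_nhds_unique h h₀
  linarith

lemma IsOptTotal.hasEnergyRate {U : ℝ → ℝ → ℝ → State} {L : ℝ} (hL : μ / 2 < L)
    (hU : IsAdmissible α L Ul Ur ξ μ v U) :
    HasEnergyRate α L U (energyFlux α Ul - energyFlux α Ur + S) := by
  obtain ⟨r, h, -⟩ := hU.2
  rwa [← hS.rate_eq hα₀ hα₁ hl hr hξ hμ hL hU h]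

lemma IsOptTotal.exists_isAdmissible :
    ∃ U, ∀ L, μ / 2 < L → IsAdmissible α L Ul Ur ξ μ v U := by
  obtain ⟨U, hU, h⟩ := hS.exists_solution hα₀ hα₁ hl hr hξ hμ
  exact ⟨U, fun L hL => ⟨hU, _, h L hL, fun V r' hV h' =>
    hS.le_rate hα₀ hα₁ hl hr hξ hμ hL hV h'⟩⟩

end

/-! ### The backward energy condition -/

/-- The limit, as `μ → 0`, of the least total dissipation rate. -/
def totalDiss (α ρ₀ u₀ ρ₁ u₁ v : ℝ) : ℝ :=
  limitDiss α ρ₀ u₀ v + limitDiss α ρ₁ (-u₁) (-v)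

lemma A₂_neg (α ρ u : ℝ) : A₂ α ρ (-u) = -B₁ α ρ u := by unfold A₂ B₁; ring

section

variable {α : ℝ} (hα₀ : 0 < α) (hα₁ : α < 1)
include hα₀ hα₁

lemma strictMonoOn_limitDiss {ρ : ℝ} (hρ : 0 < ρ) (u : ℝ) :
    StrictMonoOn (limitDiss α ρ u) (Iic (A₂ α ρ u)) := by
  intro x hx y hy hxy
  have hx0 : limitDiss α ρ u x < 0 := limitDiss_neg hα₀ hα₁ hρ (hxy.trans_le hy)
  have hA := limitDiss_eq_zero hα₀ hα₁ hρ (le_refl (A₂ α ρ u))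
  rcases (mem_Iic.1 hy).eq_or_lt with rfl | h
  · rwa [hA]
  · set A := A₂ α ρ u
    have hxA : 0 < A - x := by linarith
    have := (strictConcaveOn_limitDiss hα₀ hα₁ hρ u).2 hx self_mem_Iic (hxy.trans h).ne
      (div_pos (by linarith) hxA : 0 < (A - y) / (A - x))
      (div_pos (by linarith) hxA : 0 < (y - x) / (A - x)) (by field_simp; ring)
    rw [hA, smul_zero, add_zero, smul_eq_mul, smul_eq_mul, smul_eq_mul,
      show (A - y) / (A - x) * x + (y - x) / (A - x) * A = y by field_simp; ring] at this
    have h1 : (A - y) / (A - x) ≤ 1 := by rw [div_le_one hxA]; linarith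
    nlinarith

lemma limitDiss_nonpos {ρ : ℝ} (hρ : 0 < ρ) (u v : ℝ) : limitDiss α ρ u v ≤ 0 := by
  rcases lt_or_ge v (A₂ α ρ u) with h | h
  · exact (limitDiss_neg hα₀ hα₁ hρ h).le
  · exact (limitDiss_eq_zero hα₀ hα₁ hρ h).le

variable {ρ₀ u₀ ρ₁ u₁ ξ : ℝ} (hρ₀ : 0 < ρ₀) (hρ₁ : 0 < ρ₁)
include hρ₀ hρ₁

lemma eventually_isOptTotal (hξ : 0 < ξ) (v : ℝ) {δ : ℝ} (hδ : 0 < δ) :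
    ∀ᶠ μ in 𝓝[>] (0 : ℝ), ∃ S, IsOptTotal α (ρ₀, u₀) (ρ₁, u₁) ξ v μ S ∧
      |S - totalDiss α ρ₀ u₀ ρ₁ u₁ v| < δ ∧
      (A₂ α ρ₀ u₀ ≤ v → v ≤ B₁ α ρ₁ u₁ → S = 0) := by
  have hR : Tendsto (fun μ : ℝ => ξ / μ) (𝓝[>] 0) atTop := by
    simpa only [div_eq_mul_inv] using tendsto_inv_nhdsGT_zero.const_mul_atTop hξ
  filter_upwards [hR.eventually (eventually_isOptDiss hα₀ hα₁ (u := u₀) hρ₀ v (half_pos hδ)),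
    hR.eventually (eventually_isOptDiss hα₀ hα₁ (u := -u₁) hρ₁ (-v) (half_pos hδ))]
    with μ ⟨Dl, l1, l2, l3⟩ ⟨Dr, r1, r2, r3⟩
  refine ⟨Dl + Dr, ⟨Dl, Dr, l1, ?_, rfl⟩, ?_, fun h1 h2 => ?_⟩
  · simpa [refl] using r1.refl
  · rw [abs_lt] at l2 r2 ⊢
    unfold totalDiss
    constructor <;> linarith
  · have h3 : A₂ α ρ₁ (-u₁) ≤ -v := by rw [A₂_neg]; linarith
    rw [l3 h1, r3 h3, add_zero]

lemma exists_isAdmissibleFamily (hξ : 0 < ξ) (v : ℝ) :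
    ∃ U, ∀ L > 0, IsAdmissibleFamily α L (ρ₀, u₀) (ρ₁, u₁) ξ v U := by
  have h : ∀ᶠ μ in 𝓝[>] (0 : ℝ), ∃ U, ∀ L, μ / 2 < L →
      IsAdmissible α L (ρ₀, u₀) (ρ₁, u₁) ξ μ v U := by
    filter_upwards [eventually_isOptTotal hα₀ hα₁ (u₀ := u₀) (u₁ := u₁) hρ₀ hρ₁ hξ v one_pos,
      self_mem_nhdsWithin] with μ ⟨S, hS, _⟩ hμ
    exact hS.exists_isAdmissible hα₀ hα₁ hρ₀ hρ₁ hξ hμ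
  obtain ⟨U, hU⟩ := h.choice
  refine ⟨U, fun L hL => ?_⟩
  filter_upwards [hU, Ioo_mem_nhdsGT hL] with μ h1 h2
  exact h1 L (by linarith [h2.1, h2.2])

omit hα₀ hα₁ hρ₀ hρ₁ in
lemma eventually_half_lt {L : ℝ} (hL : 0 < L) : ∀ᶠ μ in 𝓝[>] (0 : ℝ), 0 < μ ∧ μ / 2 < L := by
  filter_upwards [Ioo_mem_nhdsGT hL] with μ h
  exact ⟨h.1, by linarith [h.1, h.2]⟩

/-- Solutions of minimal dissipation correspond to maximizers of the limit dissipation. -/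
lemma HasMinimalDissipation.totalDiss_le (hξ : 0 < ξ) {L v : ℝ} (hL : 0 < L)
    {U : ℝ → ℝ → ℝ → ℝ → State} (h : HasMinimalDissipation α L (ρ₀, u₀) (ρ₁, u₁) ξ v U) (v' : ℝ) :
    totalDiss α ρ₀ u₀ ρ₁ u₁ v' ≤ totalDiss α ρ₀ u₀ ρ₁ u₁ v := by
  obtain ⟨U', hU'⟩ := exists_isAdmissibleFamily hα₀ hα₁ (u₀ := u₀) (u₁ := u₁) hρ₀ hρ₁ hξ v'
  refine le_of_forall_pos_le_add fun δ hδ => ?_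
  obtain ⟨μ, ⟨hμ, hμL⟩, ⟨S, hS, e1, -⟩, ⟨S', hS', e2, -⟩, a1, a2, a3⟩ :=
    ((eventually_half_lt hL).and
      ((eventually_isOptTotal hα₀ hα₁ (u₀ := u₀) (u₁ := u₁) hρ₀ hρ₁ hξ v (half_pos hδ)).and
      ((eventually_isOptTotal hα₀ hα₁ (u₀ := u₀) (u₁ := u₁) hρ₀ hρ₁ hξ v' (half_pos hδ)).and
      (h.1.and ((hU' L hL).and (h.2 v' U' (hU' L hL))))))).exists
  have := a3 _ _ (hS.hasEnergyRate hα₀ hα₁ hρ₀ hρ₁ hξ hμ hμL a1)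
    (hS'.hasEnergyRate hα₀ hα₁ hρ₀ hρ₁ hξ hμ hμL a2)
  rw [abs_lt] at e1 e2
  linarith

lemma hasMinimalDissipation (hξ : 0 < ξ) {L v : ℝ} (hL : 0 < L) {U : ℝ → ℝ → ℝ → ℝ → State}
    (hU : IsAdmissibleFamily α L (ρ₀, u₀) (ρ₁, u₁) ξ v U)
    (h : ∀ v', totalDiss α ρ₀ u₀ ρ₁ u₁ v' < totalDiss α ρ₀ u₀ ρ₁ u₁ v ∨ v' = v ∨
      (A₂ α ρ₀ u₀ ≤ v' ∧ v' ≤ B₁ α ρ₁ u₁ ∧ A₂ α ρ₀ u₀ ≤ v ∧ v ≤ B₁ α ρ₁ u₁)) :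
    HasMinimalDissipation α L (ρ₀, u₀) (ρ₁, u₁) ξ v U := by
  refine ⟨hU, fun v' U' hU' => ?_⟩
  suffices H : ∀ᶠ μ in 𝓝[>] (0 : ℝ), ∃ S S', IsOptTotal α (ρ₀, u₀) (ρ₁, u₁) ξ v μ S ∧
      IsOptTotal α (ρ₀, u₀) (ρ₁, u₁) ξ v' μ S' ∧ S' ≤ S by
    filter_upwards [H, hU, hU', eventually_half_lt hL] with μ ⟨S, S', hS, hS', hle⟩ a1 a2
      ⟨hμ, hμL⟩ r r' hr hr'
    rw [hS.rate_eq hα₀ hα₁ hρ₀ hρ₁ hξ hμ hμL a1 hr,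
      hS'.rate_eq hα₀ hα₁ hρ₀ hρ₁ hξ hμ hμL a2 hr']
    linarith
  have ev := fun v {δ : ℝ} => eventually_isOptTotal hα₀ hα₁ (u₀ := u₀) (u₁ := u₁) hρ₀ hρ₁ hξ v (δ := δ)
  rcases h v' with h | rfl | ⟨h1, h2, h3, h4⟩
  · have hδ := half_pos (sub_pos.2 h)
    filter_upwards [ev v hδ, ev v' hδ] with μ ⟨S, hS, e1, _⟩ ⟨S', hS', e2, _⟩
    rw [abs_lt] at e1 e2
    exact ⟨S, S', hS, hS', by linarith⟩
  · filter_upwards [ev v' one_pos] with μ ⟨S, hS, _⟩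
    exact ⟨S, S, hS, hS, le_rfl⟩
  · filter_upwards [ev v one_pos, ev v' one_pos] with μ ⟨S, hS, _, e1⟩ ⟨S', hS', _, e2⟩
    exact ⟨S, S', hS, hS', by rw [e1 h3 h4, e2 h1 h2]⟩

/-- Two admissible families corresponding to the same value are weakly equal. -/
lemma IsAdmissibleFamily.eventually_weaklyEqual (hξ : 0 < ξ) {L v : ℝ} (hL : 0 < L)
    {U V : ℝ → ℝ → ℝ → ℝ → State} (hU : IsAdmissibleFamily α L (ρ₀, u₀) (ρ₁, u₁) ξ v U)
    (hV : IsAdmissibleFamily α L (ρ₀, u₀) (ρ₁, u₁) ξ v V) :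
    ∀ᶠ μ in 𝓝[>] (0 : ℝ), WeaklyEqual (U μ) (V μ) := by
  filter_upwards [hU, hV, eventually_half_lt hL,
    eventually_isOptTotal hα₀ hα₁ (u₀ := u₀) (u₁ := u₁) hρ₀ hρ₁ hξ v one_pos]
    with μ a1 a2 ⟨hμ, hμL⟩ ⟨S, hS, _⟩
  exact hS.weaklyEqual hα₀ hα₁ hρ₀ hρ₁ hξ hμ hμL a1.1
    (hS.hasEnergyRate hα₀ hα₁ hρ₀ hρ₁ hξ hμ hμL a1) a2.1
    (hS.hasEnergyRate hα₀ hα₁ hρ₀ hρ₁ hξ hμ hμL a2)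

/-- A value of least modulus among the maximizers of the limit dissipation is the one selected by
the backward energy condition. -/
lemma backwardEnergyCondition_of_isLeast (hξ : 0 < ξ) {M : Set ℝ} {uδ : ℝ} (hu : uδ ∈ M)
    (hM : ∀ v ∈ M, ∀ v', totalDiss α ρ₀ u₀ ρ₁ u₁ v' < totalDiss α ρ₀ u₀ ρ₁ u₁ v ∨ v' = v ∨
      (A₂ α ρ₀ u₀ ≤ v' ∧ v' ≤ B₁ α ρ₁ u₁ ∧ A₂ α ρ₀ u₀ ≤ v ∧ v ≤ B₁ α ρ₁ u₁))
    (hM' : ∀ v ∉ M, totalDiss α ρ₀ u₀ ρ₁ u₁ v < totalDiss α ρ₀ u₀ ρ₁ u₁ uδ)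
    (hmin : ∀ v ∈ M, v ≠ uδ → uδ ^ 2 < v ^ 2) :
    (∃ U, ∀ L > 0, BackwardEnergyCondition α L (ρ₀, u₀) (ρ₁, u₁) ξ uδ U) ∧
      ∀ L > 0, ∀ v V, BackwardEnergyCondition α L (ρ₀, u₀) (ρ₁, u₁) ξ v V → v = uδ ∧
        ∀ U, BackwardEnergyCondition α L (ρ₀, u₀) (ρ₁, u₁) ξ uδ U →
          ∀ᶠ μ in 𝓝[>] (0 : ℝ), WeaklyEqual (U μ) (V μ) := by
  have mem : ∀ {L v V}, 0 < L → HasMinimalDissipation α L (ρ₀, u₀) (ρ₁, u₁) ξ v V → v ∈ M := by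
    intro L v V hL h
    by_contra hv
    exact absurd (h.totalDiss_le hα₀ hα₁ hρ₀ hρ₁ hξ hL uδ) (not_le.2 (hM' v hv))
  obtain ⟨U₀, hU₀⟩ := exists_isAdmissibleFamily hα₀ hα₁ (u₀ := u₀) (u₁ := u₁) hρ₀ hρ₁ hξ uδ
  have hmd : ∀ L > 0, HasMinimalDissipation α L (ρ₀, u₀) (ρ₁, u₁) ξ uδ U₀ := fun L hL =>
    hasMinimalDissipation hα₀ hα₁ hρ₀ hρ₁ hξ hL (hU₀ L hL) (hM uδ hu)
  refine ⟨⟨U₀, fun L hL => ⟨hmd L hL, fun v' U' h' => ?_⟩⟩, fun L hL v V hV => ?_⟩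
  · have h1 : uδ ^ 2 ≤ v' ^ 2 := by
      rcases eq_or_ne v' uδ with rfl | hne
      · exact le_rfl
      · exact (hmin v' (mem hL h') hne).le
    filter_upwards [eventually_half_lt hL] with μ ⟨hμ, hμL⟩
    have := initialEnergy_sub (α := α) (ξ := ξ) (v := uδ) (v' := v') (Ul := (ρ₀, u₀))
      (Ur := (ρ₁, u₁)) hμ hμL
    have : 1 / 2 * ξ * (uδ ^ 2 - v' ^ 2) ≤ 0 :=
      mul_nonpos_of_nonneg_of_nonpos (by positivity) (by linarith)
    linarith
  · have hv : v = uδ := by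
      by_contra hne
      obtain ⟨μ, ⟨hμ, hμL⟩, h2⟩ := ((eventually_half_lt hL).and (hV.2 uδ U₀ (hmd L hL))).exists
      have h3 := initialEnergy_sub (α := α) (ξ := ξ) (v := v) (v' := uδ) (Ul := (ρ₀, u₀))
        (Ur := (ρ₁, u₁)) hμ hμL
      have h4 : 0 < 1 / 2 * ξ * (v ^ 2 - uδ ^ 2) :=
        mul_pos (by positivity) (sub_pos.2 (hmin v (mem hL hV.1) hne))
      linarith
    subst hv
    exact ⟨rfl, fun U hU => hU.1.1.eventually_weaklyEqual hα₀ hα₁ hρ₀ hρ₁ hξ hL hV.1.1⟩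

lemma totalDiss_eq_zero {v : ℝ} (h1 : A₂ α ρ₀ u₀ ≤ v) (h2 : v ≤ B₁ α ρ₁ u₁) :
    totalDiss α ρ₀ u₀ ρ₁ u₁ v = 0 := by
  rw [totalDiss, limitDiss_eq_zero hα₀ hα₁ hρ₀ h1,
    limitDiss_eq_zero hα₀ hα₁ hρ₁ (by rw [A₂_neg]; linarith), add_zero]

lemma totalDiss_neg {v : ℝ} (h : ¬(A₂ α ρ₀ u₀ ≤ v ∧ v ≤ B₁ α ρ₁ u₁)) :
    totalDiss α ρ₀ u₀ ρ₁ u₁ v < 0 := by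
  rcases lt_or_ge v (A₂ α ρ₀ u₀) with h1 | h1
  · exact add_neg_of_neg_of_nonpos (limitDiss_neg hα₀ hα₁ hρ₀ h1)
      (limitDiss_nonpos hα₀ hα₁ hρ₁ _ _)
  · have h2 : B₁ α ρ₁ u₁ < v := by by_contra hcon; exact h ⟨h1, not_lt.1 hcon⟩
    exact add_neg_of_nonpos_of_neg (limitDiss_nonpos hα₀ hα₁ hρ₀ _ _)
      (limitDiss_neg hα₀ hα₁ hρ₁ (by rw [A₂_neg]; linarith))

/-- If `B₁ < A₂`, the limit dissipation has a unique maximizer, between `B₁` and `A₂`. -/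
lemma exists_unique_maximizer (h : B₁ α ρ₁ u₁ < A₂ α ρ₀ u₀) :
    ∃ u ∈ Icc (B₁ α ρ₁ u₁) (A₂ α ρ₀ u₀), ∀ v ≠ u,
      totalDiss α ρ₀ u₀ ρ₁ u₁ v < totalDiss α ρ₀ u₀ ρ₁ u₁ u := by
  set A := A₂ α ρ₀ u₀ with hA
  set B := B₁ α ρ₁ u₁ with hB
  have hB' : A₂ α ρ₁ (-u₁) = -B := A₂_neg _ _ _
  have hc : Continuous (totalDiss α ρ₀ u₀ ρ₁ u₁) :=
    (continuous_limitDiss hα₀ hα₁ ρ₀ u₀).add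
      ((continuous_limitDiss hα₀ hα₁ ρ₁ (-u₁)).comp continuous_neg)
  obtain ⟨u, hu, hmax⟩ := isCompact_Icc.exists_isMaxOn (nonempty_Icc.2 h.le) hc.continuousOn
  have mono₁ := strictMonoOn_limitDiss hα₀ hα₁ hρ₁ (-u₁)
  rw [hB'] at mono₁
  refine ⟨u, hu, fun v hv => ?_⟩
  rcases lt_or_ge v B with h1 | h1
  · refine lt_of_lt_of_le ?_ (hmax (left_mem_Icc.2 h.le))
    have e1 := strictMonoOn_limitDiss hα₀ hα₁ hρ₀ u₀ (mem_Iic.2 (h1.trans h).le)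
      (mem_Iic.2 h.le) h1
    have e2 := limitDiss_nonpos hα₀ hα₁ hρ₁ (-u₁) (-v)
    have e3 := limitDiss_eq_zero hα₀ hα₁ hρ₁ hB'.le
    simp only [totalDiss]
    linarith
  rcases lt_or_ge A v with h2 | h2
  · refine lt_of_lt_of_le ?_ (hmax (right_mem_Icc.2 h.le))
    have e1 := mono₁ (mem_Iic.2 (by linarith : -v ≤ -B)) (mem_Iic.2 (by linarith : -A ≤ -B))
      (by linarith : -v < -A)
    have e2 := limitDiss_nonpos hα₀ hα₁ hρ₀ u₀ v
    have e3 := limitDiss_eq_zero hα₀ hα₁ hρ₀ hA.ge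
    simp only [totalDiss]
    linarith
  · have hmid : (1 / 2 : ℝ) * v + 1 / 2 * u ∈ Icc B A := by
      obtain ⟨u1, u2⟩ := hu
      constructor <;> linarith
    have c1 := (strictConcaveOn_limitDiss hα₀ hα₁ hρ₀ u₀).2 (mem_Iic.2 h2) (mem_Iic.2 hu.2) hv
      (half_pos one_pos) (half_pos one_pos) (by norm_num)
    have c2 := (strictConcaveOn_limitDiss hα₀ hα₁ hρ₁ (-u₁)).2
      (by rw [hB', mem_Iic]; linarith : -v ∈ _) (by rw [hB', mem_Iic]; linarith [hu.1] : -u ∈ _)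
      (by simpa using hv) (half_pos one_pos) (half_pos one_pos) (by norm_num)
    have c3 := hmax hmid
    simp only [smul_eq_mul, totalDiss, mem_ofPred_eq] at c1 c2 c3 ⊢
    rw [show (1 / 2 : ℝ) * -v + 1 / 2 * -u = -(1 / 2 * v + 1 / 2 * u) by ring] at c2
    linarith

end

end GenChaplygin

end

theorem mainTheorem4 (α ρ₀ u₀ ρ₁ u₁ ξ : ℝ) (hα₀ : 0 < α) (hα₁ : α < 1)
    (hρ₀ : 0 < ρ₀) (hρ₁ : 0 < ρ₁) (hξ : 0 < ξ) :
    ∃ uδ ∈ Set.Icc (min (GenChaplygin.A₂ α ρ₀ u₀) (GenChaplygin.B₁ α ρ₁ u₁))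
        (max (GenChaplygin.A₂ α ρ₀ u₀) (GenChaplygin.B₁ α ρ₁ u₁)),
      (∃ U : ℝ → ℝ → ℝ → ℝ → GenChaplygin.State, ∀ L > 0,
        GenChaplygin.BackwardEnergyCondition α L (ρ₀, u₀) (ρ₁, u₁) ξ uδ U) ∧
      ∀ L > 0, ∀ (v : ℝ) (V : ℝ → ℝ → ℝ → ℝ → GenChaplygin.State),
        GenChaplygin.BackwardEnergyCondition α L (ρ₀, u₀) (ρ₁, u₁) ξ v V →
          v = uδ ∧
          ∀ U : ℝ → ℝ → ℝ → ℝ → GenChaplygin.State,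
            GenChaplygin.BackwardEnergyCondition α L (ρ₀, u₀) (ρ₁, u₁) ξ uδ U →
              ∀ᶠ μ in nhdsWithin (0 : ℝ) (Set.Ioi 0), GenChaplygin.WeaklyEqual (U μ) (V μ) := by
  rcases le_or_gt (GenChaplygin.A₂ α ρ₀ u₀) (GenChaplygin.B₁ α ρ₁ u₁) with h | h
  · rw [min_eq_left h, max_eq_right h]
    have hu : max (GenChaplygin.A₂ α ρ₀ u₀) (min (GenChaplygin.B₁ α ρ₁ u₁) 0) ∈
        Set.Icc (GenChaplygin.A₂ α ρ₀ u₀) (GenChaplygin.B₁ α ρ₁ u₁) :=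
      ⟨le_max_left _ _, max_le h (min_le_left _ _)⟩
    refine ⟨_, hu, GenChaplygin.backwardEnergyCondition_of_isLeast hα₀ hα₁ hρ₀ hρ₁ hξ hu
      (fun v hv v' => ?_) (fun v hv => ?_) (fun v hv hne => ?_)⟩
    · by_cases h' : GenChaplygin.A₂ α ρ₀ u₀ ≤ v' ∧ v' ≤ GenChaplygin.B₁ α ρ₁ u₁
      · exact Or.inr (Or.inr ⟨h'.1, h'.2, hv.1, hv.2⟩)
      · left
        rw [GenChaplygin.totalDiss_eq_zero hα₀ hα₁ hρ₀ hρ₁ hv.1 hv.2]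
        exact GenChaplygin.totalDiss_neg hα₀ hα₁ hρ₀ hρ₁ h'
    · rw [GenChaplygin.totalDiss_eq_zero hα₀ hα₁ hρ₀ hρ₁ hu.1 hu.2]
      exact GenChaplygin.totalDiss_neg hα₀ hα₁ hρ₀ hρ₁ hv
    · obtain ⟨h1, h2⟩ := hv
      rcases le_total (GenChaplygin.B₁ α ρ₁ u₁) 0 with hB | hB
      · rw [min_eq_left hB, max_eq_right h] at hne ⊢
        nlinarith [lt_of_le_of_ne h2 hne]
      · rw [min_eq_right hB] at hne ⊢
        rcases le_total (GenChaplygin.A₂ α ρ₀ u₀) 0 with hA | hA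
        · rw [max_eq_right hA] at hne ⊢
          nlinarith [sq_pos_of_ne_zero hne]
        · rw [max_eq_left hA] at hne ⊢
          nlinarith [lt_of_le_of_ne h1 hne.symm]
  · rw [min_eq_right h.le, max_eq_left h.le]
    obtain ⟨u, hu, hmax⟩ := GenChaplygin.exists_unique_maximizer hα₀ hα₁ hρ₀ hρ₁ h
    refine ⟨u, hu, GenChaplygin.backwardEnergyCondition_of_isLeast hα₀ hα₁ hρ₀ hρ₁ hξ
      (M := {u}) rfl (fun v hv v' => ?_) (fun v hv => hmax v hv) fun v hv hne => absurd hv hne⟩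
    obtain rfl : v = u := hv
    by_cases h' : v' = v
    · exact Or.inr (Or.inl h')
    · exact Or.inl (hmax v' h')
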